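/- Let $\lambda\in\mathbb C$, let $\sqrt\lambda$ be the principal square root, let $\mathrm{Ai}$ be the Airy function, and put $A(x)=\sqrt{\lambda}\,\mathrm{Ai}(x)$. Let $$K(x,y)=\frac{A(x)A'(y)-A'(x)A(y)}{x-y}\quad(x\ne y),\qquad K(x,x)=A'(x)^2-xA(x)^2 ,$$ be the Airy kernel. For $m\ge 0$ and real $a_1<a_2<\dots<a_{2m}$ put $a=(a_1,\dots,a_{2m})$ and $J=\bigcup_{j=1}^m(a_{2j-1},a_{2j})$. Let $K$ also denote the operator $(Kf)(x)=\int_J K(x,y)f(y)\,dy$ on the complex-valued continuous functions on $\mathbb R$, and let $$D(a)=\det(I-K)=\sum_{n\ge 0}\frac{(-1)^n}{n!}\int_{J^n}\det\bigl(K(x_i,x_j)\bigr)_{i,j=1}^n\,dx_1\cdots dx_n$$ be the Fredholm determinant of $K$ acting on $J$. Suppose that $D(a)\neq 0$. Then $I-K$ is invertible. Put $R(x,y)=\bigl((I-K)^{-1}K(\cdot,y)\bigr)(x)$, $Q=(I-K)^{-1}A$, $P=(I-K)^{-1}A'$, and $$q_j=Q(a_j),\quad p_j=P(a_j),\quad u=\int_J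 A(x)Q(x)\,dx,\quad v=\int_J A(x)P(x)\,dx .$$ Then $R$ is the resolvent kernel, i.e. $\bigl(K(I-K)^{-1}f\bigr)(x)=\int_J R(x,y)f(y)\,dy$ for all continuous $f$ and all real $x$, with $R(a_j,a_k)=\lim_{y\to a_k,\,y\in J}R(a_j,y)$, and the following hold (all quantities are functions of $a$, all the derivatives written exist, and sums over $j,k$ run over $1,\dots,2m$ with the restrictions shown). (1) Near $a$, every continuous branch of $\log D$ is differentiable at $a$, with $$d_a\log D=-\sum_{j}(-1)^jR(a_j,a_j)\,da_j .$$ (2) For $j\ne k$, $$\frac{\partial q_j}{\partial a_k}=(-1)^k\frac{q_jp_k-p_jq_k}{a_j-a_k}\,q_k,\qquad \frac{\partial p_j}{\partial a_k}=(-1)^k\frac{q_jp_k-p_jq_k}{a_j-a_k}\,p_k .$$ (3) For every $j$, $$\frac{\partial q_j}{\partial a_j}=-\sum_{k\ne j}(-1)^k\frac{q_jp_k-p_jq_k}{a_j-a_k}\,q_k+p_j-q_ju,$$ $$\frac{\partial p_j}{\partial a_j}=-\sum_{k\ne j}(-1)^k\frac{q_jp_k-p_jq_k}{a_j-a_k}\,p_k+a_jq_j+p_ju-2q_jv,$$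 $$\frac{\partial u}{\partial a_j}=(-1)^jq_j^2,\qquad \frac{\partial v}{\partial a_j}=(-1)^jp_jq_j .$$ (4) For every $j$, $$R(a_j,a_j)=\sum_{k\ne j}(-1)^k\frac{(q_jp_k-p_jq_k)^2}{a_j-a_k}+p_j^2-a_jq_j^2-2p_jq_ju+2q_j^2v .$$ (5) $\displaystyle 2v-u^2=\sum_j(-1)^jq_j^2\quad$ and $\displaystyle\quad\sum_j(-1)^jR(a_j,a_j)=-u .$ -/

import Mathlib

noncomputable section

/-! ### The Airy function -/

/-- Maclaurin coefficients of the Airy function `Ai`: the values `Ai(0) = 3^{-2/3} / Γ(2/3)` and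
`Ai'(0) = -3^{-1/3} / Γ(1/3)`, and the recursion that expresses `Ai'' = x Ai`. -/
def airyCoeff : ℕ → ℝ
  | 0 => (3 : ℝ) ^ (-(2 / 3) : ℝ) / Real.Gamma (2 / 3)
  | 1 => -((3 : ℝ) ^ (-(1 / 3) : ℝ) / Real.Gamma (1 / 3))
  | 2 => 0
  | n + 3 => airyCoeff n / (((n : ℝ) + 3) * ((n : ℝ) + 2))

/-- The Airy function `Ai` on the real line, by its (everywhere convergent) Maclaurin series. -/
def airyAi (x : ℝ) : ℝ := ∑' n : ℕ, airyCoeff n * x ^ n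

theorem airyCoeff_bound (r : ℝ) (hr : 0 ≤ r) : ∃ C : ℝ, ∀ n, |airyCoeff n| * r ^ n ≤ C := by
  obtain ⟨N, hN⟩ := exists_nat_ge (r ^ 3)
  refine ⟨∑ i ∈ Finset.range (N + 3), |airyCoeff i| * r ^ i, fun n => ?_⟩
  induction n using Nat.strong_induction_on with
  | _ n ih =>
    by_cases hn : n < N + 3
    · exact Finset.single_le_sum (f := fun i => |airyCoeff i| * r ^ i)
        (fun i _ => by positivity) (Finset.mem_range.2 hn)
    · obtain ⟨k, rfl⟩ : ∃ k, n = k + 3 := ⟨n - 3, by omega⟩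
      refine le_trans ?_ (ih k (by omega))
      have hk : (N : ℝ) ≤ k := by exact_mod_cast (by omega : N ≤ k)
      have hk0 : (0 : ℝ) ≤ k := Nat.cast_nonneg k
      have hpos : (0 : ℝ) < ((k : ℝ) + 3) * ((k : ℝ) + 2) := by positivity
      have h1 : r ^ 3 ≤ ((k : ℝ) + 3) * ((k : ℝ) + 2) := by nlinarith
      rw [airyCoeff, abs_div, abs_of_pos hpos, pow_add]
      have h2 : 0 ≤ |airyCoeff k| * r ^ k := by positivity
      calc |airyCoeff k| / (((k : ℝ) + 3) * ((k : ℝ) + 2)) * (r ^ k * r ^ 3)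
          = (|airyCoeff k| * r ^ k) * (r ^ 3 / (((k : ℝ) + 3) * ((k : ℝ) + 2))) := by ring
        _ ≤ (|airyCoeff k| * r ^ k) * 1 :=
            mul_le_mul_of_nonneg_left ((div_le_one hpos).2 h1) h2
        _ = _ := mul_one _

theorem contDiff_airyAi {n : WithTop ℕ∞} : ContDiff ℝ n airyAi := by
  have hrad : (FormalMultilinearSeries.ofScalars ℝ airyCoeff).radius = ⊤ := by
    refine ENNReal.eq_top_of_forall_nnreal_le fun r => ?_
    obtain ⟨C, hC⟩ := airyCoeff_bound r r.2
    refine FormalMultilinearSeries.le_radius_of_bound _ C fun n => ?_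
    rw [FormalMultilinearSeries.ofScalars_norm]
    exact hC n
  have h := (FormalMultilinearSeries.ofScalars ℝ airyCoeff).hasFPowerSeriesOnBall
    (by rw [hrad]; exact ENNReal.zero_lt_top)
  have heq : (FormalMultilinearSeries.ofScalars ℝ airyCoeff).sum = airyAi := by
    funext x
    have := FormalMultilinearSeries.ofScalars_sum_eq (E := ℝ) airyCoeff x
    simpa [FormalMultilinearSeries.ofScalarsSum, airyAi] using this
  rw [heq, hrad] at h
  refine AnalyticOnNhd.contDiff fun x _ => ?_
  exact h.analyticAt_of_mem (by simp)

/-! ### The Airy kernel -/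

/-- `A(x) = √λ Ai(x)`. -/
def airyA (lam : ℂ) (x : ℝ) : ℂ := Complex.sqrt lam * (airyAi x : ℂ)

/-- The Airy kernel `(A(x) A'(y) - A'(x) A(y)) / (x - y)`, continued by its limit
`A'(x)² - A(x) A''(x) = A'(x)² - x A(x)²` to the diagonal. -/
def airyKernel (lam : ℂ) (x y : ℝ) : ℂ :=
  if x = y then
    deriv (airyA lam) x * deriv (airyA lam) x - airyA lam x * deriv (deriv (airyA lam)) x
  else
    (airyA lam x * deriv (airyA lam) y - deriv (airyA lam) x * airyA lam y) / ((x - y : ℝ) : ℂ)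

theorem contDiff_airyA (lam : ℂ) {n : WithTop ℕ∞} : ContDiff ℝ n (airyA lam) :=
  contDiff_const.mul (Complex.ofRealCLM.contDiff.comp contDiff_airyAi)

theorem contDiff_deriv_airyA (lam : ℂ) : ContDiff ℝ 1 (deriv (airyA lam)) :=
  ((contDiff_succ_iff_deriv (n := 1)).1 (contDiff_airyA lam)).2.2

/-- Integral form of the divided difference of a `C¹` function. -/
theorem integral_deriv_segment {f : ℝ → ℂ} (hf : ContDiff ℝ 1 f) (x y : ℝ) :
    ((x - y : ℝ) : ℂ) * ∫ t in (0 : ℝ)..1, deriv f (y + t * (x - y)) = f x - f y := by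
  have h : ∀ t ∈ Set.uIcc (0 : ℝ) 1, HasDerivAt (fun t : ℝ => f (y + t * (x - y)))
      (((x - y : ℝ) : ℂ) * deriv f (y + t * (x - y))) t := fun t _ => by
    have h1 : HasDerivAt (fun t : ℝ => y + t * (x - y)) (x - y) t := by
      simpa using ((hasDerivAt_id t).mul_const (x - y)).const_add y
    have h2 := (hf.differentiable one_ne_zero (y + t * (x - y))).hasDerivAt.scomp t h1
    simpa [Function.comp_def] using h2
  have hc : Continuous (deriv f) := hf.continuous_deriv le_rfl
  have h3 := intervalIntegral.integral_eq_sub_of_hasDerivAt h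
    (Continuous.intervalIntegrable (by fun_prop) _ _)
  rw [intervalIntegral.integral_const_mul] at h3
  simpa using h3

theorem continuous_integral_deriv_segment {f : ℝ → ℂ} (hf : ContDiff ℝ 1 f) :
    Continuous fun p : ℝ × ℝ => ∫ t in (0 : ℝ)..1, deriv f (p.2 + t * (p.1 - p.2)) := by
  have hc : Continuous (deriv f) := hf.continuous_deriv le_rfl
  exact intervalIntegral.continuous_parametric_intervalIntegral_of_continuous'
    (f := fun (p : ℝ × ℝ) (t : ℝ) => deriv f (p.2 + t * (p.1 - p.2)))
    (by simp only [Function.uncurry_def]; fun_prop) 0 1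

theorem continuous_airyKernel (lam : ℂ) :
    Continuous fun p : ℝ × ℝ => airyKernel lam p.1 p.2 := by
  have hA : ContDiff ℝ 1 (airyA lam) := contDiff_airyA lam
  have hA' := contDiff_deriv_airyA lam
  have key : (fun p : ℝ × ℝ => airyKernel lam p.1 p.2) = fun p =>
      deriv (airyA lam) p.1 * (∫ t in (0 : ℝ)..1, deriv (airyA lam) (p.2 + t * (p.1 - p.2)))
      - airyA lam p.1
        * (∫ t in (0 : ℝ)..1, deriv (deriv (airyA lam)) (p.2 + t * (p.1 - p.2))) := by
    funext ⟨x, y⟩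
    by_cases h : x = y
    · subst h
      simp [airyKernel]
    · have h0 : ((x - y : ℝ) : ℂ) ≠ 0 := Complex.ofReal_ne_zero.2 (sub_ne_zero.2 h)
      have e1 := integral_deriv_segment hA x y
      have e2 := integral_deriv_segment hA' x y
      simp only [airyKernel, h, if_false]
      rw [div_eq_iff h0]
      linear_combination airyA lam x * e2 - deriv (airyA lam) x * e1
  rw [key]
  exact ((hA'.continuous.comp continuous_fst).mul (continuous_integral_deriv_segment hA)).sub
    ((hA.continuous.comp continuous_fst).mul (continuous_integral_deriv_segment hA'))

/-! ### The domain, the Fredholm determinant and the operator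

The endpoints `a₁, …, a₂ₘ` are stored as `a : Fin (2 * m) → ℝ`, so that `aⱼ` is the value of `a` at
the index with underlying number `j - 1`. -/

/-- `J = ⋃ⱼ (a₂ⱼ₋₁, a₂ⱼ)`. -/
def airyDomain {m : ℕ} (a : Fin (2 * m) → ℝ) : Set ℝ :=
  ⋃ j : Fin m, Set.Ioo (a ⟨2 * j.val, by omega⟩) (a ⟨2 * j.val + 1, by omega⟩)

/-- The sign `(-1)^j` that belongs to the `j`-th endpoint, `1 ≤ j ≤ 2m`. -/
def endpointSign {n : ℕ} (j : Fin n) : ℂ := (-1) ^ (j.val + 1)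

/-- The Fredholm determinant `D(J; λ) = det (I - K)` of the Airy kernel acting on `J`. -/
def airyDet (lam : ℂ) {m : ℕ} (a : Fin (2 * m) → ℝ) : ℂ :=
  ∑' n : ℕ, (-1) ^ n / (n.factorial : ℂ) *
    ∫ x : Fin n → ℝ, (Matrix.of fun i j => airyKernel lam (x i) (x j)).det
      ∂(MeasureTheory.Measure.pi fun _ => MeasureTheory.volume.restrict (airyDomain a))

theorem continuous_airyOp (lam : ℂ) {m : ℕ} (a : Fin (2 * m) → ℝ) (f : C(ℝ, ℂ)) :
    Continuous fun x : ℝ => ∫ y in airyDomain a, airyKernel lam x y * f y := by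
  have hK := continuous_airyKernel lam
  have hJ : airyDomain a =ᵐ[MeasureTheory.volume]
      ⋃ j : Fin m, Set.Icc (a ⟨2 * j.val, by omega⟩) (a ⟨2 * j.val + 1, by omega⟩) :=
    Filter.EventuallyEq.countable_iUnion fun _ => MeasureTheory.Ioo_ae_eq_Icc
  simp_rw [MeasureTheory.setIntegral_congr_set hJ]
  exact continuous_parametric_integral_of_continuous
    (f := fun x y => airyKernel lam x y * f y)
    (hK.mul (f.continuous.comp continuous_snd))
    (isCompact_iUnion fun _ => isCompact_Icc)

theorem integrableOn_airyOp (lam : ℂ) {m : ℕ} (a : Fin (2 * m) → ℝ) (f : C(ℝ, ℂ)) (x : ℝ) :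
    MeasureTheory.IntegrableOn (fun y => airyKernel lam x y * f y) (airyDomain a) := by
  have hK : Continuous fun y => airyKernel lam x y :=
    (continuous_airyKernel lam).comp (by fun_prop : Continuous fun y : ℝ => (x, y))
  have hcont : Continuous fun y => airyKernel lam x y * f y := hK.mul f.continuous
  refine (hcont.continuousOn.integrableOn_compact
    (isCompact_iUnion fun j : Fin m => isCompact_Icc
      (a := a ⟨2 * j.val, by omega⟩) (b := a ⟨2 * j.val + 1, by omega⟩))).mono_set ?_
  exact Set.iUnion_mono fun _ => Set.Ioo_subset_Icc_self

/-- The operator `K` with kernel `K(x,y) χ_J(y)` on the continuous functions on the real line. -/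
def airyOp (lam : ℂ) {m : ℕ} (a : Fin (2 * m) → ℝ) : C(ℝ, ℂ) →ₗ[ℂ] C(ℝ, ℂ) where
  toFun f := ⟨fun x => ∫ y in airyDomain a, airyKernel lam x y * f y, continuous_airyOp lam a f⟩
  map_add' f g := by
    ext x
    simp only [ContinuousMap.coe_mk, ContinuousMap.add_apply, mul_add]
    exact MeasureTheory.integral_add (integrableOn_airyOp lam a f x)
      (integrableOn_airyOp lam a g x)
  map_smul' c f := by
    ext x
    simp only [ContinuousMap.coe_mk, ContinuousMap.smul_apply, RingHom.id_apply, smul_eq_mul]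
    rw [← MeasureTheory.integral_const_mul]
    exact MeasureTheory.integral_congr_ae (Filter.Eventually.of_forall fun y => by ring)

/-- `(I - K)⁻¹` (the inverse in the ring of linear endomorphisms; it is the zero map when `I - K`
is not invertible). -/
def airyInv (lam : ℂ) {m : ℕ} (a : Fin (2 * m) → ℝ) : Module.End ℂ C(ℝ, ℂ) :=
  Ring.inverse (1 - airyOp lam a)

/-! ### The quantities `R(x,y)`, `qⱼ`, `pⱼ`, `u`, `v` -/

/-- The resolvent kernel `R(x,y)`, that is, the kernel of `K (I - K)⁻¹ = (I - K)⁻¹ K`: the operator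
`(I - K)⁻¹` applied to `K(·, y)`, evaluated at `x`. For `y ∈ J` it is the kernel with respect to
integration over `J`, and for `y` an endpoint of `J` it is the limit from inside `J`. -/
def airyR (lam : ℂ) {m : ℕ} (a : Fin (2 * m) → ℝ) (x y : ℝ) : ℂ :=
  airyInv lam a ⟨fun z => airyKernel lam z y,
    (continuous_airyKernel lam).comp (by fun_prop : Continuous fun z : ℝ => (z, y))⟩ x

/-- `Q = (I - K)⁻¹ A`. -/
def airyQ (lam : ℂ) {m : ℕ} (a : Fin (2 * m) → ℝ) : C(ℝ, ℂ) :=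
  airyInv lam a ⟨airyA lam, (contDiff_airyA lam (n := 0)).continuous⟩

/-- `P = (I - K)⁻¹ A'`. -/
def airyP (lam : ℂ) {m : ℕ} (a : Fin (2 * m) → ℝ) : C(ℝ, ℂ) :=
  airyInv lam a ⟨deriv (airyA lam), (contDiff_deriv_airyA lam).continuous⟩

/-- `qⱼ = (I - K)⁻¹ A (aⱼ)`. -/
def airyq (lam : ℂ) {m : ℕ} (j : Fin (2 * m)) (a : Fin (2 * m) → ℝ) : ℂ := airyQ lam a (a j)

/-- `pⱼ = (I - K)⁻¹ A' (aⱼ)`. -/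
def airyp (lam : ℂ) {m : ℕ} (j : Fin (2 * m)) (a : Fin (2 * m) → ℝ) : ℂ := airyP lam a (a j)

/-- `u = (A, (I - K)⁻¹ A)`, the bilinear pairing over `J`. -/
def airyu (lam : ℂ) {m : ℕ} (a : Fin (2 * m) → ℝ) : ℂ :=
  ∫ x in airyDomain a, airyA lam x * airyQ lam a x

/-- `v = (A, (I - K)⁻¹ A')`, the bilinear pairing over `J`. -/
def airyv (lam : ℂ) {m : ℕ} (a : Fin (2 * m) → ℝ) : ℂ :=
  ∫ x in airyDomain a, airyA lam x * airyP lam a x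

end

/-!
Everything rests on Fredholm's resolvent kernel `R = N / D`, where `D` is the Fredholm determinant
and `N` is the first minor, the series of the integrals of `det (K (xᵢ, xⱼ))` bordered by a row `x`
and a column `y`. Hadamard's inequality (`norm_det_le_of_entries`) makes both series converge, `N`
locally uniformly, so that `N` is continuous. Expanding the bordered determinant along its first
row gives `N = D K + K N` (`fredholmMinor_eq`). Hence, if `D ≠ 0`, the operator with kernel `N / D`
is `K (I - K)⁻¹` (`airyInv_eq`, `airyR_eq_airyResolvent`); in particular `I - K` is invertible and
`R` is continuous and symmetric.

The remaining assertions use two commutators of `K`. As `(x - y) K(x, y)` is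
`A(x) A'(y) - A'(x) A(y)`, the commutator with multiplication by the variable has rank two; this
gives `(x - y) R(x, y) = Q(x) P(y) - P(x) Q(y)` (`sub_mul_airyR`) and determines
`(I - K)⁻¹ (x A)` (`airyInv_id_mul_airyA`). Airy's equation `A'' = x A` gives
`(∂ₓ + ∂ᵧ) K(x, y) = -A(x) A(y)` (`airyKernelDeriv_add`), so that the commutator with
differentiation consists of a rank-one term and of boundary terms at the endpoints
(`hasDerivAt_airyInv`). Together they express `Q'` and `P'` by `Q`, `P`, `u`, `v` and `R(x, aₖ)`,
and `R(x, x) = Q'(x) P(x) - P'(x) Q(x)` (`airyR_diag`) yields the values of `R(aⱼ, aⱼ)`.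

The dependence on an endpoint is governed by the resolvent identity for two domains that differ in
one endpoint (`airyInv_update`). Its integral over the short interval between the old and the new
endpoint is differentiated by means of the joint continuity of `(I - K)⁻¹ f` in the endpoint and the
point (`continuousAt_airyInv_update`). If the point of evaluation is the moving endpoint itself, the
derivative of `Q` or `P` is added, and the terms with `R(aⱼ, aⱼ)` cancel.

For `log D`, the determinant is expanded to first order in the indicator function of the domain,
with an error that is quadratic in the `L¹` distance (`exists_norm_fredholmDet_sub_le`). The linear
term is `-∫ N(s, s)` over the difference of the domains, and `N(s, s) = D R(s, s)`
(`hasFDerivAt_airyDet`).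

The relation for `2 v - u²` comes from integrating `(A Q)'` over `J` (`two_mul_airyv_sub`), that for
the sum of the `R(aⱼ, aⱼ)` from integrating the derivatives of `K(x, x)` and of `R(x, x) - K(x, x)`
(`sum_endpointSign_mul_airyR`).
-/

noncomputable section

open MeasureTheory Filter Topology

/-! ### Hadamard's inequality -/

open scoped ComplexOrder in
/-- Hadamard's inequality for a matrix with bounded entries: the inequality between the geometric
and the arithmetic mean, applied to the eigenvalues of `A Aᴴ`. -/
theorem norm_det_le_of_entries {n : ℕ} (A : Matrix (Fin n) (Fin n) ℂ) {M : ℝ}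
    (hA : ∀ i j, ‖A i j‖ ≤ M) : ‖A.det‖ ≤ M ^ n * √((n : ℝ) ^ n) := by
  rcases Nat.eq_zero_or_pos n with rfl | hn
  · simp
  have hM : 0 ≤ M := (norm_nonneg _).trans (hA ⟨0, hn⟩ ⟨0, hn⟩)
  have hn' : (0 : ℝ) < n := by exact_mod_cast hn
  have hG := Matrix.posSemidef_self_mul_conjTranspose A
  have hdet : ((‖A.det‖ ^ 2 : ℝ) : ℂ) = ((∏ i, hG.isHermitian.eigenvalues i : ℝ) : ℂ) := by
    have h := hG.isHermitian.det_eq_prod_eigenvalues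
    rw [Matrix.det_mul, Matrix.det_conjTranspose, Complex.star_def, Complex.mul_conj,
      Complex.normSq_eq_norm_sq] at h
    rw [h]; push_cast; rfl
  have hdet' : ‖A.det‖ ^ 2 = ∏ i, hG.isHermitian.eigenvalues i := by exact_mod_cast hdet
  have htr : ∑ i, hG.isHermitian.eigenvalues i ≤ n * (n * M ^ 2) := by
    have h := hG.isHermitian.trace_eq_sum_eigenvalues
    have h2 : ((∑ i, hG.isHermitian.eigenvalues i : ℝ) : ℂ)
        = ((∑ i, ∑ j, ‖A i j‖ ^ 2 : ℝ) : ℂ) := by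
      push_cast
      refine Eq.trans h.symm ?_
      simp only [Matrix.trace, Matrix.diag, Matrix.mul_apply, Matrix.conjTranspose_apply,
        Complex.star_def, Complex.mul_conj, Complex.normSq_eq_norm_sq]
      push_cast; rfl
    have h3 : ∑ i, hG.isHermitian.eigenvalues i = ∑ i, ∑ j, ‖A i j‖ ^ 2 := by exact_mod_cast h2
    rw [h3]
    calc ∑ i, ∑ j, ‖A i j‖ ^ 2 ≤ ∑ _i : Fin n, ∑ _j : Fin n, M ^ 2 := by
          gcongr; exact hA _ _
      _ = _ := by simp
  have h0 : ∀ i, 0 ≤ hG.isHermitian.eigenvalues i := hG.eigenvalues_nonneg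
  have hgm := Real.geom_mean_le_arith_mean Finset.univ (fun _ : Fin n => (1 : ℝ))
    hG.isHermitian.eigenvalues (by simp) (by simpa using hn) (fun i _ => h0 i)
  simp only [Real.rpow_one, Finset.sum_const, Finset.card_univ, Fintype.card_fin, nsmul_eq_mul,
    mul_one, one_mul] at hgm
  have hP : 0 ≤ ∏ i, hG.isHermitian.eigenvalues i := Finset.prod_nonneg fun i _ => h0 i
  have h4 : ∏ i, hG.isHermitian.eigenvalues i ≤ (n * M ^ 2) ^ n := by
    have h5 : (∏ i, hG.isHermitian.eigenvalues i) ^ ((n : ℝ)⁻¹) ≤ n * M ^ 2 :=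
      hgm.trans ((div_le_iff₀ hn').2 (by linarith))
    calc _ = ((∏ i, hG.isHermitian.eigenvalues i) ^ ((n : ℝ)⁻¹)) ^ n :=
          (Real.rpow_inv_natCast_pow hP hn.ne').symm
      _ ≤ _ := pow_le_pow_left₀ (Real.rpow_nonneg hP _) h5 n
  refine (abs_le_of_sq_le_sq' ?_ (by positivity)).2
  rw [hdet', mul_pow, Real.sq_sqrt (by positivity)]
  exact h4.trans (le_of_eq (by rw [mul_pow, ← pow_mul, ← pow_mul]; ring))

/-- Under the bound of Hadamard's inequality, Fredholm's series converges: as `nⁿ ≤ eⁿ n!`, the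
square of the `n`-th term is at most `(C² e)ⁿ / n!`. -/
theorem summable_pow_mul_sqrt_div_factorial (C : ℝ) :
    Summable fun n : ℕ => C ^ n * √((n : ℝ) ^ n) / n.factorial := by
  set e := Real.exp 1
  have hb : ∀ n : ℕ, ‖C ^ n * √((n : ℝ) ^ n) / n.factorial‖
      ≤ (1 / 2) ^ n + (2 * C ^ 2 * e) ^ n / n.factorial := fun n => by
    have hf : (0 : ℝ) < n.factorial := by positivity
    have h1 : (n : ℝ) ^ n ≤ e ^ n * n.factorial := by
      have := Real.pow_div_factorial_le_exp (n : ℝ) (Nat.cast_nonneg n) n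
      rw [div_le_iff₀ hf] at this
      rwa [← Real.exp_nat_mul, mul_one]
    set s := |C| ^ n * √((n : ℝ) ^ n) / n.factorial
    have hs : s ^ 2 ≤ (C ^ 2 * e) ^ n / n.factorial := by
      rw [div_pow, mul_pow, Real.sq_sqrt (by positivity), div_le_div_iff₀ (by positivity) hf,
        ← pow_mul, mul_comm n 2, pow_mul, sq_abs, mul_pow]
      have : 0 ≤ (C ^ 2) ^ n := by positivity
      calc (C ^ 2) ^ n * (n : ℝ) ^ n * n.factorial
          ≤ (C ^ 2) ^ n * (e ^ n * n.factorial) * n.factorial := by gcongr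
        _ = _ := by ring
    have h2 : ‖C ^ n * √((n : ℝ) ^ n) / n.factorial‖ = s := by
      rw [norm_div, norm_mul, norm_pow, Real.norm_eq_abs, Real.norm_of_nonneg (Real.sqrt_nonneg _),
        Real.norm_of_nonneg hf.le]
    rw [h2]
    -- weighted inequality between the means: `2 s ≤ 2⁻ⁿ + 2ⁿ s²`
    have h3 : (1 / 2 : ℝ) ^ n * 2 ^ n = 1 := by rw [← mul_pow]; norm_num
    have h4 : (2 * C ^ 2 * e) ^ n / n.factorial = 2 ^ n * ((C ^ 2 * e) ^ n / n.factorial) := by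
      rw [mul_assoc, mul_pow 2]; ring
    have h5 : (0 : ℝ) < 2 ^ n := by positivity
    have h6 : (0 : ℝ) < (1 / 2) ^ n := by positivity
    rw [h4]
    have h7 : 2 ^ n * s ^ 2 ≤ 2 ^ n * ((C ^ 2 * e) ^ n / n.factorial) := by gcongr
    have h8 : 0 ≤ 2 ^ n * (s - (1 / 2) ^ n) ^ 2 := by positivity
    have h9 : 2 ^ n * (s - (1 / 2) ^ n) ^ 2 = 2 ^ n * s ^ 2 - 2 * s + (1 / 2) ^ n := by
      linear_combination (-2 * s + (1 / 2) ^ n) * h3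
    have hs0 : 0 ≤ s := by positivity
    linarith
  refine Summable.of_norm_bounded ?_ hb
  exact (summable_geometric_of_lt_one (by norm_num) (by norm_num)).add
    (Real.summable_pow_div_factorial _)

/-! ### Integrals of continuous functions against finite measures carried by a compact set

A measure `μ` is carried by `C` if `∀ᵐ y ∂μ, y ∈ C`. The measures in question are restrictions of
Lebesgue measure to bounded, not closed, sets; `C` is any compact set that contains them. -/

section CompactlyCarried

variable {X Y E : Type*} [TopologicalSpace X] [TopologicalSpace Y] [MeasurableSpace Y]
  [BorelSpace Y] [NormedAddCommGroup E] {μ : Measure Y} [IsFiniteMeasure μ]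
  {C : Set Y}

theorem integrable_of_continuous_of_carried [T2Space Y] [SecondCountableTopology Y]
    (hC : IsCompact C) (hμ : ∀ᵐ y ∂μ, y ∈ C)
    {h : Y → E} (hh : Continuous h) : Integrable h μ := by
  rw [← Measure.restrict_eq_self_of_ae_mem hμ]
  exact hh.continuousOn.integrableOn_compact hC

theorem continuous_integral_of_carried [NormedSpace ℝ E] [FirstCountableTopology X]
    [LocallyCompactSpace X] [SecondCountableTopology Y]
    (hC : IsCompact C) (hμ : ∀ᵐ y ∂μ, y ∈ C) {f : X → Y → E}
    (hf : Continuous fun p : X × Y => f p.1 p.2) : Continuous fun x => ∫ y, f x y ∂μ := by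
  rw [← Measure.restrict_eq_self_of_ae_mem hμ]
  exact continuous_parametric_integral_of_continuous (f := f) hf hC

end CompactlyCarried

theorem ae_mem_pi {μ : Measure ℝ} [IsFiniteMeasure μ] {C : Set ℝ} (hμ : ∀ᵐ y ∂μ, y ∈ C) (n : ℕ) :
    ∀ᵐ t ∂(Measure.pi fun _ : Fin n => μ), t ∈ Set.univ.pi fun _ : Fin n => C := by
  simp only [Set.mem_univ_pi]
  exact eventually_all.2 fun i => Measure.tendsto_eval_ae_ae.eventually hμ

theorem isCompact_pi {C : Set ℝ} (hC : IsCompact C) (n : ℕ) :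
    IsCompact (Set.univ.pi fun _ : Fin n => C) := isCompact_univ_pi fun _ => hC

theorem integral_integral_swap_of_carried {μ ν : Measure ℝ} [IsFiniteMeasure μ] [IsFiniteMeasure ν]
    {C C' : Set ℝ}
    (hC : IsCompact C) (hμ : ∀ᵐ y ∂μ, y ∈ C) (hC' : IsCompact C') (hν : ∀ᵐ y ∂ν, y ∈ C')
    {f : ℝ → ℝ → ℂ} (hf : Continuous fun p : ℝ × ℝ => f p.1 p.2) :
    ∫ x, ∫ y, f x y ∂ν ∂μ = ∫ y, ∫ x, f x y ∂μ ∂ν := by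
  refine integral_integral_swap (integrable_of_continuous_of_carried (hC.prod hC') ?_ hf)
  exact (Measure.ae_prod_mem_iff_ae_ae_mem (hC.prod hC').measurableSet).2
    (hμ.mono fun x hx => hν.mono fun y hy => ⟨hx, hy⟩)

theorem ae_mem_prod_pi {μ : Measure ℝ} [IsFiniteMeasure μ] {C : Set ℝ} (hC : IsCompact C)
    (hμ : ∀ᵐ y ∂μ, y ∈ C) (n : ℕ) :
    ∀ᵐ p ∂(μ.prod (Measure.pi fun _ : Fin n => μ)), p ∈ C ×ˢ Set.univ.pi fun _ : Fin n => C :=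
  (Measure.ae_prod_mem_iff_ae_ae_mem (hC.prod (isCompact_pi hC n)).measurableSet).2
    (hμ.mono fun _ hx => (ae_mem_pi hμ n).mono fun _ hy => ⟨hx, hy⟩)

/-- Fubini's theorem, with the `i`-th of `n + 1` variables split off. -/
theorem integral_pi_succAbove {μ : Measure ℝ} [IsFiniteMeasure μ] {n : ℕ} (i : Fin (n + 1))
    {f : ℝ → (Fin n → ℝ) → ℂ}
    (hf : Integrable (fun p : ℝ × (Fin n → ℝ) => f p.1 p.2)
      (μ.prod (Measure.pi fun _ : Fin n => μ))) :
    ∫ t : Fin (n + 1) → ℝ, f (t i) (fun j => t (i.succAbove j)) ∂(Measure.pi fun _ => μ)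
      = ∫ s, ∫ t, f s t ∂(Measure.pi fun _ : Fin n => μ) ∂μ :=
  ((measurePreserving_piFinSuccAbove (fun _ : Fin (n + 1) => μ) i).integral_comp'
    (fun p : ℝ × (Fin n → ℝ) => f p.1 p.2)).trans (integral_prod _ hf)

/-! ### Fredholm's series -/

/-- The determinant `det (k (xᵢ, yⱼ))`. -/
def kernelDet (k : ℝ → ℝ → ℂ) {n : ℕ} (x y : Fin n → ℝ) : ℂ :=
  (Matrix.of fun i j => k (x i) (y j)).det

theorem continuous_kernelDet {k : ℝ → ℝ → ℂ} (hk : Continuous fun p : ℝ × ℝ => k p.1 p.2) (n : ℕ) :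
    Continuous fun p : (Fin n → ℝ) × (Fin n → ℝ) => kernelDet k p.1 p.2 := by
  unfold kernelDet
  refine Continuous.matrix_det (continuous_matrix fun i j => ?_)
  exact hk.comp (by fun_prop : Continuous fun p : (Fin n → ℝ) × (Fin n → ℝ) => (p.1 i, p.2 j))

theorem norm_kernelDet_le {k : ℝ → ℝ → ℂ} {S : Set ℝ} {M : ℝ}
    (hM : ∀ x ∈ S, ∀ y ∈ S, ‖k x y‖ ≤ M) {n : ℕ} {x y : Fin n → ℝ} (hx : ∀ i, x i ∈ S)
    (hy : ∀ i, y i ∈ S) : ‖kernelDet k x y‖ ≤ M ^ n * √((n : ℝ) ^ n) :=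
  norm_det_le_of_entries _ fun i j => hM _ (hx i) _ (hy j)

/-- For a symmetric kernel, the transposed matrix belongs to the exchanged variables. -/
theorem kernelDet_swap {k : ℝ → ℝ → ℂ} (hsymm : ∀ x y, k x y = k y x) {n : ℕ} (x y : Fin n → ℝ) :
    kernelDet k x y = kernelDet k y x := by
  unfold kernelDet
  rw [← Matrix.det_transpose]
  congr 1
  ext i j
  simp [hsymm (x j) (y i)]

/-- A simultaneous permutation of rows and columns: the `i`-th variable is moved to the front. -/
theorem kernelDet_cons_removeNth (k : ℝ → ℝ → ℂ) {n : ℕ} (i : Fin (n + 1)) (t : Fin (n + 1) → ℝ) :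
    kernelDet k (Fin.cons (t i) (fun j => t (i.succAbove j)) : Fin (n + 1) → ℝ)
      (Fin.cons (t i) (fun j => t (i.succAbove j)) : Fin (n + 1) → ℝ) = kernelDet k t t := by
  have h : t = (Fin.cons (t i) (fun j => t (i.succAbove j)) : Fin (n + 1) → ℝ) ∘ i.cycleRange := by
    rw [Fin.cons_comp_cycleRange]
    exact (Fin.insertNth_self_removeNth i t).symm
  conv_rhs => rw [h]
  exact (Matrix.det_submatrix_equiv_self i.cycleRange _).symm

/-- Expansion of a bordered determinant along its first row; in each cofactor, the row of the
variable `t i` is moved to the front. -/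
theorem kernelDet_cons_expand (k : ℝ → ℝ → ℂ) {n : ℕ} (x y : ℝ) (t : Fin (n + 1) → ℝ) :
    kernelDet k (Fin.cons x t : Fin (n + 2) → ℝ) (Fin.cons y t : Fin (n + 2) → ℝ)
      = k x y * kernelDet k t t - ∑ i, k x (t i) *
        kernelDet k (Fin.cons (t i) (fun j => t (i.succAbove j)) : Fin (n + 1) → ℝ)
          (Fin.cons y (fun j => t (i.succAbove j)) : Fin (n + 1) → ℝ) := by
  unfold kernelDet
  rw [Matrix.det_succ_row_zero, Fin.sum_univ_succ, sub_eq_add_neg, ← Finset.sum_neg_distrib]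
  congr 1
  · simp only [Fin.val_zero, pow_zero, one_mul, Matrix.of_apply, Fin.cons_zero]
    congr 2
  · refine Finset.sum_congr rfl fun i _ => ?_
    have h : t = (Fin.cons (t i) (fun j => t (i.succAbove j)) : Fin (n + 1) → ℝ)
        ∘ i.cycleRange := by
      rw [Fin.cons_comp_cycleRange]
      exact (Fin.insertNth_self_removeNth i t).symm
    have hcol : ∀ j, (Fin.cons y t : Fin (n + 2) → ℝ) (i.succ.succAbove j)
        = (Fin.cons y (fun j => t (i.succAbove j)) : Fin (n + 1) → ℝ) j := fun j => by
      refine Fin.cases ?_ (fun j => ?_) j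
      · simp
      · simp [Fin.succ_succAbove_succ]
    have hdet := Matrix.det_permute i.cycleRange (Matrix.of fun a b : Fin (n + 1) =>
      k ((Fin.cons (t i) (fun j => t (i.succAbove j)) : Fin (n + 1) → ℝ) a)
        ((Fin.cons y (fun j => t (i.succAbove j)) : Fin (n + 1) → ℝ) b))
    have hsub : (Matrix.of fun a b : Fin (n + 2) => k ((Fin.cons x t : Fin (n + 2) → ℝ) a)
        ((Fin.cons y t : Fin (n + 2) → ℝ) b)).submatrix Fin.succ i.succ.succAbove
        = (Matrix.of fun a b : Fin (n + 1) =>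
      k ((Fin.cons (t i) (fun j => t (i.succAbove j)) : Fin (n + 1) → ℝ) a)
        ((Fin.cons y (fun j => t (i.succAbove j)) : Fin (n + 1) → ℝ) b)).submatrix
          i.cycleRange id := by
      ext a b
      simp only [Matrix.submatrix_apply, Matrix.of_apply, Fin.cons_succ, hcol, id]
      exact congrArg₂ k (congrFun h a) rfl
    rw [hsub, hdet, Fin.sign_cycleRange]
    simp only [Matrix.of_apply, Fin.cons_zero, Fin.cons_succ, Fin.val_succ]
    push_cast
    have hs : ((-1 : ℂ) ^ (i : ℕ)) * (-1) ^ (i : ℕ) = 1 := by rw [← mul_pow]; simp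
    rw [pow_succ]
    linear_combination (-k x (t i) * (Matrix.of fun a b : Fin (n + 1) =>
      k ((Fin.cons (t i) (fun j => t (i.succAbove j)) : Fin (n + 1) → ℝ) a)
        ((Fin.cons y (fun j => t (i.succAbove j)) : Fin (n + 1) → ℝ) b)).det) * hs

/-- `∫ det (k (tᵢ, tⱼ)) dμ(t₁) ⋯ dμ(tₙ)`, the coefficient of `(-1)ⁿ / n!` in Fredholm's series. -/
def fredholmTrace (k : ℝ → ℝ → ℂ) (μ : Measure ℝ) (n : ℕ) : ℂ :=
  ∫ t : Fin n → ℝ, kernelDet k t t ∂(Measure.pi fun _ => μ)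

/-- The coefficient of `(-1)ⁿ / n!` in the series of Fredholm's first minor. -/
def fredholmMinorCoeff (k : ℝ → ℝ → ℂ) (μ : Measure ℝ) (n : ℕ) (x y : ℝ) : ℂ :=
  ∫ t : Fin n → ℝ, kernelDet k (Fin.cons x t : Fin (n + 1) → ℝ) (Fin.cons y t : Fin (n + 1) → ℝ)
    ∂(Measure.pi fun _ => μ)

/-- The Fredholm determinant of the integral operator with kernel `k` on `L²(μ)`. -/
def fredholmDet (k : ℝ → ℝ → ℂ) (μ : Measure ℝ) : ℂ :=
  ∑' n : ℕ, (-1) ^ n / (n.factorial : ℂ) * fredholmTrace k μ n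

/-- Fredholm's first minor: the numerator of the resolvent kernel, whose denominator is the
Fredholm determinant. -/
def fredholmMinor (k : ℝ → ℝ → ℂ) (μ : Measure ℝ) (x y : ℝ) : ℂ :=
  ∑' n : ℕ, (-1) ^ n / (n.factorial : ℂ) * fredholmMinorCoeff k μ n x y

theorem fredholmMinor_symm {k : ℝ → ℝ → ℂ} (μ : Measure ℝ)
    (hsymm : ∀ x y, k x y = k y x) (x y : ℝ) :
    fredholmMinor k μ x y = fredholmMinor k μ y x := by
  unfold fredholmMinor fredholmMinorCoeff
  simp_rw [kernelDet_swap hsymm (Fin.cons x _) (Fin.cons y _)]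

section Fredholm

variable {k : ℝ → ℝ → ℂ} {μ : Measure ℝ} [IsFiniteMeasure μ] {C : Set ℝ} {M : ℝ}

theorem measureReal_pi_univ (n : ℕ) :
    (Measure.pi fun _ : Fin n => μ).real Set.univ = μ.real Set.univ ^ n := by
  simp [measureReal_def, Measure.pi_univ]

theorem exists_bound_on_prod (hk : Continuous fun p : ℝ × ℝ => k p.1 p.2) (hC : IsCompact C) :
    ∃ M, 0 ≤ M ∧ ∀ x ∈ C, ∀ y ∈ C, ‖k x y‖ ≤ M := by
  obtain ⟨M, hM⟩ := (hC.prod hC).exists_bound_of_continuousOn hk.continuousOn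
  exact ⟨max M 0, le_max_right _ _, fun x hx y hy => (hM (x, y) ⟨hx, hy⟩).trans (le_max_left _ _)⟩

theorem norm_fredholmTrace_le (hμ : ∀ᵐ y ∂μ, y ∈ C) (hM : ∀ x ∈ C, ∀ y ∈ C, ‖k x y‖ ≤ M) (n : ℕ) :
    ‖fredholmTrace k μ n‖ ≤ M ^ n * √((n : ℝ) ^ n) * μ.real Set.univ ^ n := by
  rw [← measureReal_pi_univ]
  refine norm_integral_le_of_norm_le_const ((ae_mem_pi hμ n).mono fun t ht => ?_)
  exact norm_kernelDet_le hM (fun i => ht i trivial) (fun i => ht i trivial)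

theorem norm_fredholmMinorCoeff_le (hμ : ∀ᵐ y ∂μ, y ∈ C) (hM : ∀ x ∈ C, ∀ y ∈ C, ‖k x y‖ ≤ M)
    (n : ℕ) {x y : ℝ} (hx : x ∈ C) (hy : y ∈ C) :
    ‖fredholmMinorCoeff k μ n x y‖
      ≤ M ^ (n + 1) * √(((n + 1 : ℕ) : ℝ) ^ (n + 1)) * μ.real Set.univ ^ n := by
  rw [← measureReal_pi_univ]
  refine norm_integral_le_of_norm_le_const ((ae_mem_pi hμ n).mono fun t ht => ?_)
  refine norm_kernelDet_le hM (fun i => ?_) (fun i => ?_)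
  · exact Fin.cases (by simpa) (fun j => by simpa using ht j trivial) i
  · exact Fin.cases (by simpa) (fun j => by simpa using ht j trivial) i

/-- The terms of the series of the first minor are dominated by a summable sequence, uniformly on
a compact set. -/
theorem exists_summable_bound_minor (hk : Continuous fun p : ℝ × ℝ => k p.1 p.2) (hC : IsCompact C)
    (hμ : ∀ᵐ y ∂μ, y ∈ C) : ∃ u : ℕ → ℝ, Summable u ∧ ∀ n, ∀ x ∈ C, ∀ y ∈ C,
      ‖(-1) ^ n / (n.factorial : ℂ) * fredholmMinorCoeff k μ n x y‖ ≤ u n := by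
  obtain ⟨M, hM0, hM⟩ := exists_bound_on_prod hk hC
  set V := μ.real Set.univ
  have hV : 0 ≤ V := measureReal_nonneg
  -- A term has `n!` in the denominator but a determinant of size `n + 1` in the numerator; the
  -- missing factor `n + 1 ≤ 2 ^ (n + 1)` is absorbed by the constant.
  refine ⟨fun n => (2 * M * (V + 1)) ^ (n + 1) * √(((n + 1 : ℕ) : ℝ) ^ (n + 1)) /
    (n + 1).factorial, (summable_nat_add_iff 1).2 (summable_pow_mul_sqrt_div_factorial
    (2 * M * (V + 1))), fun n x hx y hy => ?_⟩
  have h1 := norm_fredholmMinorCoeff_le hμ hM n hx hy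
  have h2 : ((n + 1 : ℕ) : ℝ) ≤ 2 ^ (n + 1) := by exact_mod_cast Nat.lt_two_pow_self.le
  have h3 : V ^ n ≤ (V + 1) ^ (n + 1) :=
    (pow_le_pow_left₀ hV (by linarith) n).trans
      (pow_le_pow_right₀ (by linarith) (Nat.le_succ n))
  have hf : (0 : ℝ) < n.factorial := by positivity
  beta_reduce
  rw [norm_mul, norm_div, norm_pow, norm_neg, norm_one, one_pow, Complex.norm_natCast,
    Nat.factorial_succ]
  push_cast at h2 ⊢
  rw [div_mul_eq_mul_div, one_mul, div_le_div_iff₀ hf (by positivity), mul_pow, mul_pow]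
  push_cast at h1
  calc ‖fredholmMinorCoeff k μ n x y‖ * ((n + 1) * n.factorial)
      ≤ (M ^ (n + 1) * √(((n : ℝ) + 1) ^ (n + 1)) * (V + 1) ^ (n + 1))
        * (2 ^ (n + 1) * n.factorial) := by
        gcongr
        exact h1.trans (by gcongr)
    _ = _ := by ring

theorem summable_fredholmTrace (hk : Continuous fun p : ℝ × ℝ => k p.1 p.2) (hC : IsCompact C)
    (hμ : ∀ᵐ y ∂μ, y ∈ C) :
    Summable fun n : ℕ => (-1) ^ n / (n.factorial : ℂ) * fredholmTrace k μ n := by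
  obtain ⟨M, hM0, hM⟩ := exists_bound_on_prod hk hC
  refine Summable.of_norm_bounded
    (summable_pow_mul_sqrt_div_factorial (M * μ.real Set.univ)) fun n => ?_
  have h1 := norm_fredholmTrace_le hμ hM n
  rw [norm_mul, norm_div, norm_pow, norm_neg, norm_one, one_pow, Complex.norm_natCast,
    div_mul_eq_mul_div, one_mul]
  gcongr
  exact h1.trans (le_of_eq (by rw [mul_pow]; ring))

theorem summable_fredholmMinor (hk : Continuous fun p : ℝ × ℝ => k p.1 p.2) (hC : IsCompact C)
    (hμ : ∀ᵐ y ∂μ, y ∈ C) (x y : ℝ) :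
    Summable fun n : ℕ => (-1) ^ n / (n.factorial : ℂ) * fredholmMinorCoeff k μ n x y := by
  -- The carrier is enlarged by `x` and `y`, which may lie outside `C`.
  obtain ⟨u, hu, hb⟩ := exists_summable_bound_minor hk (hC.union (Set.toFinite {x, y}).isCompact)
    (hμ.mono fun y hy => Or.inl hy)
  exact Summable.of_norm_bounded hu fun n => hb n x (by simp) y (by simp)

theorem continuous_kernelDet_cons (hk : Continuous fun p : ℝ × ℝ => k p.1 p.2) (n : ℕ) :
    Continuous fun p : (ℝ × ℝ) × (Fin n → ℝ) => kernelDet k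
      (Fin.cons p.1.1 p.2 : Fin (n + 1) → ℝ) (Fin.cons p.1.2 p.2 : Fin (n + 1) → ℝ) := by
  have h1 : Continuous fun p : (ℝ × ℝ) × (Fin n → ℝ) => (Fin.cons p.1.1 p.2 : Fin (n + 1) → ℝ) :=
    Continuous.finCons (by fun_prop) (by fun_prop)
  have h2 : Continuous fun p : (ℝ × ℝ) × (Fin n → ℝ) => (Fin.cons p.1.2 p.2 : Fin (n + 1) → ℝ) :=
    Continuous.finCons (by fun_prop) (by fun_prop)
  exact (continuous_kernelDet hk (n + 1)).comp (h1.prodMk h2)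

theorem continuous_fredholmMinorCoeff (hk : Continuous fun p : ℝ × ℝ => k p.1 p.2)
    (hC : IsCompact C) (hμ : ∀ᵐ y ∂μ, y ∈ C) (n : ℕ) :
    Continuous fun p : ℝ × ℝ => fredholmMinorCoeff k μ n p.1 p.2 :=
  continuous_integral_of_carried (isCompact_pi hC n) (ae_mem_pi hμ n)
    (f := fun (p : ℝ × ℝ) (t : Fin n → ℝ) => kernelDet k (Fin.cons p.1 t : Fin (n + 1) → ℝ)
      (Fin.cons p.2 t : Fin (n + 1) → ℝ)) (continuous_kernelDet_cons hk n)

/-- The series of the first minor converges locally uniformly. -/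
theorem continuous_fredholmMinor (hk : Continuous fun p : ℝ × ℝ => k p.1 p.2)
    (hC : IsCompact C) (hμ : ∀ᵐ y ∂μ, y ∈ C) :
    Continuous fun p : ℝ × ℝ => fredholmMinor k μ p.1 p.2 := by
  refine continuous_iff_continuousAt.2 fun p => ?_
  obtain ⟨u, hu, hb⟩ := exists_summable_bound_minor hk
    (hC.union ((isCompact_closedBall p.1 1).union (isCompact_closedBall p.2 1)))
    (hμ.mono fun y hy => Or.inl hy)
  have hcont : ContinuousOn (fun p : ℝ × ℝ => fredholmMinor k μ p.1 p.2)
      (Metric.closedBall p.1 1 ×ˢ Metric.closedBall p.2 1) :=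
    continuousOn_tsum (fun n => (continuous_const.mul
      (continuous_fredholmMinorCoeff hk hC hμ n)).continuousOn) hu
      fun n q hq => hb n q.1 (Or.inr (Or.inl hq.1)) q.2 (Or.inr (Or.inr hq.2))
  exact hcont.continuousAt (prod_mem_nhds (Metric.closedBall_mem_nhds _ one_pos)
    (Metric.closedBall_mem_nhds _ one_pos))

/-- The empty determinant is `1`, and so is the mass of the space of functions on `Fin 0`. -/
theorem fredholmTrace_zero : fredholmTrace k μ 0 = 1 := by
  simp [fredholmTrace, kernelDet, measureReal_pi_univ]

theorem fredholmMinorCoeff_zero (x y : ℝ) : fredholmMinorCoeff k μ 0 x y = k x y := by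
  simp [fredholmMinorCoeff, kernelDet, measureReal_pi_univ]

/-- The integrated expansion of the bordered determinant along its first row: all `n + 1` cofactors
of the integration variables have the same integral. -/
theorem fredholmMinorCoeff_succ (hk : Continuous fun p : ℝ × ℝ => k p.1 p.2)
    (hC : IsCompact C) (hμ : ∀ᵐ y ∂μ, y ∈ C) (n : ℕ) (x y : ℝ) :
    fredholmMinorCoeff k μ (n + 1) x y = k x y * fredholmTrace k μ (n + 1)
      - (n + 1) * ∫ s, k x s * fredholmMinorCoeff k μ n s y ∂μ := by
  have hf : Continuous fun p : ℝ × (Fin n → ℝ) => k x p.1 * kernelDet k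
      (Fin.cons p.1 p.2 : Fin (n + 1) → ℝ) (Fin.cons y p.2 : Fin (n + 1) → ℝ) :=
    (hk.comp (by fun_prop : Continuous fun p : ℝ × (Fin n → ℝ) => (x, p.1))).mul
      ((continuous_kernelDet_cons hk n).comp
        (by fun_prop : Continuous fun p : ℝ × (Fin n → ℝ) => ((p.1, y), p.2)))
  have hint : ∀ i : Fin (n + 1), Integrable (fun t : Fin (n + 1) → ℝ => k x (t i) *
        kernelDet k (Fin.cons (t i) (fun j => t (i.succAbove j)) : Fin (n + 1) → ℝ)
          (Fin.cons y (fun j => t (i.succAbove j)) : Fin (n + 1) → ℝ))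
      (Measure.pi fun _ => μ) := fun i =>
    integrable_of_continuous_of_carried (isCompact_pi hC _) (ae_mem_pi hμ _)
      (hf.comp (by fun_prop : Continuous fun t : Fin (n + 1) → ℝ =>
        (t i, fun j => t (i.succAbove j))))
  have hint0 : Integrable (fun t : Fin (n + 1) → ℝ => k x y * kernelDet k t t)
      (Measure.pi fun _ => μ) :=
    integrable_of_continuous_of_carried (isCompact_pi hC _) (ae_mem_pi hμ _)
      (continuous_const.mul ((continuous_kernelDet hk (n + 1)).comp
        (by fun_prop : Continuous fun t : Fin (n + 1) → ℝ => (t, t))))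
  unfold fredholmMinorCoeff fredholmTrace
  simp_rw [kernelDet_cons_expand]
  rw [integral_sub hint0 (integrable_finsetSum _ fun i _ => hint i),
    integral_finsetSum _ fun i _ => hint i, integral_const_mul]
  congr 1
  rw [Finset.sum_congr rfl fun i _ => integral_pi_succAbove i (f := fun s t =>
    k x s * kernelDet k (Fin.cons s t : Fin (n + 1) → ℝ) (Fin.cons y t : Fin (n + 1) → ℝ))
    (integrable_of_continuous_of_carried (hC.prod (isCompact_pi hC n))
      (ae_mem_prod_pi hC hμ n) hf)]
  simp [integral_const_mul]

/-- Fredholm's first fundamental relation. -/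
theorem fredholmMinor_eq (hk : Continuous fun p : ℝ × ℝ => k p.1 p.2)
    (hC : IsCompact C) (hμ : ∀ᵐ y ∂μ, y ∈ C) (x y : ℝ) :
    fredholmMinor k μ x y
      = k x y * fredholmDet k μ + ∫ s, k x s * fredholmMinor k μ s y ∂μ := by
  -- The uniform bound of the terms has to cover the row `x` and the column `y` as well.
  have hC' : IsCompact (C ∪ {x, y}) := hC.union (Set.toFinite {x, y}).isCompact
  have hμ' : ∀ᵐ z ∂μ, z ∈ C ∪ {x, y} := hμ.mono fun y hy => Or.inl hy
  obtain ⟨u, hu, hb⟩ := exists_summable_bound_minor hk hC' hμ'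
  obtain ⟨M, hM0, hM⟩ := exists_bound_on_prod hk hC'
  set F : ℕ → ℝ → ℂ := fun n s =>
    k x s * ((-1) ^ n / (n.factorial : ℂ) * fredholmMinorCoeff k μ n s y) with hF
  have hFc : ∀ n, Continuous (F n) := fun n =>
    (hk.comp (by fun_prop : Continuous fun s : ℝ => (x, s))).mul (continuous_const.mul
      ((continuous_fredholmMinorCoeff hk hC hμ n).comp
        (by fun_prop : Continuous fun s : ℝ => (s, y))))
  have hFb : ∀ n, ∀ᵐ s ∂μ, ‖F n s‖ ≤ M * u n := fun n => hμ'.mono fun s hs => by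
    rw [hF, norm_mul]
    exact mul_le_mul (hM x (by simp) s hs) (hb n s hs y (by simp)) (norm_nonneg _) hM0
  have hFi : ∀ n, Integrable (F n) μ := fun n => integrable_of_continuous_of_carried hC hμ (hFc n)
  have hsum := hasSum_integral_of_summable_integral_norm hFi (by
    refine Summable.of_nonneg_of_le (fun n => integral_nonneg fun s => norm_nonneg _) (fun n => ?_)
      ((hu.mul_left M).mul_right (μ.real Set.univ))
    have := norm_integral_le_of_norm_le_const (f := fun s => ‖F n s‖) (by simpa using hFb n)
    exact (le_abs_self _).trans this)
  have hlim : ∫ s, ∑' n, F n s ∂μ = ∫ s, k x s * fredholmMinor k μ s y ∂μ := by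
    simp_rw [hF, tsum_mul_left]
    rfl
  rw [hlim] at hsum
  have hD := (summable_fredholmTrace hk hC hμ).hasSum
  have hD1 := ((hasSum_nat_add_iff' 1).2 hD).mul_left (k x y)
  have hN := (hasSum_nat_add_iff' 1).2 (summable_fredholmMinor hk hC hμ x y).hasSum
  -- The terms of index `n + 1` match; the terms of index `0` are `K(x, y)` on both sides.
  have hterm : ∀ n : ℕ, (-1 : ℂ) ^ (n + 1) / ((n + 1).factorial : ℂ)
        * fredholmMinorCoeff k μ (n + 1) x y
      = k x y * ((-1) ^ (n + 1) / ((n + 1).factorial : ℂ) * fredholmTrace k μ (n + 1))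
        + ∫ s, F n s ∂μ := fun n => by
    have h1 : ∫ s, F n s ∂μ = (-1) ^ n / (n.factorial : ℂ)
        * ∫ s, k x s * fredholmMinorCoeff k μ n s y ∂μ := by
      rw [← integral_const_mul]
      exact integral_congr_ae (Eventually.of_forall fun s => by simp only [hF]; ring)
    have h2 : (n.factorial : ℂ) ≠ 0 := Nat.cast_ne_zero.2 n.factorial_ne_zero
    have h3 : (n : ℂ) + 1 ≠ 0 := Nat.cast_add_one_ne_zero n
    rw [h1, fredholmMinorCoeff_succ hk hC hμ, Nat.factorial_succ]
    push_cast
    field_simp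
    ring
  have := hN.unique ((hD1.add hsum).congr_fun hterm)
  simp only [Finset.sum_range_one, pow_zero, Nat.factorial_zero, Nat.cast_one, div_one, one_mul,
    fredholmTrace_zero, fredholmMinorCoeff_zero] at this
  have h2 : fredholmMinor k μ x y - k x y = k x y * (fredholmDet k μ - 1)
    + ∫ s, k x s * fredholmMinor k μ s y ∂μ := this
  linear_combination h2

end Fredholm

/-! ### Dependence of the Fredholm determinant on the domain -/

/-- First-order expansion of a product of numbers in `[0, 1]`: the error is controlled by the
off-diagonal products of increments. -/
theorem abs_prod_sub_prod_sub_linear_le {ι : Type*} [DecidableEq ι] (s : Finset ι) {g h : ι → ℝ}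
    (hg : ∀ i, g i ∈ Set.Icc (0 : ℝ) 1) (hh : ∀ i, h i ∈ Set.Icc (0 : ℝ) 1) :
    |∏ i ∈ s, g i - ∏ i ∈ s, h i - ∑ i ∈ s, (g i - h i) * ∏ l ∈ s.erase i, h l|
      ≤ ∑ i ∈ s, ∑ l ∈ s.erase i, |g i - h i| * |g l - h l| := by
  have hfirst : ∀ s : Finset ι, |∏ i ∈ s, g i - ∏ i ∈ s, h i| ≤ ∑ i ∈ s, |g i - h i| := by
    intro s
    induction s using Finset.induction_on with
    | empty => simp
    | insert a s ha ih =>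
      rw [Finset.prod_insert ha, Finset.prod_insert ha, Finset.sum_insert ha]
      have e : g a * ∏ i ∈ s, g i - h a * ∏ i ∈ s, h i
          = (g a - h a) * ∏ i ∈ s, h i + g a * (∏ i ∈ s, g i - ∏ i ∈ s, h i) := by ring
      rw [e]
      refine (abs_add_le _ _).trans (add_le_add ?_ ?_)
      · rw [abs_mul]
        refine mul_le_of_le_one_right (abs_nonneg _) ?_
        rw [abs_of_nonneg (Finset.prod_nonneg fun i _ => (hh i).1)]
        exact Finset.prod_le_one (fun i _ => (hh i).1) fun i _ => (hh i).2
      · rw [abs_mul, abs_of_nonneg (hg a).1]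
        exact (mul_le_of_le_one_left (abs_nonneg _) (hg a).2).trans ih
  induction s using Finset.induction_on with
  | empty => simp
  | insert a s ha ih =>
    have herase : ∀ i ∈ s, (insert a s).erase i = insert a (s.erase i) := fun i hi =>
      Finset.erase_insert_of_ne (by rintro rfl; exact ha hi)
    have hna : ∀ i, a ∉ s.erase i := fun i h => ha (Finset.mem_of_mem_erase h)
    have e1 : ∑ i ∈ s, (g i - h i) * ∏ l ∈ (insert a s).erase i, h l
        = h a * ∑ i ∈ s, (g i - h i) * ∏ l ∈ s.erase i, h l := by
      rw [Finset.mul_sum]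
      refine Finset.sum_congr rfl fun i hi => ?_
      rw [herase i hi, Finset.prod_insert (hna i)]
      ring
    have e2 : ∑ i ∈ s, ∑ l ∈ (insert a s).erase i, |g i - h i| * |g l - h l|
        = ∑ i ∈ s, |g i - h i| * |g a - h a|
          + ∑ i ∈ s, ∑ l ∈ s.erase i, |g i - h i| * |g l - h l| := by
      rw [← Finset.sum_add_distrib]
      refine Finset.sum_congr rfl fun i hi => ?_
      rw [herase i hi, Finset.sum_insert (hna i)]
    rw [Finset.prod_insert ha, Finset.prod_insert ha, Finset.sum_insert ha, Finset.sum_insert ha,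
      Finset.erase_insert ha, e1, e2]
    have e : g a * ∏ i ∈ s, g i - h a * ∏ i ∈ s, h i - ((g a - h a) * ∏ i ∈ s, h i
          + h a * ∑ i ∈ s, (g i - h i) * ∏ l ∈ s.erase i, h l)
        = (g a - h a) * (∏ i ∈ s, g i - ∏ i ∈ s, h i)
          + h a * (∏ i ∈ s, g i - ∏ i ∈ s, h i
            - ∑ i ∈ s, (g i - h i) * ∏ l ∈ s.erase i, h l) := by ring
    rw [e]
    refine (abs_add_le _ _).trans (add_le_add ?_ ?_)
    · rw [abs_mul, ← Finset.mul_sum]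
      exact mul_le_mul_of_nonneg_left (hfirst s) (abs_nonneg _)
    · rw [abs_mul, abs_of_nonneg (hh a).1]
      refine (mul_le_of_le_one_left (abs_nonneg _) (hh a).2).trans (ih.trans ?_)
      exact le_add_of_nonneg_left (Finset.sum_nonneg fun i _ => by positivity)

theorem prod_erase_univ_eq_prod_succAbove {n : ℕ} (i : Fin (n + 1)) (h : Fin (n + 1) → ℝ) :
    ∏ l ∈ Finset.univ.erase i, h l = ∏ l, h (i.succAbove l) := by
  rw [← Finset.compl_singleton, ← Fin.image_succAbove_univ,
    Finset.prod_image fun _ _ _ _ h => Fin.succAbove_right_injective h]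

/-- The `L¹` distance of the indicator functions of two sets. -/
def indicatorDist (ρ : Measure ℝ) (G H : Set ℝ) : ℝ :=
  ∫ s, |G.indicator (1 : ℝ → ℝ) s - H.indicator (1 : ℝ → ℝ) s| ∂ρ

theorem indicatorDist_nonneg (ρ : Measure ℝ) (G H : Set ℝ) : 0 ≤ indicatorDist ρ G H :=
  integral_nonneg fun _ => abs_nonneg _

section Perturbation

variable {ρ : Measure ℝ} [IsFiniteMeasure ρ] {C G H : Set ℝ}

/-- Restricting every factor of a product measure multiplies the integrand by a product of
indicator functions, so that all domains can be compared over one measure. -/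
theorem integral_pi_restrict (hG : MeasurableSet G) {n : ℕ} (F : (Fin n → ℝ) → ℂ) :
    ∫ t, F t ∂(Measure.pi fun _ : Fin n => ρ.restrict G)
      = ∫ t, ((∏ i, G.indicator (1 : ℝ → ℝ) (t i) : ℝ) : ℂ) * F t
        ∂(Measure.pi fun _ : Fin n => ρ) := by
  rw [← Measure.restrict_pi_pi, ← integral_indicator (MeasurableSet.univ_pi fun _ => hG)]
  refine integral_congr_ae (Eventually.of_forall fun t => ?_)
  by_cases ht : t ∈ Set.univ.pi fun _ : Fin n => G
  · have h1 : ∏ i, G.indicator (1 : ℝ → ℝ) (t i) = 1 :=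
      Finset.prod_eq_one fun i _ => by simp [Set.indicator_of_mem (ht i trivial)]
    simp [Set.indicator_of_mem ht, h1]
  · obtain ⟨i, hi⟩ : ∃ i, t i ∉ G := by simpa [Set.mem_univ_pi] using ht
    have h1 : ∏ i, G.indicator (1 : ℝ → ℝ) (t i) = 0 :=
      Finset.prod_eq_zero (Finset.mem_univ i) (by simp [Set.indicator_of_notMem hi])
    simp [Set.indicator_of_notMem ht, h1]

theorem indicator_one_mem_Icc (G : Set ℝ) (x : ℝ) :
    G.indicator (1 : ℝ → ℝ) x ∈ Set.Icc (0 : ℝ) 1 := by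
  by_cases h : x ∈ G <;> simp [h]

theorem abs_indicator_sub_indicator_le (G H : Set ℝ) (x : ℝ) :
    |G.indicator (1 : ℝ → ℝ) x - H.indicator (1 : ℝ → ℝ) x| ≤ 1 := by
  by_cases h : x ∈ G <;> by_cases h' : x ∈ H <;> simp [h, h']

theorem measurable_indicator_one (hG : MeasurableSet G) : Measurable (G.indicator (1 : ℝ → ℝ)) :=
  measurable_one.indicator hG

theorem integrable_abs_indicator_sub (hG : MeasurableSet G) (hH : MeasurableSet H) :
    Integrable (fun s => |G.indicator (1 : ℝ → ℝ) s - H.indicator (1 : ℝ → ℝ) s|) ρ := by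
  refine Integrable.of_bound ((measurable_indicator_one hG).sub
    (measurable_indicator_one hH)).abs.aestronglyMeasurable 1 (Eventually.of_forall fun s => ?_)
  rw [Real.norm_eq_abs, abs_abs]
  exact abs_indicator_sub_indicator_le G H s

theorem integrable_mul_abs_indicator_sub (hG : MeasurableSet G) (hH : MeasurableSet H)
    {n : ℕ} (i l : Fin n) :
    Integrable (fun t : Fin n → ℝ => |G.indicator (1 : ℝ → ℝ) (t i) - H.indicator 1 (t i)| *
      |G.indicator (1 : ℝ → ℝ) (t l) - H.indicator 1 (t l)|) (Measure.pi fun _ => ρ) := by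
  have hm : Measurable fun s => |G.indicator (1 : ℝ → ℝ) s - H.indicator (1 : ℝ → ℝ) s| :=
    ((measurable_indicator_one hG).sub (measurable_indicator_one hH)).abs
  refine Integrable.of_bound ((hm.comp (measurable_pi_apply i)).mul
    (hm.comp (measurable_pi_apply l))).aestronglyMeasurable 1 (Eventually.of_forall fun s => ?_)
  rw [norm_mul, Real.norm_eq_abs, Real.norm_eq_abs, abs_abs, abs_abs]
  exact mul_le_one₀ (abs_indicator_sub_indicator_le G H _) (abs_nonneg _)
    (abs_indicator_sub_indicator_le G H _)

/-- For two distinct variables the integral factors, and each of the two increments contributes the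
`L¹` distance. -/
theorem integral_mul_abs_indicator_sub_le {n : ℕ} {i l : Fin n} (hil : i ≠ l) :
    ∫ t : Fin n → ℝ, |G.indicator (1 : ℝ → ℝ) (t i) - H.indicator 1 (t i)| *
      |G.indicator (1 : ℝ → ℝ) (t l) - H.indicator 1 (t l)| ∂(Measure.pi fun _ => ρ)
      ≤ indicatorDist ρ G H ^ 2 * (max 1 (ρ.real Set.univ)) ^ n := by
  set δ : ℝ → ℝ := fun s => |G.indicator (1 : ℝ → ℝ) s - H.indicator (1 : ℝ → ℝ) s|
  set d := indicatorDist ρ G H with hd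
  have hd0 : 0 ≤ d := indicatorDist_nonneg ρ G H
  set V := max 1 (ρ.real Set.univ)
  have hprod : ∀ t : Fin n → ℝ, δ (t i) * δ (t l)
      = ∏ r, ((if r = i then δ (t r) else 1) * (if r = l then δ (t r) else 1)) := fun t => by
    rw [Finset.prod_mul_distrib]
    simp
  calc ∫ t : Fin n → ℝ, δ (t i) * δ (t l) ∂(Measure.pi fun _ => ρ)
      = ∏ r, ∫ s, (if r = i then δ s else 1) * (if r = l then δ s else 1) ∂ρ := by
        simp_rw [hprod]
        exact integral_fintype_prod_eq_prod
          (fun r s => (if r = i then δ s else 1) * (if r = l then δ s else 1))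
    _ ≤ ∏ r, ((if r = i then d else 1) * (if r = l then d else 1)) * V := by
        refine Finset.prod_le_prod (fun r _ => integral_nonneg fun s => ?_) fun r _ => ?_
        · exact mul_nonneg (by split_ifs <;> simp [δ]) (by split_ifs <;> simp [δ])
        · have hV : 1 ≤ V := le_max_left _ _
          by_cases h1 : r = i
          · have h2 : r ≠ l := fun h => hil (h1.symm.trans h)
            simp only [h1, if_true, hil, if_false, mul_one]
            exact le_mul_of_one_le_right hd0 hV
          · by_cases h2 : r = l
            · simp only [h2, Ne.symm hil, if_true, if_false, one_mul]
              exact le_mul_of_one_le_right hd0 hV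
            · simp only [h1, h2, if_false, mul_one, one_mul, integral_const, smul_eq_mul]
              exact le_max_right _ _
    _ = _ := by
        rw [Finset.prod_mul_distrib, Finset.prod_mul_distrib]
        simp [sq]

/-- The term of first order in the `i`-th variable: the other variables are integrated over `H`,
which leaves the diagonal of the coefficient of the first minor. -/
theorem integral_linear_term {k : ℝ → ℝ → ℂ} (hk : Continuous fun p : ℝ × ℝ => k p.1 p.2)
    (hC : IsCompact C) (hρ : ∀ᵐ y ∂ρ, y ∈ C) (hG : MeasurableSet G) (hH : MeasurableSet H)
    {m : ℕ} (i : Fin (m + 1)) :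
    Integrable (fun t : Fin (m + 1) → ℝ =>
      (((G.indicator (1 : ℝ → ℝ) (t i) - H.indicator 1 (t i)) *
        ∏ l, H.indicator (1 : ℝ → ℝ) (t (i.succAbove l)) : ℝ) : ℂ) * kernelDet k t t)
      (Measure.pi fun _ => ρ) ∧
    ∫ t : Fin (m + 1) → ℝ, (((G.indicator (1 : ℝ → ℝ) (t i) - H.indicator 1 (t i)) *
        ∏ l, H.indicator (1 : ℝ → ℝ) (t (i.succAbove l)) : ℝ) : ℂ) * kernelDet k t t
      ∂(Measure.pi fun _ => ρ)
      = ∫ s, ((G.indicator (1 : ℝ → ℝ) s - H.indicator 1 s : ℝ) : ℂ)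
        * fredholmMinorCoeff k (ρ.restrict H) m s s ∂ρ := by
  set f : ℝ → (Fin m → ℝ) → ℂ := fun s t => (((G.indicator (1 : ℝ → ℝ) s - H.indicator 1 s) *
    ∏ l, H.indicator (1 : ℝ → ℝ) (t l) : ℝ) : ℂ) *
      kernelDet k (Fin.cons s t : Fin (m + 1) → ℝ) (Fin.cons s t : Fin (m + 1) → ℝ) with hf
  have hrw : (fun t : Fin (m + 1) → ℝ => (((G.indicator (1 : ℝ → ℝ) (t i) - H.indicator 1 (t i)) *
        ∏ l, H.indicator (1 : ℝ → ℝ) (t (i.succAbove l)) : ℝ) : ℂ) * kernelDet k t t)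
      = fun t => f (t i) (fun j => t (i.succAbove j)) := by
    funext t
    simp only [hf, kernelDet_cons_removeNth]
  have hcont : Continuous fun p : ℝ × (Fin m → ℝ) =>
      kernelDet k (Fin.cons p.1 p.2 : Fin (m + 1) → ℝ) (Fin.cons p.1 p.2 : Fin (m + 1) → ℝ) :=
    (continuous_kernelDet_cons hk m).comp
      (by fun_prop : Continuous fun p : ℝ × (Fin m → ℝ) => ((p.1, p.1), p.2))
  have hGm := measurable_indicator_one hG
  have hHm := measurable_indicator_one hH
  have hw : Measurable fun p : ℝ × (Fin m → ℝ) =>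
      (G.indicator (1 : ℝ → ℝ) p.1 - H.indicator 1 p.1) *
        ∏ l, H.indicator (1 : ℝ → ℝ) (p.2 l) :=
    ((hGm.comp measurable_fst).sub (hHm.comp measurable_fst)).mul
      (Finset.measurable_prod _ fun l _ =>
        hHm.comp ((measurable_pi_apply l).comp measurable_snd))
  have hwb : ∀ p : ℝ × (Fin m → ℝ), |(G.indicator (1 : ℝ → ℝ) p.1 - H.indicator 1 p.1) *
        ∏ l, H.indicator (1 : ℝ → ℝ) (p.2 l)| ≤ 1 := fun p => by
    have h0 : 0 ≤ ∏ l, H.indicator (1 : ℝ → ℝ) (p.2 l) :=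
      Finset.prod_nonneg fun l _ => (indicator_one_mem_Icc H _).1
    rw [abs_mul, abs_of_nonneg h0]
    exact mul_le_one₀ (abs_indicator_sub_indicator_le G H _) h0
      (Finset.prod_le_one (fun l _ => (indicator_one_mem_Icc H _).1)
        fun l _ => (indicator_one_mem_Icc H _).2)
  have hint : Integrable (fun p : ℝ × (Fin m → ℝ) => f p.1 p.2)
      (ρ.prod (Measure.pi fun _ : Fin m => ρ)) := by
    refine Integrable.bdd_mul (c := 1) (integrable_of_continuous_of_carried
      (hC.prod (isCompact_pi hC m)) (ae_mem_prod_pi hC hρ m) hcont)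
      (Complex.measurable_ofReal.comp hw).aestronglyMeasurable
      (Eventually.of_forall fun p => ?_)
    rw [Complex.norm_real, Real.norm_eq_abs]
    exact hwb p
  rw [hrw]
  refine ⟨((measurePreserving_piFinSuccAbove (fun _ : Fin (m + 1) => ρ) i).integrable_comp_emb
    (MeasurableEquiv.measurableEmbedding _)).2 hint, ?_⟩
  rw [integral_pi_succAbove i hint]
  refine integral_congr_ae (Eventually.of_forall fun s => ?_)
  unfold fredholmMinorCoeff
  simp only [hf]
  rw [integral_pi_restrict hH, ← integral_const_mul]
  refine integral_congr_ae (Eventually.of_forall fun t => ?_)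
  simp only [Complex.ofReal_mul]
  ring

theorem integrable_indicator_prod_mul {k : ℝ → ℝ → ℂ}
    (hk : Continuous fun p : ℝ × ℝ => k p.1 p.2) (hC : IsCompact C) (hρ : ∀ᵐ y ∂ρ, y ∈ C)
    (hG : MeasurableSet G) (n : ℕ) :
    Integrable (fun t : Fin n → ℝ => ((∏ i, G.indicator (1 : ℝ → ℝ) (t i) : ℝ) : ℂ)
      * kernelDet k t t) (Measure.pi fun _ => ρ) := by
  have hw : Measurable fun t : Fin n → ℝ => ∏ l, G.indicator (1 : ℝ → ℝ) (t l) :=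
    Finset.measurable_prod _ fun l _ => (measurable_indicator_one hG).comp (measurable_pi_apply l)
  refine Integrable.bdd_mul (c := 1) (integrable_of_continuous_of_carried (isCompact_pi hC n)
    (ae_mem_pi hρ n) ((continuous_kernelDet hk n).comp (by fun_prop :
      Continuous fun t : Fin n → ℝ => (t, t))))
    (Complex.measurable_ofReal.comp hw).aestronglyMeasurable (Eventually.of_forall fun t => ?_)
  rw [Complex.norm_real, Real.norm_eq_abs,
    abs_of_nonneg (Finset.prod_nonneg fun l _ => (indicator_one_mem_Icc G _).1)]
  exact Finset.prod_le_one (fun l _ => (indicator_one_mem_Icc G _).1)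
    fun l _ => (indicator_one_mem_Icc G _).2

/-- First-order expansion of one coefficient of Fredholm's series in the domain of integration. The
determinant is bounded by Hadamard's inequality, and each of the `(m + 1) m` pairs of variables
contributes the square of the `L¹` distance. -/
theorem norm_fredholmTrace_sub_le {k : ℝ → ℝ → ℂ} (hk : Continuous fun p : ℝ × ℝ => k p.1 p.2)
    (hC : IsCompact C) (hρ : ∀ᵐ y ∂ρ, y ∈ C) (hG : MeasurableSet G) (hH : MeasurableSet H)
    {M : ℝ} (hM0 : 0 ≤ M) (hM : ∀ x ∈ C, ∀ y ∈ C, ‖k x y‖ ≤ M) (m : ℕ) :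
    ‖fredholmTrace k (ρ.restrict G) (m + 1) - fredholmTrace k (ρ.restrict H) (m + 1)
      - (m + 1) * ∫ s, ((G.indicator (1 : ℝ → ℝ) s - H.indicator 1 s : ℝ) : ℂ)
        * fredholmMinorCoeff k (ρ.restrict H) m s s ∂ρ‖
      ≤ M ^ (m + 1) * √(((m + 1 : ℕ) : ℝ) ^ (m + 1)) * (((m + 1 : ℕ) : ℝ) ^ 2 *
        (indicatorDist ρ G H ^ 2 * (max 1 (ρ.real Set.univ)) ^ (m + 1))) := by
  set B := M ^ (m + 1) * √(((m + 1 : ℕ) : ℝ) ^ (m + 1)) with hB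
  have hB0 : 0 ≤ B := by positivity
  set δ : ℝ → ℝ := fun s => G.indicator (1 : ℝ → ℝ) s - H.indicator 1 s with hδ
  have hlin := fun i => integral_linear_term (ρ := ρ) hk hC hρ hG hH (m := m) i
  have hsum : (m + 1) * ∫ s, ((G.indicator (1 : ℝ → ℝ) s - H.indicator 1 s : ℝ) : ℂ)
        * fredholmMinorCoeff k (ρ.restrict H) m s s ∂ρ
      = ∫ t : Fin (m + 1) → ℝ, ∑ i, (((G.indicator (1 : ℝ → ℝ) (t i) - H.indicator 1 (t i)) *
        ∏ l, H.indicator (1 : ℝ → ℝ) (t (i.succAbove l)) : ℝ) : ℂ) * kernelDet k t t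
      ∂(Measure.pi fun _ => ρ) := by
    rw [integral_finsetSum _ fun i _ => (hlin i).1, Finset.sum_congr rfl fun i _ => (hlin i).2]
    simp
  have hGi := integrable_indicator_prod_mul (ρ := ρ) hk hC hρ hG (m + 1)
  have hHi := integrable_indicator_prod_mul (ρ := ρ) hk hC hρ hH (m + 1)
  rw [hsum]
  unfold fredholmTrace
  rw [integral_pi_restrict hG, integral_pi_restrict hH, ← integral_sub hGi hHi,
    ← integral_sub (by exact hGi.sub hHi) (integrable_finsetSum _ fun i _ => (hlin i).1)]
  have hpt : ∀ᵐ t ∂(Measure.pi fun _ : Fin (m + 1) => ρ),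
      ‖((∏ i, G.indicator (1 : ℝ → ℝ) (t i) : ℝ) : ℂ) * kernelDet k t t
        - ((∏ i, H.indicator (1 : ℝ → ℝ) (t i) : ℝ) : ℂ) * kernelDet k t t
        - ∑ i, (((G.indicator (1 : ℝ → ℝ) (t i) - H.indicator 1 (t i)) *
        ∏ l, H.indicator (1 : ℝ → ℝ) (t (i.succAbove l)) : ℝ) : ℂ) * kernelDet k t t‖
      ≤ B * ∑ i, ∑ l ∈ Finset.univ.erase i, |δ (t i)| * |δ (t l)| := by
    filter_upwards [ae_mem_pi hρ (m + 1)] with t ht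
    rw [← Finset.sum_mul, ← sub_mul, ← sub_mul, norm_mul, mul_comm B]
    refine mul_le_mul ?_ (norm_kernelDet_le hM (fun i => ht i trivial) fun i => ht i trivial)
      (norm_nonneg _) (Finset.sum_nonneg fun i _ => Finset.sum_nonneg fun l _ => by positivity)
    have := abs_prod_sub_prod_sub_linear_le Finset.univ
      (fun i => indicator_one_mem_Icc G (t i)) (fun i => indicator_one_mem_Icc H (t i))
    simp_rw [prod_erase_univ_eq_prod_succAbove] at this
    rw [← Complex.ofReal_sub, ← Complex.ofReal_sum, ← Complex.ofReal_sub, Complex.norm_real,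
      Real.norm_eq_abs]
    exact this
  have hdi : ∀ i l : Fin (m + 1), Integrable (fun t : Fin (m + 1) → ℝ => |δ (t i)| * |δ (t l)|)
      (Measure.pi fun _ => ρ) := fun i l => integrable_mul_abs_indicator_sub hG hH i l
  refine (norm_integral_le_of_norm_le ((integrable_finsetSum _ fun i _ =>
    integrable_finsetSum _ fun l _ => hdi i l).const_mul B) hpt).trans ?_
  rw [integral_const_mul, integral_finsetSum _ fun i _ =>
    integrable_finsetSum _ fun l _ => hdi i l]
  refine mul_le_mul_of_nonneg_left ?_ hB0
  set W := indicatorDist ρ G H ^ 2 * (max 1 (ρ.real Set.univ)) ^ (m + 1)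
  have hW : 0 ≤ W := by positivity
  calc ∑ i, ∫ t : Fin (m + 1) → ℝ, ∑ l ∈ Finset.univ.erase i, |δ (t i)| * |δ (t l)|
        ∂(Measure.pi fun _ => ρ)
      ≤ ∑ _i : Fin (m + 1), ∑ _l : Fin (m + 1), W := by
        refine Finset.sum_le_sum fun i _ => ?_
        rw [integral_finsetSum _ fun l _ => hdi i l]
        refine (Finset.sum_le_sum fun l hl => ?_).trans
          (Finset.sum_le_sum_of_subset_of_nonneg (Finset.erase_subset i _) fun _ _ _ => hW)
        exact integral_mul_abs_indicator_sub_le (Finset.ne_of_mem_erase hl).symm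
    _ = _ := by
        simp only [Finset.sum_const, Finset.card_univ, Fintype.card_fin, nsmul_eq_mul]
        ring

/-- First-order expansion of the Fredholm determinant in the domain of integration. -/
theorem exists_norm_fredholmDet_sub_le {k : ℝ → ℝ → ℂ}
    (hk : Continuous fun p : ℝ × ℝ => k p.1 p.2) (hC : IsCompact C) (hρ : ∀ᵐ y ∂ρ, y ∈ C) :
    ∃ B : ℝ, ∀ G H : Set ℝ, MeasurableSet G → MeasurableSet H →
      ‖fredholmDet k (ρ.restrict G) - fredholmDet k (ρ.restrict H)
        + ∫ s, ((G.indicator (1 : ℝ → ℝ) s - H.indicator 1 s : ℝ) : ℂ)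
          * fredholmMinor k (ρ.restrict H) s s ∂ρ‖ ≤ B * indicatorDist ρ G H ^ 2 := by
  obtain ⟨M, hM0, hM⟩ := exists_bound_on_prod hk hC
  set V := max 1 (ρ.real Set.univ)
  have hV : 1 ≤ V := le_max_left _ _
  -- The `4` absorbs the factor `(n + 1) ^ 2 ≤ 4 ^ (n + 1)` that counts the pairs of variables.
  set w : ℕ → ℝ := fun n => (4 * M * V) ^ (n + 1) * √(((n + 1 : ℕ) : ℝ) ^ (n + 1)) /
    (n + 1).factorial with hw
  have hws : Summable w := (summable_nat_add_iff 1).2 (summable_pow_mul_sqrt_div_factorial _)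
  refine ⟨∑' n, w n, fun G H hG hH => ?_⟩
  set d := indicatorDist ρ G H
  have hρG : ∀ᵐ y ∂(ρ.restrict G), y ∈ C := ae_restrict_of_ae hρ
  have hρH : ∀ᵐ y ∂(ρ.restrict H), y ∈ C := ae_restrict_of_ae hρ
  -- termwise integration of the series of the first minor
  obtain ⟨u, hu, hb⟩ := exists_summable_bound_minor hk hC hρH
  set F : ℕ → ℝ → ℂ := fun n s => ((G.indicator (1 : ℝ → ℝ) s - H.indicator 1 s : ℝ) : ℂ) *
    ((-1) ^ n / (n.factorial : ℂ) * fredholmMinorCoeff k (ρ.restrict H) n s s) with hF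
  have hδb : ∀ s, ‖((G.indicator (1 : ℝ → ℝ) s - H.indicator 1 s : ℝ) : ℂ)‖ ≤ 1 := fun s => by
    rw [Complex.norm_real]
    exact abs_indicator_sub_indicator_le G H s
  have hFi : ∀ n, Integrable (F n) ρ := fun n => by
    refine Integrable.bdd_mul (c := 1) (integrable_of_continuous_of_carried hC hρ
      (continuous_const.mul ((continuous_fredholmMinorCoeff hk hC hρH n).comp
        (by fun_prop : Continuous fun s : ℝ => (s, s)))))
      (Complex.measurable_ofReal.comp ((measurable_indicator_one hG).sub
        (measurable_indicator_one hH))).aestronglyMeasurable (Eventually.of_forall hδb)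
  have hFb : ∀ n, ∀ᵐ s ∂ρ, ‖F n s‖ ≤ u n := fun n => hρ.mono fun s hs => by
    rw [hF, norm_mul]
    exact (mul_le_of_le_one_left (norm_nonneg _) (hδb s)).trans (hb n s hs s hs)
  have hsum := hasSum_integral_of_summable_integral_norm hFi (by
    refine Summable.of_nonneg_of_le (fun n => integral_nonneg fun s => norm_nonneg _) (fun n => ?_)
      (hu.mul_right (ρ.real Set.univ))
    have := norm_integral_le_of_norm_le_const (f := fun s => ‖F n s‖) (by simpa using hFb n)
    exact (le_abs_self _).trans this)
  have hlim : ∫ s, ∑' n, F n s ∂ρ = ∫ s, ((G.indicator (1 : ℝ → ℝ) s - H.indicator 1 s : ℝ) : ℂ)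
      * fredholmMinor k (ρ.restrict H) s s ∂ρ := by
    simp_rw [hF, tsum_mul_left]
    rfl
  rw [hlim] at hsum
  have hDG := (hasSum_nat_add_iff' 1).2 (summable_fredholmTrace hk hC hρG).hasSum
  have hDH := (hasSum_nat_add_iff' 1).2 (summable_fredholmTrace hk hC hρH).hasSum
  have htot := (hDG.sub hDH).add hsum
  simp only [Finset.sum_range_one, pow_zero, Nat.factorial_zero, Nat.cast_one, div_one, one_mul,
    fredholmTrace_zero, sub_sub_sub_cancel_right] at htot
  have hterm : ∀ n : ℕ, ‖(-1 : ℂ) ^ (n + 1) / ((n + 1).factorial : ℂ)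
        * fredholmTrace k (ρ.restrict G) (n + 1) - (-1 : ℂ) ^ (n + 1) / ((n + 1).factorial : ℂ)
        * fredholmTrace k (ρ.restrict H) (n + 1) + ∫ s, F n s ∂ρ‖ ≤ w n * d ^ 2 := fun n => by
    have h1 : ∫ s, F n s ∂ρ = (-1) ^ n / (n.factorial : ℂ) *
        ∫ s, ((G.indicator (1 : ℝ → ℝ) s - H.indicator 1 s : ℝ) : ℂ)
          * fredholmMinorCoeff k (ρ.restrict H) n s s ∂ρ := by
      rw [← integral_const_mul]
      exact integral_congr_ae (Eventually.of_forall fun s => by simp only [hF]; ring)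
    have h2 : (n.factorial : ℂ) ≠ 0 := Nat.cast_ne_zero.2 n.factorial_ne_zero
    have h3 : (n : ℂ) + 1 ≠ 0 := Nat.cast_add_one_ne_zero n
    have h4 : (-1 : ℂ) ^ (n + 1) / ((n + 1).factorial : ℂ)
        * fredholmTrace k (ρ.restrict G) (n + 1) - (-1 : ℂ) ^ (n + 1) / ((n + 1).factorial : ℂ)
        * fredholmTrace k (ρ.restrict H) (n + 1) + ∫ s, F n s ∂ρ
        = (-1 : ℂ) ^ (n + 1) / ((n + 1).factorial : ℂ) * (fredholmTrace k (ρ.restrict G) (n + 1)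
          - fredholmTrace k (ρ.restrict H) (n + 1) - (n + 1) *
          ∫ s, ((G.indicator (1 : ℝ → ℝ) s - H.indicator 1 s : ℝ) : ℂ)
          * fredholmMinorCoeff k (ρ.restrict H) n s s ∂ρ) := by
      rw [h1, Nat.factorial_succ]
      push_cast
      field_simp
      ring
    rw [h4, norm_mul, norm_div, norm_pow, norm_neg, norm_one, one_pow, Complex.norm_natCast, hw]
    beta_reduce
    rw [div_mul_eq_mul_div, one_mul, div_mul_eq_mul_div]
    gcongr
    refine (norm_fredholmTrace_sub_le hk hC hρ hG hH hM0 hM n).trans ?_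
    have h5 : ((n + 1 : ℕ) : ℝ) ^ 2 ≤ 4 ^ (n + 1) := by
      have : ((n + 1 : ℕ) : ℝ) ≤ 2 ^ (n + 1) := by exact_mod_cast Nat.lt_two_pow_self.le
      calc ((n + 1 : ℕ) : ℝ) ^ 2 ≤ (2 ^ (n + 1)) ^ 2 := by gcongr
        _ = 4 ^ (n + 1) := by rw [← pow_mul, mul_comm, pow_mul]; norm_num
    calc M ^ (n + 1) * √(((n + 1 : ℕ) : ℝ) ^ (n + 1)) *
          (((n + 1 : ℕ) : ℝ) ^ 2 * (d ^ 2 * V ^ (n + 1)))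
        ≤ M ^ (n + 1) * √(((n + 1 : ℕ) : ℝ) ^ (n + 1)) *
          (4 ^ (n + 1) * (d ^ 2 * V ^ (n + 1))) := by gcongr
      _ = _ := by rw [mul_pow, mul_pow]; ring
  unfold fredholmDet
  rw [← htot.tsum_eq]
  refine (tsum_of_norm_bounded (hws.mul_right (d ^ 2)).hasSum hterm).trans (le_of_eq ?_)
  rw [tsum_mul_right]

end Perturbation

/-! ### Airy's equation and the Airy kernel -/

/-- Termwise differentiation of an everywhere convergent power series. -/
theorem hasDerivAt_tsum_pow {c : ℕ → ℝ}
    (hc : ∀ r : ℝ, 0 ≤ r → ∃ C : ℝ, ∀ n, |c n| * r ^ n ≤ C) (x : ℝ) :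
    Summable (fun n : ℕ => ((n : ℝ) + 1) * c (n + 1) * x ^ n) ∧
    HasDerivAt (fun x => ∑' n : ℕ, c n * x ^ n) (∑' n : ℕ, (n + 1) * c (n + 1) * x ^ n) x := by
  set r := |x| + 1
  have hr : 0 < r := by positivity
  -- A factor `2` absorbs the exponent produced by differentiation, another one gives the geometric
  -- series.
  obtain ⟨C, hC⟩ := hc (4 * r) (by positivity)
  have hb : ∀ n : ℕ, ∀ y ∈ Metric.ball (0 : ℝ) r, ‖c n * (n * y ^ (n - 1))‖
      ≤ C / r * (1 / 2) ^ n := fun n y hy => by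
    have hy' : |y| ≤ r := by simpa using (Metric.mem_ball.1 hy).le
    rcases n with _ | n
    · have := hC 0
      simp only [pow_zero, mul_one] at this
      have hC0 : 0 ≤ C := (abs_nonneg _).trans this
      simp only [Nat.cast_zero, zero_mul, mul_zero, norm_zero]
      positivity
    · have h1 := hC (n + 1)
      have h2 : ((n + 1 : ℕ) : ℝ) ≤ 2 ^ (n + 1) := by exact_mod_cast Nat.lt_two_pow_self.le
      have h3 : |y| ^ n ≤ r ^ n := pow_le_pow_left₀ (abs_nonneg _) hy' n
      rw [norm_mul, norm_mul, norm_pow, Real.norm_eq_abs, Real.norm_eq_abs, Real.norm_eq_abs,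
        Nat.abs_cast, Nat.add_sub_cancel, div_mul_eq_mul_div, le_div_iff₀ hr]
      calc |c (n + 1)| * (((n + 1 : ℕ) : ℝ) * |y| ^ n) * r
          ≤ |c (n + 1)| * (2 ^ (n + 1) * r ^ n) * r := by gcongr
        _ = |c (n + 1)| * (4 * r) ^ (n + 1) * (1 / 2) ^ (n + 1) := by
            rw [mul_pow, show (4 : ℝ) = 2 * 2 by norm_num, mul_pow 2 2]
            have : (2 : ℝ) ^ (n + 1) * (1 / 2) ^ (n + 1) = 1 := by rw [← mul_pow]; norm_num
            linear_combination (-|c (n + 1)| * 2 ^ (n + 1) * r ^ (n + 1)) * this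
        _ ≤ C * (1 / 2) ^ (n + 1) := by gcongr
  have hu : Summable fun n : ℕ => C / r * (1 / 2 : ℝ) ^ n :=
    (summable_geometric_of_lt_one (by norm_num) (by norm_num)).mul_left _
  have hx : x ∈ Metric.ball (0 : ℝ) r := by simp [r]
  have h := hasDerivAt_tsum_of_isPreconnected hu Metric.isOpen_ball
    (convex_ball (0 : ℝ) r).isPreconnected
    (fun n y _ => (hasDerivAt_pow n y).const_mul (c n)) hb (Metric.mem_ball_self hr)
    (summable_of_ne_finset_zero (s := {0}) fun n hn => by simp_all) hx
  refine ⟨((summable_nat_add_iff 1).2 (Summable.of_norm_bounded hu fun n => hb n x hx)).congr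
    fun n => by rw [Nat.add_sub_cancel]; push_cast; ring, ?_⟩
  convert! h using 1
  rw [(Summable.of_norm_bounded hu fun n => hb n x hx).tsum_eq_zero_add]
  simp only [Nat.cast_zero, zero_mul, mul_zero, zero_add, Nat.add_sub_cancel]
  exact tsum_congr fun n => by push_cast; ring

theorem airyCoeff_deriv_bound (r : ℝ) (hr : 0 ≤ r) :
    ∃ C : ℝ, ∀ n : ℕ, |((n : ℝ) + 1) * airyCoeff (n + 1)| * r ^ n ≤ C := by
  obtain ⟨C, hC⟩ := airyCoeff_bound (2 * (r + 1)) (by positivity)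
  refine ⟨C, fun n => le_trans ?_ (hC (n + 1))⟩
  have h2 : (n : ℝ) + 1 ≤ 2 ^ (n + 1) := by exact_mod_cast (Nat.lt_two_pow_self (n := n + 1)).le
  have h3 : r ^ n ≤ (r + 1) ^ (n + 1) :=
    (pow_le_pow_left₀ hr (by linarith) n).trans (pow_le_pow_right₀ (by linarith) (Nat.le_succ n))
  rw [abs_mul, abs_of_nonneg (by positivity : (0 : ℝ) ≤ n + 1), mul_pow]
  calc ((n : ℝ) + 1) * |airyCoeff (n + 1)| * r ^ n
      ≤ 2 ^ (n + 1) * |airyCoeff (n + 1)| * (r + 1) ^ (n + 1) := by gcongr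
    _ = _ := by ring

/-- Airy's equation `Ai'' = x Ai`. -/
theorem deriv_deriv_airyAi (x : ℝ) : deriv (deriv airyAi) x = x * airyAi x := by
  have h1 : deriv airyAi = fun x => ∑' n : ℕ, ((n : ℝ) + 1) * airyCoeff (n + 1) * x ^ n :=
    funext fun x => (hasDerivAt_tsum_pow airyCoeff_bound x).2.deriv
  rw [h1, (hasDerivAt_tsum_pow airyCoeff_deriv_bound x).2.deriv]
  have hs := (hasDerivAt_tsum_pow airyCoeff_deriv_bound x).1
  rw [hs.tsum_eq_zero_add, airyAi, ← tsum_mul_left]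
  have h2 : airyCoeff (0 + 1 + 1) = 0 := by rw [airyCoeff]
  rw [h2]
  simp only [mul_zero, zero_mul, zero_add]
  refine tsum_congr fun n => ?_
  rw [show n + 1 + 1 + 1 = n + 3 from rfl, airyCoeff]
  have h3 : (n : ℝ) + 2 ≠ 0 := by positivity
  have h4 : (n : ℝ) + 3 ≠ 0 := by positivity
  push_cast
  field_simp
  ring

theorem hasDerivAt_airyA (lam : ℂ) (x : ℝ) : HasDerivAt (airyA lam) (deriv (airyA lam) x) x :=
  ((contDiff_airyA lam (n := 1)).differentiable one_ne_zero x).hasDerivAt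

/-- Airy's equation `A'' = x A`. -/
theorem hasDerivAt_deriv_airyA (lam : ℂ) (x : ℝ) :
    HasDerivAt (deriv (airyA lam)) ((x : ℂ) * airyA lam x) x := by
  have h1 : ∀ x, HasDerivAt airyAi (deriv airyAi x) x := fun x =>
    ((contDiff_airyAi (n := 1)).differentiable one_ne_zero x).hasDerivAt
  have h2 : deriv (airyA lam) = fun x => Complex.sqrt lam * ((deriv airyAi x : ℝ) : ℂ) :=
    funext fun x => ((h1 x).ofReal_comp.const_mul _).deriv
  have h3 : HasDerivAt (deriv airyAi) (x * airyAi x) x := by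
    rw [← deriv_deriv_airyAi]
    exact ((((contDiff_succ_iff_deriv (n := 1)).1 contDiff_airyAi).2.2).differentiable
      one_ne_zero x).hasDerivAt
  rw [h2]
  refine (h3.ofReal_comp.const_mul (Complex.sqrt lam)).congr_deriv ?_
  rw [airyA]
  push_cast
  ring

theorem airyKernel_symm (lam : ℂ) (x y : ℝ) : airyKernel lam x y = airyKernel lam y x := by
  by_cases h : x = y
  · rw [h]
  · rw [airyKernel, airyKernel, if_neg h, if_neg (Ne.symm h), ← neg_div_neg_eq]
    push_cast
    congr 1 <;> ring

theorem sub_mul_airyKernel (lam : ℂ) (x y : ℝ) : ((x : ℂ) - y) * airyKernel lam x y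
    = airyA lam x * deriv (airyA lam) y - deriv (airyA lam) x * airyA lam y := by
  by_cases h : x = y
  · subst h; ring
  · have h0 : (x : ℂ) - y ≠ 0 := sub_ne_zero.2 fun e => h (Complex.ofReal_injective e)
    rw [airyKernel, if_neg h]
    push_cast
    field_simp

theorem airyKernel_diag (lam : ℂ) (x : ℝ) :
    airyKernel lam x x = deriv (airyA lam) x ^ 2 - x * airyA lam x ^ 2 := by
  rw [airyKernel, if_pos rfl, (hasDerivAt_deriv_airyA lam x).deriv]
  ring

/-- Differentiation under the integral sign, for a finite measure carried by a compact set. -/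
theorem hasDerivAt_integral_of_carried {μ : Measure ℝ} [IsFiniteMeasure μ] {C : Set ℝ}
    (hC : IsCompact C) (hμ : ∀ᵐ y ∂μ, y ∈ C) {f f' : ℝ → ℝ → ℂ}
    (hf : Continuous fun p : ℝ × ℝ => f p.1 p.2) (hf' : Continuous fun p : ℝ × ℝ => f' p.1 p.2)
    (h : ∀ x y, HasDerivAt (fun x => f x y) (f' x y) x) (x : ℝ) :
    HasDerivAt (fun x => ∫ y, f x y ∂μ) (∫ y, f' x y ∂μ) x := by
  obtain ⟨B, hB⟩ := ((isCompact_closedBall x 1).prod hC).exists_bound_of_continuousOn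
    hf'.continuousOn
  have hc : ∀ (g : ℝ → ℝ → ℂ), (Continuous fun p : ℝ × ℝ => g p.1 p.2) → ∀ x,
      Continuous fun y => g x y := fun g hg x =>
    hg.comp (by fun_prop : Continuous fun y : ℝ => (x, y))
  exact (hasDerivAt_integral_of_dominated_loc_of_deriv_le
    (F := f) (F' := f') (bound := fun _ => B) (Metric.closedBall_mem_nhds x one_pos)
    (Eventually.of_forall fun x => (hc f hf x).aestronglyMeasurable)
    (integrable_of_continuous_of_carried hC hμ (hc f hf x)) (hc f' hf' x).aestronglyMeasurable
    (hμ.mono fun y hy x' hx' => hB (x', y) ⟨hx', hy⟩) (integrable_const B)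
    (Eventually.of_forall fun y x' _ => h x' y)).2

/-- The divided difference of a `C²` function is differentiable in its first argument, and the
derivative is jointly continuous. -/
theorem exists_hasDerivAt_integral_segment {f : ℝ → ℂ} (hf : ContDiff ℝ 2 f) :
    ∃ φ : ℝ → ℝ → ℂ, (Continuous fun p : ℝ × ℝ => φ p.1 p.2) ∧ ∀ x y,
      HasDerivAt (fun x => ∫ t in (0 : ℝ)..1, deriv f (y + t * (x - y))) (φ x y) x := by
  have h1 : ContDiff ℝ 1 (deriv f) := ((contDiff_succ_iff_deriv (n := 1)).1 hf).2.2
  have hc1 : Continuous (deriv f) := h1.continuous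
  have hc2 : Continuous (deriv (deriv f)) := h1.continuous_deriv le_rfl
  have hμ : ∀ᵐ t ∂(volume.restrict (Set.Ioc (0 : ℝ) 1)), t ∈ Set.Icc (0 : ℝ) 1 :=
    (ae_restrict_mem measurableSet_Ioc).mono fun t ht => Set.Ioc_subset_Icc_self ht
  refine ⟨fun x y => ∫ t in Set.Ioc (0 : ℝ) 1, t * deriv (deriv f) (y + t * (x - y)),
    continuous_integral_of_carried isCompact_Icc hμ
      (f := fun (p : ℝ × ℝ) (t : ℝ) => (t : ℂ) * deriv (deriv f) (p.2 + t * (p.1 - p.2)))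
      (by fun_prop), fun x y => ?_⟩
  simp_rw [intervalIntegral.integral_of_le zero_le_one]
  refine hasDerivAt_integral_of_carried isCompact_Icc hμ
    (f := fun x t => deriv f (y + t * (x - y)))
    (f' := fun x t => (t : ℂ) * deriv (deriv f) (y + t * (x - y))) (by fun_prop) (by fun_prop)
    (fun x t => ?_) x
  have h2 : HasDerivAt (fun x : ℝ => y + t * (x - y)) t x := by
    simpa using (((hasDerivAt_id x).sub_const y).const_mul t).const_add y
  have h3 := (h1.differentiable one_ne_zero (y + t * (x - y))).hasDerivAt.scomp x h2
  simpa [Function.comp_def] using h3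

/-- The partial derivative of the Airy kernel in its first argument. -/
def airyKernelDeriv (lam : ℂ) (x y : ℝ) : ℂ := deriv (fun x => airyKernel lam x y) x

/-- The Airy kernel is continuously differentiable in its first argument, also on the diagonal,
because the divided differences of `A` and `A'` are. -/
theorem airyKernel_hasDerivAt_and_continuous (lam : ℂ) :
    (∀ x y, HasDerivAt (fun x => airyKernel lam x y) (airyKernelDeriv lam x y) x) ∧
      Continuous fun p : ℝ × ℝ => airyKernelDeriv lam p.1 p.2 := by
  have hA : ContDiff ℝ 1 (airyA lam) := contDiff_airyA lam
  have hA' := contDiff_deriv_airyA lam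
  have hA2 : ContDiff ℝ 2 (deriv (airyA lam)) :=
    ((contDiff_succ_iff_deriv (n := 2)).1 (contDiff_airyA lam)).2.2
  -- The numerator of the kernel is `A'(x) (A(x) - A(y)) - A(x) (A'(x) - A'(y))`.
  have key : ∀ x y, airyKernel lam x y =
      deriv (airyA lam) x * (∫ t in (0 : ℝ)..1, deriv (airyA lam) (y + t * (x - y)))
      - airyA lam x * (∫ t in (0 : ℝ)..1, deriv (deriv (airyA lam)) (y + t * (x - y))) := by
    intro x y
    by_cases h : x = y
    · subst h
      simp [airyKernel]
    · have h0 : ((x - y : ℝ) : ℂ) ≠ 0 := Complex.ofReal_ne_zero.2 (sub_ne_zero.2 h)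
      have e1 := integral_deriv_segment hA x y
      have e2 := integral_deriv_segment hA' x y
      simp only [airyKernel, h, if_false]
      rw [div_eq_iff h0]
      linear_combination airyA lam x * e2 - deriv (airyA lam) x * e1
  obtain ⟨φ, hφc, hφ⟩ := exists_hasDerivAt_integral_segment (contDiff_airyA lam (n := 2))
  obtain ⟨ψ, hψc, hψ⟩ := exists_hasDerivAt_integral_segment hA2
  have hd : ∀ x y : ℝ, HasDerivAt (fun x => airyKernel lam x y)
      ((x : ℂ) * airyA lam x * (∫ t in (0 : ℝ)..1, deriv (airyA lam) (y + t * (x - y)))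
        + deriv (airyA lam) x * φ x y
        - (deriv (airyA lam) x * (∫ t in (0 : ℝ)..1, deriv (deriv (airyA lam)) (y + t * (x - y)))
          + airyA lam x * ψ x y)) x := fun x y => by
    simp_rw [key]
    exact ((hasDerivAt_deriv_airyA lam x).mul (hφ x y)).sub
      ((hasDerivAt_airyA lam x).mul (hψ x y))
  refine ⟨fun x y => (hd x y).differentiableAt.hasDerivAt, ?_⟩
  have he : (fun p : ℝ × ℝ => airyKernelDeriv lam p.1 p.2) = _ :=
    funext fun p => (hd p.1 p.2).deriv
  rw [he]
  have c0 := hA.continuous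
  have c1 := hA'.continuous
  have c2 := continuous_integral_deriv_segment hA
  have c3 := continuous_integral_deriv_segment hA'
  fun_prop

theorem hasDerivAt_airyKernel (lam : ℂ) (x y : ℝ) :
    HasDerivAt (fun x => airyKernel lam x y) (airyKernelDeriv lam x y) x :=
  (airyKernel_hasDerivAt_and_continuous lam).1 x y

theorem continuous_airyKernelDeriv (lam : ℂ) :
    Continuous fun p : ℝ × ℝ => airyKernelDeriv lam p.1 p.2 :=
  (airyKernel_hasDerivAt_and_continuous lam).2

/-- `(∂ₓ + ∂ᵧ) K(x, y) = -A(x) A(y)`, where `∂ᵧ K(x, y) = ∂₁ K(y, x)` by symmetry. -/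
theorem airyKernelDeriv_add (lam : ℂ) (x y : ℝ) :
    airyKernelDeriv lam x y + airyKernelDeriv lam y x = -(airyA lam x * airyA lam y) := by
  -- Differentiate `(x - y) K(x, y)`, whose value is explicit.
  have hoff : ∀ x y : ℝ, x ≠ y →
      ((x : ℂ) - y) * airyKernelDeriv lam x y = deriv (airyA lam) x * deriv (airyA lam) y
        - x * airyA lam x * airyA lam y - airyKernel lam x y := fun x y h => by
    have h1 : HasDerivAt (fun x : ℝ => ((x : ℂ) - y) * airyKernel lam x y)
        (1 * airyKernel lam x y + ((x : ℂ) - y) * airyKernelDeriv lam x y) x :=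
      ((hasDerivAt_id x).ofReal_comp.sub_const (y : ℂ)).mul (hasDerivAt_airyKernel lam x y)
    have h2 : HasDerivAt (fun x : ℝ => ((x : ℂ) - y) * airyKernel lam x y)
        (deriv (airyA lam) x * deriv (airyA lam) y - x * airyA lam x * airyA lam y) x := by
      simp_rw [sub_mul_airyKernel]
      exact ((hasDerivAt_airyA lam x).mul_const _).sub
        ((hasDerivAt_deriv_airyA lam x).mul_const _)
    linear_combination h1.unique h2
  have hne : ∀ x y : ℝ, x ≠ y →
      airyKernelDeriv lam x y + airyKernelDeriv lam y x = -(airyA lam x * airyA lam y) := by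
    intro x y h
    have h0 : (x : ℂ) - y ≠ 0 := sub_ne_zero.2 fun e => h (Complex.ofReal_injective e)
    refine mul_left_cancel₀ h0 ?_
    linear_combination hoff x y h - hoff y x (Ne.symm h) + airyKernel_symm lam y x
  by_cases h : x = y
  · subst h
    -- the diagonal is reached by continuity
    have hK := continuous_airyKernelDeriv lam
    have hA := (contDiff_airyA lam (n := 0)).continuous
    have c1 : Continuous fun y => airyKernelDeriv lam x y + airyKernelDeriv lam y x :=
      (hK.comp (by fun_prop : Continuous fun y : ℝ => (x, y))).add
        (hK.comp (by fun_prop : Continuous fun y : ℝ => (y, x)))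
    have c2 : Continuous fun y => -(airyA lam x * airyA lam y) := by fun_prop
    refine tendsto_nhds_unique_of_eventuallyEq (l := 𝓝[≠] x)
      ((c1.tendsto x).mono_left nhdsWithin_le_nhds) ((c2.tendsto x).mono_left nhdsWithin_le_nhds) ?_
    filter_upwards [self_mem_nhdsWithin] with y hy using hne x y (Ne.symm hy)
  · exact hne x y h

/-! ### The domain of integration -/

theorem measurableSet_airyDomain {m : ℕ} (a : Fin (2 * m) → ℝ) : MeasurableSet (airyDomain a) :=
  MeasurableSet.iUnion fun _ => measurableSet_Ioo

theorem airyDomain_subset_Icc {m : ℕ} {a : Fin (2 * m) → ℝ} {L : ℝ} (hL : ∀ k, |a k| ≤ L) :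
    airyDomain a ⊆ Set.Icc (-L) L :=
  Set.iUnion_subset fun _ _ hx =>
    ⟨(abs_le.1 (hL _)).1.trans hx.1.le, hx.2.le.trans (abs_le.1 (hL _)).2⟩

theorem exists_airyDomain_subset_Icc {m : ℕ} (a : Fin (2 * m) → ℝ) :
    ∃ L, airyDomain a ⊆ Set.Icc (-L) L :=
  ⟨∑ k, |a k|, airyDomain_subset_Icc fun k =>
    Finset.single_le_sum (f := fun k => |a k|) (fun _ _ => abs_nonneg _) (Finset.mem_univ k)⟩

instance isFiniteMeasure_restrict_airyDomain {m : ℕ} (a : Fin (2 * m) → ℝ) :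
    IsFiniteMeasure (volume.restrict (airyDomain a)) := by
  obtain ⟨L, hL⟩ := exists_airyDomain_subset_Icc a
  exact isFiniteMeasure_restrict.2 ((measure_mono hL).trans_lt isCompact_Icc.measure_lt_top).ne

theorem exists_compact_carrying_airyDomain {m : ℕ} (a : Fin (2 * m) → ℝ) :
    ∃ C : Set ℝ, IsCompact C ∧ ∀ᵐ y ∂(volume.restrict (airyDomain a)), y ∈ C := by
  obtain ⟨L, hL⟩ := exists_airyDomain_subset_Icc a
  exact ⟨Set.Icc (-L) L, isCompact_Icc,
    (ae_restrict_mem (measurableSet_airyDomain a)).mono fun _ hx => hL hx⟩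

theorem integrableOn_airyDomain {m : ℕ} (a : Fin (2 * m) → ℝ) {h : ℝ → ℂ} (hh : Continuous h) :
    IntegrableOn h (airyDomain a) := by
  obtain ⟨C, hC, hμ⟩ := exists_compact_carrying_airyDomain a
  exact integrable_of_continuous_of_carried hC hμ hh

theorem continuous_integral_airyDomain {X : Type*} [TopologicalSpace X] [FirstCountableTopology X]
    [LocallyCompactSpace X] {m : ℕ} (a : Fin (2 * m) → ℝ) {f : X → ℝ → ℂ}
    (hf : Continuous fun p : X × ℝ => f p.1 p.2) :
    Continuous fun x => ∫ y in airyDomain a, f x y := by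
  obtain ⟨C, hC, hμ⟩ := exists_compact_carrying_airyDomain a
  exact continuous_integral_of_carried hC hμ hf

theorem integral_airyDomain_swap {m : ℕ} (a : Fin (2 * m) → ℝ) {f : ℝ → ℝ → ℂ}
    (hf : Continuous fun p : ℝ × ℝ => f p.1 p.2) :
    ∫ x in airyDomain a, ∫ y in airyDomain a, f x y
      = ∫ y in airyDomain a, ∫ x in airyDomain a, f x y := by
  obtain ⟨C, hC, hμ⟩ := exists_compact_carrying_airyDomain a
  exact integral_integral_swap_of_carried hC hμ hC hμ hf

theorem hasDerivAt_integral_airyDomain {m : ℕ} (a : Fin (2 * m) → ℝ) {f f' : ℝ → ℝ → ℂ}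
    (hf : Continuous fun p : ℝ × ℝ => f p.1 p.2) (hf' : Continuous fun p : ℝ × ℝ => f' p.1 p.2)
    (h : ∀ x y, HasDerivAt (fun x => f x y) (f' x y) x) (x : ℝ) :
    HasDerivAt (fun x => ∫ y in airyDomain a, f x y) (∫ y in airyDomain a, f' x y) x := by
  obtain ⟨C, hC, hμ⟩ := exists_compact_carrying_airyDomain a
  exact hasDerivAt_integral_of_carried hC hμ hf hf' h x

/-- Pairing the left endpoint of each interval with its right endpoint. -/
theorem sum_fin_two_mul {M : Type*} [AddCommMonoid M] {m : ℕ} (f : Fin (2 * m) → M) :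
    ∑ k, f k = ∑ j : Fin m, (f ⟨2 * j.val, by omega⟩ + f ⟨2 * j.val + 1, by omega⟩) := by
  induction m with
  | zero => rfl
  | succ m ih =>
    rw [Fin.sum_univ_castSucc (n := m)]
    have h := Fin.sum_univ_castSucc (n := 2 * m + 1) f
    rw [Fin.sum_univ_castSucc (n := 2 * m)] at h
    refine Eq.trans h ?_
    rw [ih fun k => f k.castSucc.castSucc, add_assoc]
    rfl

/-- Integrals over `J` in terms of the antiderivative at the endpoints. -/
theorem integral_airyDomain_eq_sum {m : ℕ} {a : Fin (2 * m) → ℝ} (ha : StrictMono a)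
    {h : ℝ → ℂ} (hh : Continuous h) :
    ∫ x in airyDomain a, h x = ∑ k, endpointSign k * ∫ x in (0 : ℝ)..(a k), h x := by
  have hdisj : Pairwise (Function.onFun Disjoint fun j : Fin m =>
      Set.Ioo (a ⟨2 * j.val, by omega⟩) (a ⟨2 * j.val + 1, by omega⟩)) := by
    have key : ∀ i j : Fin m, i < j → Disjoint
        (Set.Ioo (a ⟨2 * i.val, by omega⟩) (a ⟨2 * i.val + 1, by omega⟩))
        (Set.Ioo (a ⟨2 * j.val, by omega⟩) (a ⟨2 * j.val + 1, by omega⟩)) := fun i j hij => by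
      refine Set.disjoint_left.2 fun x hx hx' => ?_
      have h1 : a ⟨2 * i.val + 1, by omega⟩ ≤ a ⟨2 * j.val, by omega⟩ :=
        ha.monotone (by rw [Fin.le_def]; have := Fin.lt_def.1 hij; simp only; omega)
      exact absurd (hx.2.trans_le (h1.trans hx'.1.le)) (lt_irrefl _)
    intro i j hij
    rcases lt_or_gt_of_ne hij with h | h
    · exact key i j h
    · exact (key j i h).symm
  rw [airyDomain, integral_iUnion_fintype (fun _ => measurableSet_Ioo) hdisj fun j =>
    (hh.integrableOn_Icc).mono_set Set.Ioo_subset_Icc_self, sum_fin_two_mul]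
  refine Finset.sum_congr rfl fun j _ => ?_
  have hle : a ⟨2 * j.val, by omega⟩ ≤ a ⟨2 * j.val + 1, by omega⟩ :=
    ha.monotone (by rw [Fin.le_def]; simp)
  rw [← integral_Ioc_eq_integral_Ioo, ← intervalIntegral.integral_of_le hle,
    ← intervalIntegral.integral_interval_sub_left (hh.intervalIntegrable 0 _)
      (hh.intervalIntegrable 0 _)]
  have e1 : endpointSign (⟨2 * j.val, by omega⟩ : Fin (2 * m)) = -1 := by
    simp [endpointSign, pow_succ, pow_mul]
  have e2 : endpointSign (⟨2 * j.val + 1, by omega⟩ : Fin (2 * m)) = 1 := by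
    simp [endpointSign, pow_succ, pow_mul]
  rw [e1, e2]
  ring

/-- The boundary terms of an integral of a derivative over `J`. -/
theorem integral_airyDomain_deriv {m : ℕ} {a : Fin (2 * m) → ℝ} (ha : StrictMono a)
    {f f' : ℝ → ℂ} (hf : ∀ x, HasDerivAt f (f' x) x) (hf' : Continuous f') :
    ∫ x in airyDomain a, f' x = ∑ k, endpointSign k * f (a k) := by
  -- The signs cancel in pairs, so the constant of integration `f 0` drops out.
  have hsign : ∑ k : Fin (2 * m), endpointSign k = 0 := by
    rw [sum_fin_two_mul]
    exact Finset.sum_eq_zero fun j _ => by simp [endpointSign, pow_succ, pow_mul]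
  rw [integral_airyDomain_eq_sum ha hf']
  simp_rw [intervalIntegral.integral_eq_sub_of_hasDerivAt (fun x _ => hf x)
    (hf'.intervalIntegrable _ _), mul_sub, Finset.sum_sub_distrib, ← Finset.sum_mul, hsign]
  simp

/-! ### The resolvent kernel -/

theorem airyDet_eq_fredholmDet (lam : ℂ) {m : ℕ} (a : Fin (2 * m) → ℝ) :
    airyDet lam a = fredholmDet (airyKernel lam) (volume.restrict (airyDomain a)) := rfl

/-- Fredholm's resolvent kernel: the quotient of the first minor and the determinant. -/
def airyResolvent (lam : ℂ) {m : ℕ} (a : Fin (2 * m) → ℝ) (x y : ℝ) : ℂ :=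
  fredholmMinor (airyKernel lam) (volume.restrict (airyDomain a)) x y / airyDet lam a

theorem continuous_airyResolvent (lam : ℂ) {m : ℕ} (a : Fin (2 * m) → ℝ) :
    Continuous fun p : ℝ × ℝ => airyResolvent lam a p.1 p.2 := by
  obtain ⟨C, hC, hμ⟩ := exists_compact_carrying_airyDomain a
  exact (continuous_fredholmMinor (continuous_airyKernel lam) hC hμ).div_const _

theorem airyResolvent_symm (lam : ℂ) {m : ℕ} (a : Fin (2 * m) → ℝ) (x y : ℝ) :
    airyResolvent lam a x y = airyResolvent lam a y x := by
  rw [airyResolvent, airyResolvent, fredholmMinor_symm _ (airyKernel_symm lam)]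

section Resolvent

variable {lam : ℂ} {m : ℕ} {a : Fin (2 * m) → ℝ}

/-- Fredholm's relation divided by the determinant: `R = K + K R`. -/
theorem airyResolvent_eq (hD : airyDet lam a ≠ 0) (x y : ℝ) : airyResolvent lam a x y
    = airyKernel lam x y + ∫ s in airyDomain a, airyKernel lam x s * airyResolvent lam a s y := by
  obtain ⟨C, hC, hμ⟩ := exists_compact_carrying_airyDomain a
  have h := fredholmMinor_eq (continuous_airyKernel lam) hC hμ x y
  rw [← airyDet_eq_fredholmDet] at h
  simp_rw [airyResolvent, mul_div_assoc', integral_div]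
  rw [h]
  field_simp

/-- The relation `R = K + R K`, by symmetry of both kernels. -/
theorem airyResolvent_eq' (hD : airyDet lam a ≠ 0) (x y : ℝ) : airyResolvent lam a x y
    = airyKernel lam x y + ∫ s in airyDomain a, airyResolvent lam a x s * airyKernel lam s y := by
  rw [airyResolvent_symm, airyResolvent_eq hD, airyKernel_symm]
  congr 1
  refine integral_congr_ae (Eventually.of_forall fun s => ?_)
  beta_reduce
  rw [airyKernel_symm, airyResolvent_symm]
  ring

/-- The integral operator on `J` whose kernel is Fredholm's resolvent kernel. -/
def airyResolventOp (lam : ℂ) (a : Fin (2 * m) → ℝ) : C(ℝ, ℂ) →ₗ[ℂ] C(ℝ, ℂ) where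
  toFun f := ⟨fun x => ∫ y in airyDomain a, airyResolvent lam a x y * f y,
    continuous_integral_airyDomain a
      ((continuous_airyResolvent lam a).mul (f.continuous.comp continuous_snd))⟩
  map_add' f g := by
    have hi : ∀ (f : C(ℝ, ℂ)) (x : ℝ),
        IntegrableOn (fun y => airyResolvent lam a x y * f y) (airyDomain a) := fun f x =>
      integrableOn_airyDomain a (((continuous_airyResolvent lam a).comp
        (by fun_prop : Continuous fun y : ℝ => (x, y))).mul f.continuous)
    ext x
    simp only [ContinuousMap.coe_mk, ContinuousMap.add_apply, mul_add]
    exact integral_add (hi f x) (hi g x)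
  map_smul' c f := by
    ext x
    simp only [ContinuousMap.coe_mk, ContinuousMap.smul_apply, RingHom.id_apply, smul_eq_mul]
    rw [← integral_const_mul]
    exact integral_congr_ae (Eventually.of_forall fun y => by ring)

theorem airyOp_apply (lam : ℂ) (a : Fin (2 * m) → ℝ) (f : C(ℝ, ℂ)) (x : ℝ) :
    airyOp lam a f x = ∫ y in airyDomain a, airyKernel lam x y * f y := rfl

theorem airyResolventOp_apply (lam : ℂ) (a : Fin (2 * m) → ℝ) (f : C(ℝ, ℂ)) (x : ℝ) :
    airyResolventOp lam a f x = ∫ y in airyDomain a, airyResolvent lam a x y * f y := rfl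

theorem integrableOn_kernel_mul (a : Fin (2 * m) → ℝ) {k : ℝ → ℝ → ℂ}
    (hk : Continuous fun p : ℝ × ℝ => k p.1 p.2) {f : ℝ → ℂ} (hf : Continuous f) (x : ℝ) :
    IntegrableOn (fun y => k x y * f y) (airyDomain a) :=
  integrableOn_airyDomain a ((hk.comp (by fun_prop : Continuous fun y : ℝ => (x, y))).mul hf)

/-- The integral of a product of two kernels with a function. -/
theorem integral_mul_integral_swap (a : Fin (2 * m) → ℝ) {k l : ℝ → ℝ → ℂ}
    (hk : Continuous fun p : ℝ × ℝ => k p.1 p.2) (hl : Continuous fun p : ℝ × ℝ => l p.1 p.2)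
    {f : ℝ → ℂ} (hf : Continuous f) (x : ℝ) :
    ∫ y in airyDomain a, k x y * ∫ z in airyDomain a, l y z * f z
      = ∫ z in airyDomain a, (∫ y in airyDomain a, k x y * l y z) * f z := by
  simp_rw [← integral_const_mul, ← integral_mul_const]
  rw [integral_airyDomain_swap a (f := fun y z => k x y * (l y z * f z))
    ((hk.comp (by fun_prop : Continuous fun p : ℝ × ℝ => (x, p.1))).mul
      (hl.mul (hf.comp continuous_snd)))]
  simp_rw [mul_assoc]

theorem airyOp_airyResolventOp (hD : airyDet lam a ≠ 0) (f : C(ℝ, ℂ)) :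
    airyOp lam a (airyResolventOp lam a f) = airyResolventOp lam a f - airyOp lam a f := by
  have hk := continuous_airyKernel lam
  have hr := continuous_airyResolvent lam a
  ext x
  rw [ContinuousMap.sub_apply, airyOp_apply,
    airyResolventOp_apply, airyOp_apply]
  simp_rw [airyResolventOp_apply]
  rw [integral_mul_integral_swap a hk hr f.continuous, ← integral_sub
    (integrableOn_kernel_mul a hr f.continuous x) (integrableOn_kernel_mul a hk f.continuous x)]
  refine integral_congr_ae (Eventually.of_forall fun z => ?_)
  beta_reduce
  rw [airyResolvent_eq hD x z]
  ring

theorem airyResolventOp_airyOp (hD : airyDet lam a ≠ 0) (f : C(ℝ, ℂ)) :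
    airyResolventOp lam a (airyOp lam a f) = airyResolventOp lam a f - airyOp lam a f := by
  have hk := continuous_airyKernel lam
  have hr := continuous_airyResolvent lam a
  ext x
  rw [ContinuousMap.sub_apply, airyOp_apply,
    airyResolventOp_apply, airyResolventOp_apply]
  simp_rw [airyOp_apply]
  rw [integral_mul_integral_swap a hr hk f.continuous, ← integral_sub
    (integrableOn_kernel_mul a hr f.continuous x) (integrableOn_kernel_mul a hk f.continuous x)]
  refine integral_congr_ae (Eventually.of_forall fun z => ?_)
  beta_reduce
  rw [airyResolvent_eq' hD x z]
  ring

theorem one_sub_airyOp_mul (hD : airyDet lam a ≠ 0) :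
    (1 - airyOp lam a : Module.End ℂ C(ℝ, ℂ)) * (1 + airyResolventOp lam a) = 1 := by
  refine LinearMap.ext fun f => ?_
  change (f + airyResolventOp lam a f) - airyOp lam a (f + airyResolventOp lam a f) = f
  rw [map_add, airyOp_airyResolventOp hD]
  abel

theorem mul_one_sub_airyOp (hD : airyDet lam a ≠ 0) :
    (1 + airyResolventOp lam a : Module.End ℂ C(ℝ, ℂ)) * (1 - airyOp lam a) = 1 := by
  refine LinearMap.ext fun f => ?_
  change (f - airyOp lam a f) + airyResolventOp lam a (f - airyOp lam a f) = f
  rw [map_sub, airyResolventOp_airyOp hD]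
  abel

theorem isUnit_one_sub_airyOp (hD : airyDet lam a ≠ 0) :
    IsUnit (1 - airyOp lam a : Module.End ℂ C(ℝ, ℂ)) :=
  ⟨⟨_, _, one_sub_airyOp_mul hD, mul_one_sub_airyOp hD⟩, rfl⟩

theorem airyInv_eq (hD : airyDet lam a ≠ 0) : airyInv lam a = 1 + airyResolventOp lam a :=
  Ring.inverse_unit
    (⟨_, _, one_sub_airyOp_mul hD, mul_one_sub_airyOp hD⟩ : (Module.End ℂ C(ℝ, ℂ))ˣ)

/-- The kernel `((I - K)⁻¹ K(·, y))(x)` is Fredholm's quotient, which is known to be continuous and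
symmetric. -/
theorem airyR_eq_airyResolvent (hD : airyDet lam a ≠ 0) (x y : ℝ) :
    airyR lam a x y = airyResolvent lam a x y := by
  rw [airyR, airyInv_eq hD, airyResolvent_eq' hD]
  rfl

theorem continuous_airyR (hD : airyDet lam a ≠ 0) :
    Continuous fun p : ℝ × ℝ => airyR lam a p.1 p.2 := by
  simp_rw [airyR_eq_airyResolvent hD]
  exact continuous_airyResolvent lam a

theorem airyR_symm (hD : airyDet lam a ≠ 0) (x y : ℝ) : airyR lam a x y = airyR lam a y x := by
  rw [airyR_eq_airyResolvent hD, airyR_eq_airyResolvent hD, airyResolvent_symm]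

theorem airyR_eq (hD : airyDet lam a ≠ 0) (x y : ℝ) : airyR lam a x y
    = airyKernel lam x y + ∫ s in airyDomain a, airyKernel lam x s * airyR lam a s y := by
  simp_rw [airyR_eq_airyResolvent hD]
  exact airyResolvent_eq hD x y

theorem airyR_eq' (hD : airyDet lam a ≠ 0) (x y : ℝ) : airyR lam a x y
    = airyKernel lam x y + ∫ s in airyDomain a, airyR lam a x s * airyKernel lam s y := by
  simp_rw [airyR_eq_airyResolvent hD]
  exact airyResolvent_eq' hD x y

theorem airyInv_apply (hD : airyDet lam a ≠ 0) (f : C(ℝ, ℂ)) (x : ℝ) :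
    airyInv lam a f x = f x + ∫ y in airyDomain a, airyR lam a x y * f y := by
  rw [airyInv_eq hD]
  simp_rw [airyR_eq_airyResolvent hD]
  rfl

/-- `(I - K)⁻¹ f` solves the integral equation. -/
theorem airyInv_sub (hD : airyDet lam a ≠ 0) (f : C(ℝ, ℂ)) (x : ℝ) :
    airyInv lam a f x - ∫ y in airyDomain a, airyKernel lam x y * airyInv lam a f y = f x := by
  have h : (1 - airyOp lam a : Module.End ℂ C(ℝ, ℂ)) (airyInv lam a f) = f := by
    rw [airyInv_eq hD, ← Module.End.mul_apply, one_sub_airyOp_mul hD, Module.End.one_apply]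
  exact DFunLike.congr_fun h x

/-- The solution of the integral equation is unique. -/
theorem airyInv_eq_of_sub (hD : airyDet lam a ≠ 0) {f g : C(ℝ, ℂ)}
    (h : ∀ x, g x - ∫ y in airyDomain a, airyKernel lam x y * g y = f x) :
    airyInv lam a f = g := by
  have h1 : (1 - airyOp lam a : Module.End ℂ C(ℝ, ℂ)) g = f := ContinuousMap.ext h
  rw [← h1, airyInv_eq hD, ← Module.End.mul_apply, mul_one_sub_airyOp hD, Module.End.one_apply]

theorem airyOp_mul_airyInv_apply (hD : airyDet lam a ≠ 0) (f : C(ℝ, ℂ)) (x : ℝ) :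
    (airyOp lam a * airyInv lam a : Module.End ℂ C(ℝ, ℂ)) f x
      = ∫ y in airyDomain a, airyR lam a x y * f y := by
  have h1 := airyInv_sub hD f x
  rw [airyInv_apply hD f x] at h1
  rw [Module.End.mul_apply, airyOp_apply]
  linear_combination -h1

end Resolvent

/-! ### Commutation identities for the resolvent -/

section Identities

variable {lam : ℂ} {m : ℕ} {a : Fin (2 * m) → ℝ}

theorem continuous_airyA (lam : ℂ) : Continuous (airyA lam) :=
  (contDiff_airyA lam (n := 0)).continuous

theorem continuous_deriv_airyA (lam : ℂ) : Continuous (deriv (airyA lam)) :=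
  (contDiff_deriv_airyA lam).continuous

theorem airyQ_sub (hD : airyDet lam a ≠ 0) (x : ℝ) :
    airyQ lam a x - ∫ y in airyDomain a, airyKernel lam x y * airyQ lam a y = airyA lam x :=
  airyInv_sub hD _ x

theorem airyP_sub (hD : airyDet lam a ≠ 0) (x : ℝ) :
    airyP lam a x - ∫ y in airyDomain a, airyKernel lam x y * airyP lam a y
      = deriv (airyA lam) x :=
  airyInv_sub hD _ x

/-- `(I - K)⁻¹` is symmetric for the bilinear pairing over `J`. -/
theorem integral_mul_airyInv (hD : airyDet lam a ≠ 0) (f g : C(ℝ, ℂ)) :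
    ∫ x in airyDomain a, f x * airyInv lam a g x
      = ∫ x in airyDomain a, airyInv lam a f x * g x := by
  have hR := continuous_airyR hD
  have hc : ∀ f : C(ℝ, ℂ), Continuous fun x => ∫ y in airyDomain a, airyR lam a x y * f y :=
    fun f => continuous_integral_airyDomain a (hR.mul (f.continuous.comp continuous_snd))
  have i1 : IntegrableOn (fun x => f x * g x) (airyDomain a) :=
    integrableOn_airyDomain a (by fun_prop)
  have i2 : IntegrableOn (fun x => f x * ∫ y in airyDomain a, airyR lam a x y * g y)
    (airyDomain a) := integrableOn_airyDomain a (f.continuous.mul (hc g))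
  have i3 : IntegrableOn (fun x => (∫ y in airyDomain a, airyR lam a x y * f y) * g x)
    (airyDomain a) := integrableOn_airyDomain a ((hc f).mul g.continuous)
  simp_rw [airyInv_apply hD, mul_add, add_mul]
  rw [integral_add i1 i2, integral_add i1 i3]
  congr 1
  simp_rw [← integral_const_mul, ← integral_mul_const]
  rw [integral_airyDomain_swap a (f := fun x y => f x * (airyR lam a x y * g y))
    ((f.continuous.comp continuous_fst).mul (hR.mul (g.continuous.comp continuous_snd)))]
  refine integral_congr_ae (Eventually.of_forall fun x => ?_)
  refine integral_congr_ae (Eventually.of_forall fun y => ?_)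
  beta_reduce
  rw [airyR_symm hD]
  ring

/-- The pairings of `A'` with `Q` and of `A` with `P` agree. -/
theorem integral_deriv_airyA_mul_airyQ (hD : airyDet lam a ≠ 0) :
    ∫ x in airyDomain a, deriv (airyA lam) x * airyQ lam a x = airyv lam a := by
  refine (integral_mul_airyInv hD ⟨deriv (airyA lam), (contDiff_deriv_airyA lam).continuous⟩
    ⟨airyA lam, continuous_airyA lam⟩).trans ?_
  exact integral_congr_ae (Eventually.of_forall fun x => mul_comm _ _)

/-- By symmetry of `R`, this is the formula `Q = A + R A`. -/
theorem integral_airyA_mul_airyR (hD : airyDet lam a ≠ 0) (y : ℝ) :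
    ∫ z in airyDomain a, airyA lam z * airyR lam a z y = airyQ lam a y - airyA lam y := by
  have h := airyInv_apply hD ⟨airyA lam, continuous_airyA lam⟩ y
  rw [airyQ, h, ContinuousMap.coe_mk, add_sub_cancel_left]
  refine integral_congr_ae (Eventually.of_forall fun z => ?_)
  beta_reduce
  rw [airyR_symm hD, mul_comm]

/-- By symmetry of `R`, this is the formula `P = A' + R A'`. -/
theorem integral_deriv_airyA_mul_airyR (hD : airyDet lam a ≠ 0) (y : ℝ) :
    ∫ z in airyDomain a, deriv (airyA lam) z * airyR lam a z y
      = airyP lam a y - deriv (airyA lam) y := by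
  have h := airyInv_apply hD ⟨deriv (airyA lam), continuous_deriv_airyA lam⟩ y
  rw [airyP, h, ContinuousMap.coe_mk, add_sub_cancel_left]
  refine integral_congr_ae (Eventually.of_forall fun z => ?_)
  beta_reduce
  rw [airyR_symm hD, mul_comm]

/-- The commutator of the operator `K` with multiplication by the variable has rank two. -/
theorem integral_airyKernel_mul_id_mul {g : ℝ → ℂ} (hg : Continuous g) (x : ℝ) :
    ∫ z in airyDomain a, airyKernel lam x z * (z * g z)
      = x * (∫ z in airyDomain a, airyKernel lam x z * g z)
        - airyA lam x * (∫ z in airyDomain a, deriv (airyA lam) z * g z)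
        + deriv (airyA lam) x * ∫ z in airyDomain a, airyA lam z * g z := by
  have hA := continuous_airyA lam
  have hA' := continuous_deriv_airyA lam
  have hk : Continuous fun z => airyKernel lam x z :=
    (continuous_airyKernel lam).comp (by fun_prop : Continuous fun z : ℝ => (x, z))
  have i1 : IntegrableOn (fun z => x * (airyKernel lam x z * g z)) (airyDomain a) :=
    integrableOn_airyDomain a (by fun_prop)
  have i2 : IntegrableOn (fun z => airyA lam x * (deriv (airyA lam) z * g z)) (airyDomain a) :=
    integrableOn_airyDomain a (by fun_prop)
  have i3 : IntegrableOn (fun z => deriv (airyA lam) x * (airyA lam z * g z)) (airyDomain a) :=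
    integrableOn_airyDomain a (by fun_prop)
  simp_rw [← integral_const_mul]
  rw [← integral_sub i1 i2, ← integral_add (by exact i1.sub i2) i3]
  refine integral_congr_ae (Eventually.of_forall fun z => ?_)
  beta_reduce
  linear_combination (-g z) * sub_mul_airyKernel lam x z

/-- `(I - K)⁻¹` applied to `x A(x)`. -/
theorem airyInv_id_mul_airyA (hD : airyDet lam a ≠ 0) (x : ℝ) :
    airyInv lam a ⟨fun x => (x : ℂ) * airyA lam x,
        Complex.continuous_ofReal.mul (continuous_airyA lam)⟩ x
      = x * airyQ lam a x - airyQ lam a x * airyv lam a + airyP lam a x * airyu lam a := by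
  have hQ := (airyQ lam a).continuous
  have hP := (airyP lam a).continuous
  have h := airyInv_eq_of_sub hD
    (f := ⟨fun x => (x : ℂ) * airyA lam x,
        Complex.continuous_ofReal.mul (continuous_airyA lam)⟩)
    (g := ⟨fun x => (x : ℂ) * airyQ lam a x - airyQ lam a x * airyv lam a
      + airyP lam a x * airyu lam a, by fun_prop⟩) (fun x => by
    have hk : Continuous fun z => airyKernel lam x z :=
      (continuous_airyKernel lam).comp (by fun_prop : Continuous fun z : ℝ => (x, z))
    have i1 : IntegrableOn (fun z => airyKernel lam x z * (z * airyQ lam a z)) (airyDomain a) :=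
      integrableOn_airyDomain a (by fun_prop)
    have i2 : IntegrableOn (fun z => airyKernel lam x z * airyQ lam a z * airyv lam a)
      (airyDomain a) := integrableOn_airyDomain a (by fun_prop)
    have i3 : IntegrableOn (fun z => airyKernel lam x z * airyP lam a z * airyu lam a)
      (airyDomain a) := integrableOn_airyDomain a (by fun_prop)
    simp only [ContinuousMap.coe_mk]
    have e : ∫ z in airyDomain a, airyKernel lam x z * (z * airyQ lam a z
        - airyQ lam a z * airyv lam a + airyP lam a z * airyu lam a)
        = (∫ z in airyDomain a, airyKernel lam x z * (z * airyQ lam a z))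
          - (∫ z in airyDomain a, airyKernel lam x z * airyQ lam a z) * airyv lam a
          + (∫ z in airyDomain a, airyKernel lam x z * airyP lam a z) * airyu lam a := by
      rw [← integral_mul_const, ← integral_mul_const, ← integral_sub i1 i2,
        ← integral_add (by exact i1.sub i2) i3]
      exact integral_congr_ae (Eventually.of_forall fun z => by ring)
    have hu : airyu lam a = ∫ z in airyDomain a, airyA lam z * airyQ lam a z := rfl
    rw [e, integral_airyKernel_mul_id_mul hQ, integral_deriv_airyA_mul_airyQ hD, ← hu]
    linear_combination (x - airyv lam a) * airyQ_sub hD x + airyu lam a * airyP_sub hD x)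
  rw [h]
  rfl

/-- The resolvent kernel is of the same form as the Airy kernel, with `Q`, `P` in place of
`A`, `A'`. -/
theorem sub_mul_airyR (hD : airyDet lam a ≠ 0) (x y : ℝ) :
    ((x : ℂ) - y) * airyR lam a x y
      = airyQ lam a x * airyP lam a y - airyP lam a x * airyQ lam a y := by
  have hR : Continuous fun z => airyR lam a z y :=
    (continuous_airyR hD).comp (by fun_prop : Continuous fun z : ℝ => (z, y))
  have h := airyInv_eq_of_sub hD
    (f := airyP lam a y • (⟨airyA lam, continuous_airyA lam⟩ : C(ℝ, ℂ))
      - airyQ lam a y • (⟨deriv (airyA lam), continuous_deriv_airyA lam⟩ : C(ℝ, ℂ)))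
    (g := ⟨fun x => ((x : ℂ) - y) * airyR lam a x y, by fun_prop⟩) (fun x => by
    have hk : Continuous fun z => airyKernel lam x z :=
      (continuous_airyKernel lam).comp (by fun_prop : Continuous fun z : ℝ => (x, z))
    have i1 : IntegrableOn (fun z => airyKernel lam x z * (z * airyR lam a z y)) (airyDomain a) :=
      integrableOn_airyDomain a (by fun_prop)
    have i2 : IntegrableOn (fun z => y * (airyKernel lam x z * airyR lam a z y))
      (airyDomain a) := integrableOn_airyDomain a (by fun_prop)
    simp only [ContinuousMap.coe_mk, ContinuousMap.sub_apply, ContinuousMap.smul_apply,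
      smul_eq_mul]
    have e : ∫ z in airyDomain a, airyKernel lam x z * ((z - y) * airyR lam a z y)
        = (∫ z in airyDomain a, airyKernel lam x z * (z * airyR lam a z y))
          - y * ∫ z in airyDomain a, airyKernel lam x z * airyR lam a z y := by
      rw [← integral_const_mul, ← integral_sub i1 i2]
      exact integral_congr_ae (Eventually.of_forall fun z => by ring)
    rw [e, integral_airyKernel_mul_id_mul hR, integral_deriv_airyA_mul_airyR hD,
      integral_airyA_mul_airyR hD]
    linear_combination ((x : ℂ) - y) * airyR_eq hD x y + sub_mul_airyKernel lam x y)
  rw [map_sub, map_smul, map_smul] at h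
  have h1 := DFunLike.congr_fun h x
  simp only [ContinuousMap.coe_mk, ContinuousMap.sub_apply, ContinuousMap.smul_apply,
      smul_eq_mul] at h1
  rw [← h1, airyQ, airyP]
  ring

theorem airyR_eq_div (hD : airyDet lam a ≠ 0) {x y : ℝ} (h : x ≠ y) :
    airyR lam a x y = (airyQ lam a x * airyP lam a y - airyP lam a x * airyQ lam a y)
      / ((x - y : ℝ) : ℂ) := by
  have h0 : ((x - y : ℝ) : ℂ) ≠ 0 := Complex.ofReal_ne_zero.2 (sub_ne_zero.2 h)
  rw [eq_div_iff h0, ← sub_mul_airyR hD]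
  push_cast
  ring

/-- The commutator of `(I - K)⁻¹` with differentiation. -/
theorem hasDerivAt_airyInv (ha : StrictMono a) (hD : airyDet lam a ≠ 0) {f f' : C(ℝ, ℂ)}
    (hf : ∀ x, HasDerivAt f (f' x) x) (x : ℝ) :
    HasDerivAt (airyInv lam a f) (airyInv lam a f' x
      - airyQ lam a x * (∫ y in airyDomain a, airyA lam y * airyInv lam a f y)
      - ∑ k, endpointSign k * airyR lam a x (a k) * airyInv lam a f (a k)) x := by
  set F := airyInv lam a f with hF
  have hFc := F.continuous
  have hk := continuous_airyKernel lam
  have hk1 := continuous_airyKernelDeriv lam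
  have hcF : Continuous fun p : ℝ × ℝ => F p.2 := F.continuous.comp continuous_snd
  -- `G` is the derivative of `F`, found by differentiating the integral equation of `F`.
  -- Integration by parts shows that `(I - K) G` is `f'`, minus a multiple of `A`, minus multiples
  -- of the functions `K(·, aₖ)`.
  set G : C(ℝ, ℂ) := ⟨fun x => f' x + ∫ y in airyDomain a, airyKernelDeriv lam x y * F y,
    f'.continuous.add (continuous_integral_airyDomain a (hk1.mul hcF))⟩ with hG
  have hFG : ∀ x, HasDerivAt F (G x) x := fun x => by
    have h1 : ⇑F = fun x => f x + ∫ y in airyDomain a, airyKernel lam x y * F y :=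
      funext fun x => by rw [← airyInv_sub hD f x]; ring
    rw [h1]
    exact (hf x).add (hasDerivAt_integral_airyDomain a (hk.mul hcF) (hk1.mul hcF)
      (fun x y => (hasDerivAt_airyKernel lam x y).mul_const (F y)) x)
  have hinv := airyInv_eq_of_sub hD (g := G)
    (f := f' - (∫ y in airyDomain a, airyA lam y * F y) •
        (⟨airyA lam, continuous_airyA lam⟩ : C(ℝ, ℂ))
      - ∑ k, (endpointSign k * F (a k)) • (⟨fun z => airyKernel lam z (a k),
        hk.comp (by fun_prop : Continuous fun z : ℝ => (z, a k))⟩ : C(ℝ, ℂ))) (fun x => by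
    have c1 : Continuous fun y => airyKernel lam x y :=
      hk.comp (by fun_prop : Continuous fun z : ℝ => (x, z))
    have c2 : Continuous fun y => airyKernelDeriv lam y x :=
      hk1.comp (by fun_prop : Continuous fun z : ℝ => (z, x))
    have c3 : Continuous fun y => airyKernelDeriv lam x y :=
      hk1.comp (by fun_prop : Continuous fun z : ℝ => (x, z))
    have i1 : IntegrableOn (fun y => airyKernelDeriv lam y x * F y) (airyDomain a) :=
      integrableOn_airyDomain a (by fun_prop)
    have i2 : IntegrableOn (fun y => airyKernel lam x y * G y) (airyDomain a) :=
      integrableOn_airyDomain a (by fun_prop)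
    have i3 : IntegrableOn (fun y => airyKernelDeriv lam x y * F y) (airyDomain a) :=
      integrableOn_airyDomain a (by fun_prop)
    have hparts := integral_airyDomain_deriv ha
      (f := fun y => airyKernel lam x y * F y)
      (f' := fun y => airyKernelDeriv lam y x * F y + airyKernel lam x y * G y) (fun y => by
        have h2 : HasDerivAt (fun y => airyKernel lam x y) (airyKernelDeriv lam y x) y :=
          (hasDerivAt_airyKernel lam y x).congr_of_eventuallyEq
            (Eventually.of_forall fun y => airyKernel_symm lam x y)
        exact h2.mul (hFG y)) (by fun_prop)
    rw [integral_add i1 i2] at hparts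
    have hadd : (∫ y in airyDomain a, airyKernelDeriv lam x y * F y)
        + ∫ y in airyDomain a, airyKernelDeriv lam y x * F y
        = -(airyA lam x * ∫ y in airyDomain a, airyA lam y * F y) := by
      rw [← integral_add i3 i1, ← integral_const_mul, ← integral_neg]
      refine integral_congr_ae (Eventually.of_forall fun y => ?_)
      beta_reduce
      linear_combination F y * airyKernelDeriv_add lam x y
    simp only [ContinuousMap.sub_apply, ContinuousMap.smul_apply, ContinuousMap.coe_sum,
      Finset.sum_apply, smul_eq_mul, ContinuousMap.coe_mk]
    have hsum : ∑ k, endpointSign k * F (a k) * airyKernel lam x (a k)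
        = ∑ k, endpointSign k * (airyKernel lam x (a k) * F (a k)) :=
      Finset.sum_congr rfl fun k _ => by ring
    have hGx : G x = f' x + ∫ y in airyDomain a, airyKernelDeriv lam x y * F y := rfl
    rw [hsum, hGx]
    linear_combination hadd - hparts)
  refine (hFG x).congr_deriv ?_
  rw [← hinv, map_sub, map_sub, map_smul, map_sum]
  simp only [map_smul, ContinuousMap.sub_apply, ContinuousMap.smul_apply, ContinuousMap.coe_sum,
      Finset.sum_apply, smul_eq_mul]
  have hsum : ∑ k, endpointSign k * airyR lam a x (a k) * F (a k)
      = ∑ k, endpointSign k * F (a k) * airyR lam a x (a k) :=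
    Finset.sum_congr rfl fun k _ => by ring
  rw [hsum, mul_comm (airyQ lam a x)]
  rfl

/-- The commutator with differentiation, applied to `A`. -/
theorem hasDerivAt_airyQ (ha : StrictMono a) (hD : airyDet lam a ≠ 0) (x : ℝ) :
    HasDerivAt (airyQ lam a) (airyP lam a x - airyQ lam a x * airyu lam a
      - ∑ k, endpointSign k * airyR lam a x (a k) * airyQ lam a (a k)) x :=
  hasDerivAt_airyInv ha hD (f := ⟨airyA lam, (contDiff_airyA lam (n := 0)).continuous⟩)
    (f' := ⟨deriv (airyA lam), (contDiff_deriv_airyA lam).continuous⟩)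
    (fun x => hasDerivAt_airyA lam x) x

/-- The commutator with differentiation, applied to `A'`; by Airy's equation the right-hand side
contains `(I - K)⁻¹ (x A)`, which contributes one of the two terms `Q v`. -/
theorem hasDerivAt_airyP (ha : StrictMono a) (hD : airyDet lam a ≠ 0) (x : ℝ) :
    HasDerivAt (airyP lam a) (x * airyQ lam a x + airyP lam a x * airyu lam a
      - 2 * airyQ lam a x * airyv lam a
      - ∑ k, endpointSign k * airyR lam a x (a k) * airyP lam a (a k)) x := by
  have h := hasDerivAt_airyInv ha hD
    (f := ⟨deriv (airyA lam), (contDiff_deriv_airyA lam).continuous⟩)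
    (f' := ⟨fun x => (x : ℂ) * airyA lam x,
        Complex.continuous_ofReal.mul (continuous_airyA lam)⟩)
    (fun x => hasDerivAt_deriv_airyA lam x) x
  rw [airyInv_id_mul_airyA hD] at h
  refine h.congr_deriv ?_
  have hv : ∫ y in airyDomain a, airyA lam y * airyInv lam a
      ⟨deriv (airyA lam), (contDiff_deriv_airyA lam).continuous⟩ y = airyv lam a := rfl
  rw [hv, airyP]
  ring

/-- The diagonal of the resolvent kernel, as the limit of the off-diagonal quotient. -/
theorem airyR_diag (ha : StrictMono a) (hD : airyDet lam a ≠ 0) (x : ℝ) :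
    airyR lam a x x = deriv (airyQ lam a) x * airyP lam a x
      - deriv (airyP lam a) x * airyQ lam a x := by
  have hQ := (hasDerivAt_airyQ ha hD x).differentiableAt.hasDerivAt
  have hP := (hasDerivAt_airyP ha hD x).differentiableAt.hasDerivAt
  have h1 : HasDerivAt (fun z : ℝ => ((z : ℂ) - x) * airyR lam a z x)
      (deriv (airyQ lam a) x * airyP lam a x - deriv (airyP lam a) x * airyQ lam a x) x := by
    simp_rw [sub_mul_airyR hD]
    exact (hQ.mul_const _).sub (hP.mul_const _)
  have hR : Continuous fun z => airyR lam a z x :=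
    (continuous_airyR hD).comp (by fun_prop : Continuous fun z : ℝ => (z, x))
  have h2 := hasDerivAt_iff_tendsto_slope.1 h1
  refine tendsto_nhds_unique ((hR.tendsto x).mono_left nhdsWithin_le_nhds) (h2.congr' ?_)
  filter_upwards [self_mem_nhdsWithin] with z hz
  have hz0 : ((z : ℂ) - x) ≠ 0 := sub_ne_zero.2 fun e => hz (Complex.ofReal_injective e)
  rw [slope_def_module, sub_self, zero_mul, sub_zero, Complex.real_smul]
  push_cast
  field_simp

theorem airyR_endpoint (hD : airyDet lam a ≠ 0) (ha : StrictMono a) {j k : Fin (2 * m)}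
    (h : j ≠ k) : airyR lam a (a j) (a k)
      = (airyq lam j a * airyp lam k a - airyp lam j a * airyq lam k a)
        / ((a j - a k : ℝ) : ℂ) :=
  airyR_eq_div hD (ha.injective.ne h)

/-- In `Q' P - P' Q` at `aⱼ`, the `j`-th terms of the two sums over the endpoints cancel. -/
theorem airyR_diag_endpoint (ha : StrictMono a) (hD : airyDet lam a ≠ 0) (j : Fin (2 * m)) :
    airyR lam a (a j) (a j)
      = (∑ k ∈ Finset.univ.erase j,
          endpointSign k * ((airyq lam j a * airyp lam k a - airyp lam j a * airyq lam k a) ^ 2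
            / ((a j - a k : ℝ) : ℂ)))
        + airyp lam j a ^ 2 - (a j : ℂ) * airyq lam j a ^ 2
        - 2 * airyp lam j a * airyq lam j a * airyu lam a
        + 2 * airyq lam j a ^ 2 * airyv lam a := by
  rw [airyR_diag ha hD, (hasDerivAt_airyQ ha hD _).deriv, (hasDerivAt_airyP ha hD _).deriv]
  have hsum : (∑ k ∈ Finset.univ.erase j,
      endpointSign k * ((airyq lam j a * airyp lam k a - airyp lam j a * airyq lam k a) ^ 2
            / ((a j - a k : ℝ) : ℂ)))
      = (∑ k, endpointSign k * airyR lam a (a j) (a k) * airyP lam a (a k)) * airyQ lam a (a j)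
        - (∑ k, endpointSign k * airyR lam a (a j) (a k) * airyQ lam a (a k))
          * airyP lam a (a j) := by
    rw [Finset.sum_mul, Finset.sum_mul, ← Finset.sum_sub_distrib,
      ← Finset.add_sum_erase _ _ (Finset.mem_univ j)]
    rw [show endpointSign j * airyR lam a (a j) (a j) * airyP lam a (a j) * airyQ lam a (a j)
      - endpointSign j * airyR lam a (a j) (a j) * airyQ lam a (a j) * airyP lam a (a j) = 0 by
        ring, zero_add]
    refine Finset.sum_congr rfl fun k hk => ?_
    rw [airyR_endpoint hD ha (Finset.ne_of_mem_erase hk).symm]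
    simp only [airyq, airyp]
    ring
  rw [hsum]
  simp only [airyq, airyp]
  ring

/-- Obtained by integrating `(A Q)'` over `J`. -/
theorem two_mul_airyv_sub (ha : StrictMono a) (hD : airyDet lam a ≠ 0) :
    2 * airyv lam a - airyu lam a ^ 2 = ∑ j, endpointSign j * airyq lam j a ^ 2 := by
  have hA := continuous_airyA lam
  have hA' := continuous_deriv_airyA lam
  have hR := continuous_airyR hD
  have hRk : ∀ k, Continuous fun x => airyR lam a x (a k) := fun k =>
    hR.comp (by fun_prop : Continuous fun x : ℝ => (x, a k))
  have h := integral_airyDomain_deriv ha (f := fun x => airyA lam x * airyQ lam a x)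
    (f' := fun x => deriv (airyA lam) x * airyQ lam a x + airyA lam x * (airyP lam a x
      - airyQ lam a x * airyu lam a
      - ∑ k, endpointSign k * airyR lam a x (a k) * airyQ lam a (a k)))
    (fun x => (hasDerivAt_airyA lam x).mul (hasDerivAt_airyQ ha hD x)) (by fun_prop)
  have i1 : IntegrableOn (fun x => deriv (airyA lam) x * airyQ lam a x) (airyDomain a) :=
    integrableOn_airyDomain a (by fun_prop)
  have i2 : IntegrableOn (fun x => airyA lam x * airyP lam a x) (airyDomain a) :=
    integrableOn_airyDomain a (by fun_prop)
  have i3 : IntegrableOn (fun x => airyA lam x * airyQ lam a x * airyu lam a) (airyDomain a) :=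
    integrableOn_airyDomain a (by fun_prop)
  have i4 : ∀ k, IntegrableOn (fun x => airyA lam x * airyR lam a x (a k)
      * (endpointSign k * airyQ lam a (a k))) (airyDomain a) := fun k =>
    integrableOn_airyDomain a (by have := hRk k; fun_prop)
  have e : ∀ x, deriv (airyA lam) x * airyQ lam a x + airyA lam x * (airyP lam a x
      - airyQ lam a x * airyu lam a
      - ∑ k, endpointSign k * airyR lam a x (a k) * airyQ lam a (a k))
      = deriv (airyA lam) x * airyQ lam a x + (airyA lam x * airyP lam a x
        - airyA lam x * airyQ lam a x * airyu lam a
        - ∑ k, airyA lam x * airyR lam a x (a k) * (endpointSign k * airyQ lam a (a k))) := by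
    intro x
    rw [mul_sub, mul_sub, Finset.mul_sum]
    congr 2
    · ring
    · exact Finset.sum_congr rfl fun k _ => by ring
  simp_rw [e] at h
  rw [integral_add i1 (by exact (i2.sub i3).sub (integrable_finsetSum _ fun k _ => i4 k)),
    integral_sub (by exact i2.sub i3) (integrable_finsetSum _ fun k _ => i4 k),
    integral_sub i2 i3, integral_finsetSum _ fun k _ => i4 k, integral_mul_const,
    integral_deriv_airyA_mul_airyQ hD] at h
  simp_rw [integral_mul_const, integral_airyA_mul_airyR hD] at h
  have hu : ∫ x in airyDomain a, airyA lam x * airyQ lam a x = airyu lam a := rfl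
  have hv : ∫ x in airyDomain a, airyA lam x * airyP lam a x = airyv lam a := rfl
  rw [hu, hv] at h
  have hs : ∑ j, endpointSign j * airyq lam j a ^ 2
      = (∑ k, (airyQ lam a (a k) - airyA lam (a k)) * (endpointSign k * airyQ lam a (a k)))
        + ∑ k, endpointSign k * (airyA lam (a k) * airyQ lam a (a k)) := by
    rw [← Finset.sum_add_distrib]
    exact Finset.sum_congr rfl fun k _ => by rw [airyq]; ring
  rw [hs, ← h]
  ring

end Identities

/-! ### The trace identity -/

section TraceIdentity

variable {lam : ℂ} {m : ℕ} {a : Fin (2 * m) → ℝ}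

/-- The partial derivative of the resolvent kernel in its first argument. -/
def airyRDeriv (lam : ℂ) (a : Fin (2 * m) → ℝ) (x y : ℝ) : ℂ :=
  airyKernelDeriv lam x y + ∫ z in airyDomain a, airyKernelDeriv lam x z * airyR lam a z y

theorem continuous_airyRDeriv (hD : airyDet lam a ≠ 0) :
    Continuous fun p : ℝ × ℝ => airyRDeriv lam a p.1 p.2 := by
  have hk1 := continuous_airyKernelDeriv lam
  have hR := continuous_airyR hD
  refine hk1.add (continuous_integral_airyDomain a
    (f := fun (p : ℝ × ℝ) z => airyKernelDeriv lam p.1 z * airyR lam a z p.2) ?_)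
  exact (hk1.comp (by fun_prop : Continuous fun p : (ℝ × ℝ) × ℝ => (p.1.1, p.2))).mul
    (hR.comp (by fun_prop : Continuous fun p : (ℝ × ℝ) × ℝ => (p.2, p.1.2)))

theorem hasDerivAt_airyR (hD : airyDet lam a ≠ 0) (x y : ℝ) :
    HasDerivAt (fun x => airyR lam a x y) (airyRDeriv lam a x y) x := by
  have hR : Continuous fun p : ℝ × ℝ => airyR lam a p.2 y :=
    (continuous_airyR hD).comp (by fun_prop : Continuous fun p : ℝ × ℝ => (p.2, y))
  have h := (hasDerivAt_airyKernel lam x y).add (hasDerivAt_integral_airyDomain a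
    (f := fun x z => airyKernel lam x z * airyR lam a z y)
    (f' := fun x z => airyKernelDeriv lam x z * airyR lam a z y)
    ((continuous_airyKernel lam).mul hR) ((continuous_airyKernelDeriv lam).mul hR)
    (fun x z => (hasDerivAt_airyKernel lam x z).mul_const _) x)
  exact h.congr_of_eventuallyEq (Eventually.of_forall fun x => airyR_eq hD x y)

/-- Both sides are the integral over `z` of `∂₁K(x, z) ((I - K)⁻¹ K(·, x))(z)`: on the left because
`∂₁R = ∂₁K (I - K)⁻¹`, on the right because `R = (I - K)⁻¹ K`. -/
theorem integral_airyKernel_mul_airyRDeriv (hD : airyDet lam a ≠ 0) (x : ℝ) :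
    ∫ y in airyDomain a, airyKernel lam x y * airyRDeriv lam a x y
      = ∫ y in airyDomain a, airyKernelDeriv lam x y * airyR lam a x y := by
  have hk := continuous_airyKernel lam
  have hk1 := continuous_airyKernelDeriv lam
  have hR := continuous_airyR hD
  have ck : Continuous fun y => airyKernel lam x y :=
    hk.comp (by fun_prop : Continuous fun y : ℝ => (x, y))
  have ck1 : Continuous fun y => airyKernelDeriv lam x y :=
    hk1.comp (by fun_prop : Continuous fun y : ℝ => (x, y))
  have cR : Continuous fun p : ℝ × ℝ => airyR lam a p.2 p.1 :=
    hR.comp (by fun_prop : Continuous fun p : ℝ × ℝ => (p.2, p.1))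
  have c1 : Continuous fun y => ∫ z in airyDomain a, airyKernelDeriv lam x z * airyR lam a z y :=
    continuous_integral_airyDomain a ((ck1.comp continuous_snd).mul cR)
  have c2 : Continuous fun z => ∫ y in airyDomain a, airyR lam a z y * airyKernel lam y x := by
    refine continuous_integral_airyDomain a (hR.mul ?_)
    exact hk.comp (by fun_prop : Continuous fun p : ℝ × ℝ => (p.2, x))
  have i1 : IntegrableOn (fun y => airyKernel lam x y * airyKernelDeriv lam x y) (airyDomain a) :=
    integrableOn_airyDomain a (by fun_prop)
  have i2 : IntegrableOn (fun y => airyKernel lam x y *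
      ∫ z in airyDomain a, airyKernelDeriv lam x z * airyR lam a z y) (airyDomain a) :=
    integrableOn_airyDomain a (by fun_prop)
  have i3 : IntegrableOn (fun z => airyKernelDeriv lam x z *
      ∫ y in airyDomain a, airyR lam a z y * airyKernel lam y x) (airyDomain a) :=
    integrableOn_airyDomain a (by fun_prop)
  simp_rw [airyRDeriv, mul_add]
  rw [integral_add i1 i2]
  have hswap : ∫ y in airyDomain a, airyKernel lam x y *
      ∫ z in airyDomain a, airyKernelDeriv lam x z * airyR lam a z y
      = ∫ z in airyDomain a, airyKernelDeriv lam x z *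
        ∫ y in airyDomain a, airyR lam a z y * airyKernel lam y x := by
    simp_rw [← integral_const_mul]
    rw [integral_airyDomain_swap a (f := fun y z =>
      airyKernel lam x y * (airyKernelDeriv lam x z * airyR lam a z y))
      ((ck.comp continuous_fst).mul ((ck1.comp continuous_snd).mul cR))]
    refine integral_congr_ae (Eventually.of_forall fun z => ?_)
    refine integral_congr_ae (Eventually.of_forall fun y => ?_)
    beta_reduce
    rw [airyKernel_symm lam x y]
    ring
  rw [hswap, ← integral_add i1 i3]
  refine integral_congr_ae (Eventually.of_forall fun z => ?_)
  beta_reduce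
  rw [airyR_symm hD x z, airyR_eq' hD z x, airyKernel_symm lam z x]
  ring

/-- The boundary terms of the diagonal of the resolvent kernel. Integrating the derivative of
`R(x, x) - K(x, x)` over `J` produces the double integral of `R(x, y) (∂ₓ + ∂ᵧ) K(x, y)`. -/
theorem sum_endpointSign_mul_airyR (ha : StrictMono a) (hD : airyDet lam a ≠ 0) :
    ∑ j, endpointSign j * airyR lam a (a j) (a j) = -airyu lam a := by
  have hk := continuous_airyKernel lam
  have hk1 := continuous_airyKernelDeriv lam
  have hR := continuous_airyR hD
  have hR1 := continuous_airyRDeriv hD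
  have hA := continuous_airyA lam
  have hA' := continuous_deriv_airyA lam
  -- the diagonal of `K`
  have hdiagK : ∫ x in airyDomain a, -(airyA lam x * airyA lam x)
      = ∑ k, endpointSign k * airyKernel lam (a k) (a k) := by
    refine integral_airyDomain_deriv ha (f := fun x => airyKernel lam x x) (fun x => ?_)
      (by fun_prop)
    simp_rw [airyKernel_diag]
    have h1 := ((hasDerivAt_deriv_airyA lam x).pow 2).sub
      ((hasDerivAt_id x).ofReal_comp.mul ((hasDerivAt_airyA lam x).pow 2))
    refine h1.congr_deriv ?_
    simp
    ring
  -- the diagonal of `R - K`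
  have hdiag : ∫ x in airyDomain a,
      2 * ∫ y in airyDomain a, airyKernelDeriv lam x y * airyR lam a x y
      = ∑ k, endpointSign k * (airyR lam a (a k) (a k) - airyKernel lam (a k) (a k)) := by
    refine integral_airyDomain_deriv ha
      (f := fun x => airyR lam a x x - airyKernel lam x x) (fun x => ?_)
      (continuous_const.mul (continuous_integral_airyDomain a (hk1.mul hR)))
    have h1 := hasDerivAt_integral_airyDomain a
      (f := fun x y => airyKernel lam x y * airyR lam a x y)
      (f' := fun x y => airyKernelDeriv lam x y * airyR lam a x y
        + airyKernel lam x y * airyRDeriv lam a x y) (hk.mul hR)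
      ((hk1.mul hR).add (hk.mul hR1))
      (fun x y => (hasDerivAt_airyKernel lam x y).mul (hasDerivAt_airyR hD x y)) x
    have hint : ∀ {k l : ℝ → ℝ → ℂ}, (Continuous fun p : ℝ × ℝ => k p.1 p.2) →
        (Continuous fun p : ℝ × ℝ => l p.1 p.2) →
        IntegrableOn (fun y => k x y * l x y) (airyDomain a) := fun hk hl =>
      integrableOn_airyDomain a
        ((hk.mul hl).comp (by fun_prop : Continuous fun y : ℝ => (x, y)))
    rw [integral_add (hint hk1 hR) (hint hk hR1), integral_airyKernel_mul_airyRDeriv hD,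
      ← two_mul] at h1
    refine h1.congr_of_eventuallyEq (Eventually.of_forall fun x => ?_)
    beta_reduce
    rw [airyR_eq hD x x, add_sub_cancel_left]
    refine integral_congr_ae (Eventually.of_forall fun y => ?_)
    beta_reduce
    rw [airyR_symm hD]
  have hsw : ∫ x in airyDomain a, ∫ y in airyDomain a, airyKernelDeriv lam x y * airyR lam a x y
      = ∫ x in airyDomain a, ∫ y in airyDomain a, airyKernelDeriv lam y x * airyR lam a x y := by
    rw [integral_airyDomain_swap a (f := fun x y => airyKernelDeriv lam x y * airyR lam a x y)
      (hk1.mul hR)]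
    simp_rw [fun x y => airyR_symm hD x y]
  have c1 : Continuous fun x => ∫ y in airyDomain a, airyKernelDeriv lam x y * airyR lam a x y :=
    continuous_integral_airyDomain a (hk1.mul hR)
  have hk1' : Continuous fun p : ℝ × ℝ => airyKernelDeriv lam p.2 p.1 :=
    hk1.comp (by fun_prop : Continuous fun p : ℝ × ℝ => (p.2, p.1))
  have c2 : Continuous fun x => ∫ y in airyDomain a, airyKernelDeriv lam y x * airyR lam a x y :=
    continuous_integral_airyDomain a (hk1'.mul hR)
  have hdouble : ∫ x in airyDomain a,
      2 * ∫ y in airyDomain a, airyKernelDeriv lam x y * airyR lam a x y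
      = ∫ x in airyDomain a, -(airyA lam x * airyQ lam a x - airyA lam x * airyA lam x) := by
    rw [integral_const_mul, two_mul]
    conv_lhs => arg 2; rw [hsw]
    rw [← integral_add (integrableOn_airyDomain a c1) (integrableOn_airyDomain a c2)]
    refine integral_congr_ae (Eventually.of_forall fun x => ?_)
    beta_reduce
    have i1 : IntegrableOn (fun y => airyKernelDeriv lam x y * airyR lam a x y) (airyDomain a) :=
      integrableOn_airyDomain a ((hk1.mul hR).comp
        (by fun_prop : Continuous fun y : ℝ => (x, y)))
    have i2 : IntegrableOn (fun y => airyKernelDeriv lam y x * airyR lam a x y) (airyDomain a) :=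
      integrableOn_airyDomain a ((hk1'.mul hR).comp
        (by fun_prop : Continuous fun y : ℝ => (x, y)))
    rw [← integral_add i1 i2, ← mul_sub, ← integral_airyA_mul_airyR hD, ← integral_const_mul,
      ← integral_neg]
    refine integral_congr_ae (Eventually.of_forall fun y => ?_)
    beta_reduce
    rw [airyR_symm hD y x]
    linear_combination airyR lam a x y * airyKernelDeriv_add lam x y
  have iQ : IntegrableOn (fun x => airyA lam x * airyQ lam a x) (airyDomain a) :=
    integrableOn_airyDomain a (by fun_prop)
  have iA : IntegrableOn (fun x => airyA lam x * airyA lam x) (airyDomain a) :=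
    integrableOn_airyDomain a (by fun_prop)
  rw [hdouble, integral_neg, integral_sub iQ iA] at hdiag
  rw [integral_neg] at hdiagK
  simp_rw [mul_sub, Finset.sum_sub_distrib] at hdiag
  have hu : ∫ x in airyDomain a, airyA lam x * airyQ lam a x = airyu lam a := rfl
  rw [hu] at hdiag
  linear_combination -hdiag - hdiagK

end TraceIdentity

/-! ### The differential of the determinant -/

section Determinant

variable {lam : ℂ} {m : ℕ} {a : Fin (2 * m) → ℝ}

theorem eventually_strictMono {n : ℕ} {a : Fin n → ℝ} (ha : StrictMono a) :
    ∀ᶠ b in 𝓝 a, StrictMono b := by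
  have h : ∀ᶠ b : Fin n → ℝ in 𝓝 a, ∀ i j, i < j → b i < b j := by
    refine eventually_all.2 fun i => eventually_all.2 fun j => ?_
    by_cases hij : i < j
    · have h1 : Continuous fun b : Fin n → ℝ => b i := continuous_apply i
      have h2 : Continuous fun b : Fin n → ℝ => b j := continuous_apply j
      exact ((h1.tendsto a).eventually_lt (h2.tendsto a) (ha hij)).mono fun b hb _ => hb
    · exact Eventually.of_forall fun b h => absurd h hij
  exact h.mono fun b hb i j hij => hb i j hij

/-- The symmetric difference of two domains is covered by the intervals between corresponding
endpoints. -/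
theorem indicatorDist_airyDomain_le {ρ : Measure ℝ} [IsFiniteMeasure ρ] (hρ : ρ ≤ volume)
    (a b : Fin (2 * m) → ℝ) :
    indicatorDist ρ (airyDomain b) (airyDomain a) ≤ ∑ k, |b k - a k| := by
  have hpt : ∀ s, |(airyDomain b).indicator (1 : ℝ → ℝ) s - (airyDomain a).indicator 1 s|
      ≤ ∑ k, (Set.uIcc (a k) (b k)).indicator (1 : ℝ → ℝ) s := fun s => by
    have h0 : ∀ k, 0 ≤ (Set.uIcc (a k) (b k)).indicator (1 : ℝ → ℝ) s := fun k =>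
      (indicator_one_mem_Icc _ s).1
    have hmem : ∀ k, s ∈ Set.uIcc (a k) (b k) →
        1 ≤ ∑ k, (Set.uIcc (a k) (b k)).indicator (1 : ℝ → ℝ) s := fun k hk => by
      refine le_trans ?_ (Finset.single_le_sum (fun k _ => h0 k) (Finset.mem_univ k))
      simp [hk]
    have key : ∀ a b : Fin (2 * m) → ℝ, s ∈ airyDomain b → s ∉ airyDomain a →
        ∃ k, s ∈ Set.uIcc (a k) (b k) := fun a b h1 h2 => by
      simp only [airyDomain, Set.mem_iUnion, not_exists] at h1 h2
      obtain ⟨j, hj⟩ := h1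
      rcases le_or_gt s (a ⟨2 * j.val, by omega⟩) with h | h
      · exact ⟨_, Set.mem_uIcc.2 (Or.inr ⟨hj.1.le, h⟩)⟩
      · refine ⟨⟨2 * j.val + 1, by omega⟩, Set.mem_uIcc.2 (Or.inl ⟨?_, hj.2.le⟩)⟩
        by_contra h3
        exact h2 j ⟨h, not_le.1 h3⟩
    by_cases h1 : s ∈ airyDomain b <;> by_cases h2 : s ∈ airyDomain a
    · simpa [h1, h2] using Finset.sum_nonneg fun k _ => h0 k
    · obtain ⟨k, hk⟩ := key a b h1 h2
      simpa [h1, h2] using hmem k hk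
    · obtain ⟨k, hk⟩ := key b a h2 h1
      rw [Set.uIcc_comm] at hk
      simpa [h1, h2] using hmem k hk
    · simpa [h1, h2] using Finset.sum_nonneg fun k _ => h0 k
  have hi : ∀ k, Integrable ((Set.uIcc (a k) (b k)).indicator (1 : ℝ → ℝ)) ρ := fun k =>
    (integrable_const (1 : ℝ)).indicator measurableSet_uIcc
  refine (integral_mono (integrable_abs_indicator_sub (measurableSet_airyDomain b)
    (measurableSet_airyDomain a)) (integrable_finsetSum _ fun k _ => hi k) hpt).trans ?_
  rw [integral_finsetSum _ fun k _ => hi k]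
  refine Finset.sum_le_sum fun k _ => ?_
  rw [integral_indicator_one measurableSet_uIcc, measureReal_def]
  have h := hρ (Set.uIcc (a k) (b k))
  rw [Real.volume_interval] at h
  exact ENNReal.toReal_le_of_le_ofReal (abs_nonneg _) h

/-- The partial derivative of `D` in `aⱼ` is, up to sign, the diagonal value `D R(aⱼ, aⱼ)` of the
first minor. -/
theorem hasFDerivAt_airyDet (ha : StrictMono a) (hD : airyDet lam a ≠ 0) :
    HasFDerivAt (airyDet lam) (-∑ j, (ContinuousLinearMap.proj j :
      (Fin (2 * m) → ℝ) →L[ℝ] ℝ).smulRight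
        (endpointSign j * (airyDet lam a * airyR lam a (a j) (a j)))) a := by
  -- All domains with endpoints at distance less than `1` from those of `a` lie in `[-L, L]`.
  set L := (∑ k, |a k|) + 1
  have hL : ∀ k, |a k| + 1 ≤ L := fun k => by
    have := Finset.single_le_sum (f := fun k => |a k|) (fun _ _ => abs_nonneg _)
      (Finset.mem_univ k)
    simp only [L]
    linarith
  set ρ := volume.restrict (Set.Icc (-L) L) with hρdef
  have hρ : ∀ᵐ y ∂ρ, y ∈ Set.Icc (-L) L := ae_restrict_mem measurableSet_Icc
  have : IsFiniteMeasure ρ := isFiniteMeasure_restrict.2 isCompact_Icc.measure_lt_top.ne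
  obtain ⟨B, hB⟩ := exists_norm_fredholmDet_sub_le (continuous_airyKernel lam) isCompact_Icc hρ
  have hsub : ∀ b : Fin (2 * m) → ℝ, dist b a < 1 → airyDomain b ⊆ Set.Icc (-L) L := fun b hb =>
    airyDomain_subset_Icc fun k => by
      have h1 : |b k - a k| ≤ 1 := by
        rw [← Real.dist_eq]
        exact (dist_le_pi_dist b a k).trans hb.le
      have h2 := abs_sub_abs_le_abs_sub (b k) (a k)
      linarith [hL k]
  have hrestr : ∀ b : Fin (2 * m) → ℝ, dist b a < 1 →
      ρ.restrict (airyDomain b) = volume.restrict (airyDomain b) := fun b hb => by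
    rw [hρdef, Measure.restrict_restrict (measurableSet_airyDomain b),
      Set.inter_eq_self_of_subset_left (hsub b hb)]
  set N : ℝ → ℂ := fun s => airyDet lam a * airyR lam a s s with hN
  have hNc : Continuous N := continuous_const.mul
    ((continuous_airyR hD).comp (by fun_prop : Continuous fun s : ℝ => (s, s)))
  have hNeq : ∀ s, fredholmMinor (airyKernel lam) (ρ.restrict (airyDomain a)) s s = N s :=
    fun s => by
      rw [hrestr a (by simp), hN]
      beta_reduce
      rw [airyR_eq_airyResolvent hD, airyResolvent]
      field_simp
  -- `Ψ b` is the integral of `N` over the domain of `b`, in a form that is differentiable whether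
  -- or not `b` is increasing.
  set Ψ : (Fin (2 * m) → ℝ) → ℂ := fun b => ∑ k, endpointSign k * ∫ s in (0 : ℝ)..(b k), N s
  have hΨ : HasFDerivAt Ψ (∑ j, (ContinuousLinearMap.proj j :
      (Fin (2 * m) → ℝ) →L[ℝ] ℝ).smulRight (endpointSign j * N (a j))) a := by
    refine HasFDerivAt.fun_sum (u := Finset.univ)
      (A := fun j (b : Fin (2 * m) → ℝ) => endpointSign j * ∫ s in (0 : ℝ)..(b j), N s)
      fun j _ => ?_
    have h1 : HasDerivAt (fun t : ℝ => endpointSign j * ∫ s in (0 : ℝ)..t, N s)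
        (endpointSign j * N (a j)) (a j) :=
      (intervalIntegral.integral_hasDerivAt_right (hNc.intervalIntegrable _ _)
        hNc.stronglyMeasurable.stronglyMeasurableAtFilter hNc.continuousAt).const_mul _
    have h2 := h1.hasFDerivAt.comp a
      (ContinuousLinearMap.proj j : (Fin (2 * m) → ℝ) →L[ℝ] ℝ).hasFDerivAt
    refine h2.congr_fderiv ?_
    ext b
    simp
  -- the remainder is of second order
  have hrem : HasFDerivAt (fun b => airyDet lam b + Ψ b)
      (0 : (Fin (2 * m) → ℝ) →L[ℝ] ℂ) a := by
    rw [hasFDerivAt_iff_isLittleO]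
    have hO : (fun b => airyDet lam b + Ψ b - (airyDet lam a + Ψ a)) =O[𝓝 a]
        fun b => ‖b - a‖ ^ 2 := by
      refine Asymptotics.IsBigO.of_bound (|B| * (2 * m : ℕ) ^ 2) ?_
      filter_upwards [eventually_strictMono ha, Metric.ball_mem_nhds a one_pos] with b hb hba
      have hba' : dist b a < 1 := hba
      have h1 := hB _ _ (measurableSet_airyDomain b) (measurableSet_airyDomain a)
      have hcalc : ∫ s, (((airyDomain b).indicator (1 : ℝ → ℝ) s
          - (airyDomain a).indicator 1 s : ℝ) : ℂ)
          * fredholmMinor (airyKernel lam) (ρ.restrict (airyDomain a)) s s ∂ρ = Ψ b - Ψ a := by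
        have hind : ∀ b : Fin (2 * m) → ℝ, StrictMono b → dist b a < 1 →
            Integrable (fun s => (airyDomain b).indicator N s) ρ ∧
            ∫ s, (airyDomain b).indicator N s ∂ρ = Ψ b := fun b hb hba => by
          refine ⟨(integrable_of_continuous_of_carried isCompact_Icc hρ hNc).indicator
            (measurableSet_airyDomain b), ?_⟩
          rw [integral_indicator (measurableSet_airyDomain b), hrestr b hba,
            integral_airyDomain_eq_sum hb hNc]
        have ia := hind a ha (by simp)
        have ib := hind b hb hba'
        rw [← ia.2, ← ib.2, ← integral_sub ib.1 ia.1]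
        refine integral_congr_ae (Eventually.of_forall fun s => ?_)
        beta_reduce
        rw [hNeq]
        by_cases h1 : s ∈ airyDomain b <;> by_cases h2 : s ∈ airyDomain a <;> simp [h1, h2]
      rw [hcalc, hrestr b hba', hrestr a (by simp), ← airyDet_eq_fredholmDet,
        ← airyDet_eq_fredholmDet] at h1
      have hd : indicatorDist ρ (airyDomain b) (airyDomain a) ≤ (2 * m : ℕ) * ‖b - a‖ := by
        refine (indicatorDist_airyDomain_le Measure.restrict_le_self a b).trans ?_
        calc ∑ k, |b k - a k| ≤ ∑ _k : Fin (2 * m), ‖b - a‖ :=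
              Finset.sum_le_sum fun k _ => norm_le_pi_norm (b - a) k
          _ = _ := by simp
      have hd0 := indicatorDist_nonneg ρ (airyDomain b) (airyDomain a)
      rw [show airyDet lam b + Ψ b - (airyDet lam a + Ψ a)
        = airyDet lam b - airyDet lam a + (Ψ b - Ψ a) by ring, Real.norm_of_nonneg (sq_nonneg _)]
      calc _ ≤ B * indicatorDist ρ (airyDomain b) (airyDomain a) ^ 2 := h1
        _ ≤ |B| * ((2 * m : ℕ) * ‖b - a‖) ^ 2 :=
          mul_le_mul (le_abs_self B) (pow_le_pow_left₀ hd0 hd 2) (sq_nonneg _) (abs_nonneg _)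
        _ = _ := by ring
    have ho : (fun b : Fin (2 * m) → ℝ => ‖b - a‖ ^ 2) =o[𝓝 a] fun b => b - a := by
      have h1 : (fun b : Fin (2 * m) → ℝ => b - a) =o[𝓝 a] fun _ => (1 : ℝ) := by
        rw [Asymptotics.isLittleO_one_iff]
        have : Continuous fun b : Fin (2 * m) → ℝ => b - a := by fun_prop
        simpa using this.tendsto a
      have h2 := h1.norm_left.mul_isBigO (Asymptotics.isBigO_refl (fun b => ‖b - a‖) (𝓝 a))
      simpa [sq] using h2.norm_right
    simpa using hO.trans_isLittleO ho
  have h := hrem.sub hΨ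
  rw [zero_sub] at h
  refine h.congr_of_eventuallyEq (Eventually.of_forall fun b => ?_)
  simp

theorem hasFDerivAt_log_airyDet (ha : StrictMono a) (hD : airyDet lam a ≠ 0) :
    HasFDerivAt (fun b : Fin (2 * m) → ℝ => Complex.log (airyDet lam b / airyDet lam a))
      (-∑ j, (ContinuousLinearMap.proj j : (Fin (2 * m) → ℝ) →L[ℝ] ℝ).smulRight
        (endpointSign j * airyR lam a (a j) (a j))) a := by
  have h1 := (hasFDerivAt_airyDet ha hD).const_mul (airyDet lam a)⁻¹
  -- The quotient is `1` at `a`, where the principal branch of the logarithm is differentiable.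
  have h3 : (airyDet lam a)⁻¹ * airyDet lam a = 1 := inv_mul_cancel₀ hD
  have h4 := (Complex.hasStrictFDerivAt_log_real (x := (airyDet lam a)⁻¹ * airyDet lam a)
    (by rw [h3]; exact Complex.one_mem_slitPlane)).hasFDerivAt.comp a h1
  have h5 : (fun b : Fin (2 * m) → ℝ => Complex.log (airyDet lam b / airyDet lam a))
      = Complex.log ∘ fun b => (airyDet lam a)⁻¹ * airyDet lam b :=
    funext fun b => by rw [Function.comp_apply, div_eq_inv_mul]
  rw [h5]
  refine h4.congr_fderiv ?_
  ext b
  simp only [h3, inv_one, one_smul, ContinuousLinearMap.coe_comp, Function.comp_apply,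
    one_apply_eq_self, smul_apply, neg_apply,
    sum_apply, ContinuousLinearMap.smulRight_apply, smul_neg, Finset.smul_sum]
  refine congrArg Neg.neg (Finset.sum_congr rfl fun j _ => ?_)
  rw [smul_comm, smul_eq_mul]
  congr 1
  linear_combination (endpointSign j * airyR lam a (a j) (a j)) * h3

end Determinant

/-! ### Variation of one endpoint -/

/-- The derivative at `c` of an integral over `[c, t]` whose integrand also depends on `t`. -/
theorem hasDerivAt_integral_of_continuousAt {H : ℝ → ℝ → ℂ} {c : ℝ}
    (hH : ContinuousAt (fun p : ℝ × ℝ => H p.1 p.2) (c, c)) (hc : ∀ t, Continuous (H t)) :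
    HasDerivAt (fun t => ∫ y in c..t, H t y) (H c c) c := by
  rw [hasDerivAt_iff_isLittleO, Asymptotics.isLittleO_iff]
  intro ε hε
  obtain ⟨δ, hδ, h⟩ := Metric.continuousAt_iff.1 hH ε hε
  filter_upwards [Metric.ball_mem_nhds c hδ] with t ht
  have h1 : ∫ y in c..t, (H t y - H c c) = (∫ y in c..t, H t y) - (t - c) • H c c := by
    rw [intervalIntegral.integral_sub ((hc t).intervalIntegrable _ _)
      intervalIntegrable_const, intervalIntegral.integral_const]
  rw [intervalIntegral.integral_same, sub_zero, ← h1]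
  refine intervalIntegral.norm_integral_le_of_norm_le_const fun y hy => ?_
  rw [← dist_eq_norm]
  refine (h (x := (t, y)) ?_).le
  have hy' : dist y c ≤ dist t c := by
    rw [Real.dist_eq, Real.dist_eq]
    exact Set.abs_sub_left_of_mem_uIcc (Set.uIoc_subset_uIcc hy)
  rw [Prod.dist_eq]
  exact max_lt ht (hy'.trans_lt ht)

theorem integral_airyDomain_intervalIntegral_swap {m : ℕ} (a : Fin (2 * m) → ℝ) {f : ℝ → ℝ → ℂ}
    (hf : Continuous fun p : ℝ × ℝ => f p.1 p.2) (c t : ℝ) :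
    ∫ x in airyDomain a, ∫ y in c..t, f x y = ∫ y in c..t, ∫ x in airyDomain a, f x y := by
  obtain ⟨C, hC, hμ⟩ := exists_compact_carrying_airyDomain a
  have hν : ∀ᵐ y ∂(volume.restrict (Set.uIoc c t)), y ∈ Set.uIcc c t :=
    (ae_restrict_mem measurableSet_uIoc).mono fun y hy => Set.uIoc_subset_uIcc hy
  have : IsFiniteMeasure (volume.restrict (Set.uIoc c t)) := isFiniteMeasure_restrict.2
    ((measure_mono Set.uIoc_subset_uIcc).trans_lt isCompact_uIcc.measure_lt_top).ne
  simp_rw [intervalIntegral.intervalIntegral_eq_integral_uIoc]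
  rw [integral_smul, integral_integral_swap_of_carried hC hμ isCompact_uIcc hν hf]

section Variation

variable {lam : ℂ} {m : ℕ} {a : Fin (2 * m) → ℝ}

/-- Moving one endpoint adds a signed integral between its old and its new position. -/
theorem integral_airyDomain_update (ha : StrictMono a) {k : Fin (2 * m)} {t : ℝ}
    (hb : StrictMono (Function.update a k t)) {h : ℝ → ℂ} (hh : Continuous h) :
    ∫ x in airyDomain (Function.update a k t), h x
      = (∫ x in airyDomain a, h x) + endpointSign k * ∫ x in (a k)..t, h x := by
  rw [integral_airyDomain_eq_sum ha hh, integral_airyDomain_eq_sum hb hh,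
    ← Finset.add_sum_erase _ _ (Finset.mem_univ k),
    ← Finset.add_sum_erase _ (fun i => endpointSign i * ∫ x in (0 : ℝ)..(a i), h x)
      (Finset.mem_univ k), Function.update_self]
  have h1 : ∑ i ∈ Finset.univ.erase k,
      endpointSign i * ∫ x in (0 : ℝ)..(Function.update a k t i), h x
      = ∑ i ∈ Finset.univ.erase k, endpointSign i * ∫ x in (0 : ℝ)..(a i), h x :=
    Finset.sum_congr rfl fun i hi => by
      rw [Function.update_of_ne (Finset.ne_of_mem_erase hi)]
  rw [h1, ← intervalIntegral.integral_add_adjacent_intervals (hh.intervalIntegrable 0 (a k))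
    (hh.intervalIntegrable (a k) t)]
  ring

/-- The resolvent identity for two domains that differ in one endpoint. -/
theorem airyInv_update (ha : StrictMono a) (hD : airyDet lam a ≠ 0) {k : Fin (2 * m)} {t : ℝ}
    (hb : StrictMono (Function.update a k t)) (hDb : airyDet lam (Function.update a k t) ≠ 0)
    (f : C(ℝ, ℂ)) (x : ℝ) :
    airyInv lam (Function.update a k t) f x = airyInv lam a f x + endpointSign k *
      ∫ y in (a k)..t, airyR lam a x y * airyInv lam (Function.update a k t) f y := by
  set F := airyInv lam (Function.update a k t) f with hF
  have hFc := F.continuous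
  have hk := continuous_airyKernel lam
  have hR := continuous_airyR hD
  have cK : ∀ x, Continuous fun y => airyKernel lam x y := fun x =>
    hk.comp (by fun_prop : Continuous fun y : ℝ => (x, y))
  have cKF : ∀ x, Continuous fun y => airyKernel lam x y * F y := fun x => (cK x).mul hFc
  have cR : ∀ x, Continuous fun y => airyR lam a x y := fun x =>
    hR.comp (by fun_prop : Continuous fun y : ℝ => (x, y))
  set g : C(ℝ, ℂ) := ⟨fun x => ∫ y in (a k)..t, airyKernel lam x y * F y,
    intervalIntegral.continuous_parametric_intervalIntegral_of_continuous'
      (f := fun x y => airyKernel lam x y * F y) (hk.mul (hFc.comp continuous_snd)) _ _⟩ with hg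
  -- Over the original domain, `F` solves the integral equation with right-hand side `f ± g`.
  have h1 := airyInv_eq_of_sub hD (f := f + endpointSign k • g) (g := F) (fun x => by
    have h2 := airyInv_sub hDb f x
    rw [← hF, integral_airyDomain_update ha hb (cKF x)] at h2
    simp only [ContinuousMap.add_apply, ContinuousMap.smul_apply, smul_eq_mul]
    have hgx : g x = ∫ y in (a k)..t, airyKernel lam x y * F y := rfl
    rw [← h2, hgx]
    ring)
  have h3 : airyInv lam a g x = ∫ y in (a k)..t, airyR lam a x y * F y := by
    have e1 : ∀ z, g z = ∫ y in (a k)..t, airyKernel lam z y * F y := fun z => rfl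
    have e2 : ∫ z in airyDomain a, airyR lam a x z * g z
        = ∫ y in (a k)..t, (∫ z in airyDomain a, airyR lam a x z * airyKernel lam z y) * F y := by
      simp_rw [e1, ← intervalIntegral.integral_const_mul]
      rw [integral_airyDomain_intervalIntegral_swap a
        (f := fun z y => airyR lam a x z * (airyKernel lam z y * F y))
        (((cR x).comp continuous_fst).mul (hk.mul (hFc.comp continuous_snd)))]
      simp_rw [← integral_mul_const, mul_assoc]
    have c1 : Continuous fun y => ∫ z in airyDomain a, airyR lam a x z * airyKernel lam z y :=
      continuous_integral_airyDomain a (((cR x).comp continuous_snd).mul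
        (hk.comp (by fun_prop : Continuous fun p : ℝ × ℝ => (p.2, p.1))))
    have c2 : Continuous fun y =>
        (∫ z in airyDomain a, airyR lam a x z * airyKernel lam z y) * F y := c1.mul hFc
    rw [airyInv_apply hD, e1, e2, ← intervalIntegral.integral_add
      ((cKF x).intervalIntegrable _ _) (c2.intervalIntegrable _ _)]
    refine intervalIntegral.integral_congr fun y _ => ?_
    rw [airyR_eq' hD x y]
    ring
  rw [← h3, ← h1, map_add, map_smul]
  rfl

theorem tendsto_update_self (a : Fin (2 * m) → ℝ) (k : Fin (2 * m)) :
    Tendsto (fun t => Function.update a k t) (𝓝 (a k)) (𝓝 a) := by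
  have h : Continuous fun t => Function.update a k t := continuous_const.update k continuous_id
  simpa using h.tendsto (a k)

/-- The hypotheses persist when one endpoint moves a little. -/
theorem eventually_update (ha : StrictMono a) (hD : airyDet lam a ≠ 0) (k : Fin (2 * m)) :
    ∀ᶠ t in 𝓝 (a k), StrictMono (Function.update a k t)
      ∧ airyDet lam (Function.update a k t) ≠ 0 :=
  (tendsto_update_self a k).eventually ((eventually_strictMono ha).and
    ((hasFDerivAt_airyDet ha hD).continuousAt.eventually_ne hD))

/-- `(I - K)⁻¹ f` depends continuously on an endpoint, locally uniformly. The supremum of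
`(I - K)⁻¹ f` over a compact interval is bounded by absorption in the resolvent identity. -/
theorem continuousAt_airyInv_update (ha : StrictMono a) (hD : airyDet lam a ≠ 0)
    (k : Fin (2 * m)) (f : C(ℝ, ℂ)) :
    ContinuousAt (fun p : ℝ × ℝ => airyInv lam (Function.update a k p.1) f p.2) (a k, a k) := by
  set I := Metric.closedBall (a k) 1
  have hI : IsCompact I := isCompact_closedBall _ _
  have hIne : I.Nonempty := ⟨a k, Metric.mem_closedBall_self zero_le_one⟩
  obtain ⟨M, hM0, hM⟩ := exists_bound_on_prod (continuous_airyR hD) hI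
  obtain ⟨S, hS⟩ := hI.exists_bound_of_continuousOn (airyInv lam a f).continuous.continuousOn
  have hsign : ‖(endpointSign k : ℂ)‖ = 1 := by simp [endpointSign]
  have hbound : ∀ᶠ t in 𝓝 (a k), ∀ y ∈ I,
      ‖airyInv lam (Function.update a k t) f y - airyInv lam a f y‖
        ≤ M * (2 * S) * |t - a k| := by
    have hsmall : ∀ᶠ t in 𝓝 (a k), M * |t - a k| < 1 / 2 := by
      have : Continuous fun t => M * |t - a k| := by fun_prop
      exact (this.tendsto' (a k) 0 (by simp)).eventually_lt_const (by norm_num)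
    filter_upwards [eventually_update ha hD k, hsmall, Metric.ball_mem_nhds (a k) one_pos]
      with t ht hMt htI
    set F := airyInv lam (Function.update a k t) f with hF
    have hdiff : ∀ T, (∀ y ∈ I, ‖F y‖ ≤ T) → ∀ y ∈ I,
        ‖F y - airyInv lam a f y‖ ≤ M * T * |t - a k| := fun T hT y hy => by
      rw [hF, airyInv_update ha hD ht.1 ht.2 f y, add_sub_cancel_left, norm_mul, hsign, one_mul]
      refine intervalIntegral.norm_integral_le_of_norm_le_const fun z hz => ?_
      have hz' : z ∈ I := by
        rw [Metric.mem_closedBall, Real.dist_eq]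
        refine (Set.abs_sub_left_of_mem_uIcc (Set.uIoc_subset_uIcc hz)).trans ?_
        rw [← Real.dist_eq]
        exact (Metric.mem_ball.1 htI).le
      rw [norm_mul]
      exact mul_le_mul (hM y hy z hz') (hT z hz') (norm_nonneg _) hM0
    -- At a maximum of `|F|` the estimate reads `|F| ≤ S + |F| / 2`.
    obtain ⟨y₀, hy₀, hmax⟩ := hI.exists_isMaxOn hIne (F.continuous.norm.continuousOn)
    have h1 := hdiff ‖F y₀‖ (fun y hy => hmax hy) y₀ hy₀
    have h2 : ‖F y₀‖ ≤ 2 * S := by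
      have h3 := norm_sub_norm_le (F y₀) (airyInv lam a f y₀)
      have h4 := hS y₀ hy₀
      have h5 : M * ‖F y₀‖ * |t - a k| ≤ 1 / 2 * ‖F y₀‖ := by
        rw [mul_right_comm]
        exact mul_le_mul_of_nonneg_right hMt.le (norm_nonneg _)
      linarith
    exact hdiff (2 * S) fun y hy => le_trans (hmax hy) h2
  have hzero : Tendsto (fun p : ℝ × ℝ => airyInv lam (Function.update a k p.1) f p.2
      - airyInv lam a f p.2) (𝓝 (a k, a k)) (𝓝 0) := by
    refine squeeze_zero_norm' (a := fun p : ℝ × ℝ => M * (2 * S) * |p.1 - a k|) ?_ ?_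
    · rw [nhds_prod_eq]
      exact (hbound.prod_mk (Metric.closedBall_mem_nhds (a k) one_pos)).mono
        fun p hp => hp.1 p.2 hp.2
    · have : Continuous fun p : ℝ × ℝ => M * (2 * S) * |p.1 - a k| := by fun_prop
      exact this.tendsto' _ _ (by simp)
  have hcont : Tendsto (fun p : ℝ × ℝ => airyInv lam a f p.2) (𝓝 (a k, a k))
      (𝓝 (airyInv lam a f (a k))) :=
    ((airyInv lam a f).continuous.comp continuous_snd).tendsto (a k, a k)
  have := hzero.add hcont
  simp only [sub_add_cancel, zero_add] at this
  rw [ContinuousAt, Function.update_eq_self]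
  exact this

/-- The derivative of `(I - K)⁻¹ f`, at a point that may move with the endpoint. -/
theorem hasDerivAt_airyInv_update (ha : StrictMono a) (hD : airyDet lam a ≠ 0)
    (k : Fin (2 * m)) (f : C(ℝ, ℂ)) {ξ : ℝ → ℝ} (hξ : Continuous ξ) {F' : ℂ}
    (hF' : HasDerivAt (fun t => airyInv lam a f (ξ t)) F' (a k)) :
    HasDerivAt (fun t => airyInv lam (Function.update a k t) f (ξ t))
      (F' + endpointSign k * (airyR lam a (ξ (a k)) (a k) * airyInv lam a f (a k))) (a k) := by
  have hR := continuous_airyR hD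
  have h := hasDerivAt_integral_of_continuousAt (c := a k)
    (H := fun t y => airyR lam a (ξ t) y * airyInv lam (Function.update a k t) f y)
    ((hR.comp (by fun_prop : Continuous fun p : ℝ × ℝ => (ξ p.1, p.2))).continuousAt.mul
      (continuousAt_airyInv_update ha hD k f))
    (fun t => (hR.comp (by fun_prop : Continuous fun y : ℝ => (ξ t, y))).mul
      (airyInv lam (Function.update a k t) f).continuous)
  simp only [Function.update_eq_self] at h
  refine (hF'.add (h.const_mul _)).congr_of_eventuallyEq ?_
  filter_upwards [eventually_update ha hD k] with t ht
  exact airyInv_update ha hD ht.1 ht.2 f (ξ t)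

/-- The derivative of the pairing of `A` with `(I - K)⁻¹ f`. -/
theorem hasDerivAt_integral_airyA_mul_airyInv (ha : StrictMono a) (hD : airyDet lam a ≠ 0)
    (k : Fin (2 * m)) (f : C(ℝ, ℂ)) :
    HasDerivAt (fun t => ∫ x in airyDomain (Function.update a k t),
        airyA lam x * airyInv lam (Function.update a k t) f x)
      (endpointSign k * (airyQ lam a (a k) * airyInv lam a f (a k))) (a k) := by
  have hR := continuous_airyR hD
  have hA := continuous_airyA lam
  have hQ := (airyQ lam a).continuous
  have h := hasDerivAt_integral_of_continuousAt (c := a k)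
    (H := fun t y => airyQ lam a y * airyInv lam (Function.update a k t) f y)
    ((hQ.comp continuous_snd).continuousAt.mul (continuousAt_airyInv_update ha hD k f))
    (fun t => hQ.mul (airyInv lam (Function.update a k t) f).continuous)
  simp only [Function.update_eq_self] at h
  refine ((h.const_mul (endpointSign k)).const_add
    (∫ x in airyDomain a, airyA lam x * airyInv lam a f x)).congr_of_eventuallyEq ?_
  filter_upwards [eventually_update ha hD k] with t ht
  set F := airyInv lam (Function.update a k t) f with hF
  have hFc := F.continuous
  have hRF : Continuous fun p : ℝ × ℝ => airyR lam a p.1 p.2 * F p.2 :=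
    hR.mul (hFc.comp continuous_snd)
  have c1 : Continuous fun x => ∫ y in (a k)..t, airyR lam a x y * F y :=
    intervalIntegral.continuous_parametric_intervalIntegral_of_continuous'
      (f := fun x y => airyR lam a x y * F y) hRF _ _
  have i1 : IntegrableOn (fun x => airyA lam x * airyInv lam a f x) (airyDomain a) :=
    integrableOn_airyDomain a (hA.mul (airyInv lam a f).continuous)
  have i2 : IntegrableOn (fun x => endpointSign k * (airyA lam x *
      ∫ y in (a k)..t, airyR lam a x y * F y)) (airyDomain a) :=
    integrableOn_airyDomain a (continuous_const.mul (hA.mul c1))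
  have e1 : ∫ x in airyDomain a, airyA lam x * F x
      = (∫ x in airyDomain a, airyA lam x * airyInv lam a f x)
        + endpointSign k * ∫ x in airyDomain a, airyA lam x *
          ∫ y in (a k)..t, airyR lam a x y * F y := by
    rw [← integral_const_mul, ← integral_add i1 i2]
    refine integral_congr_ae (Eventually.of_forall fun x => ?_)
    beta_reduce
    conv_lhs => rw [hF, airyInv_update ha hD ht.1 ht.2 f x]
    ring
  have e2 : ∫ x in airyDomain a, airyA lam x * ∫ y in (a k)..t, airyR lam a x y * F y
      = ∫ y in (a k)..t, (airyQ lam a y - airyA lam y) * F y := by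
    simp_rw [← intervalIntegral.integral_const_mul]
    rw [integral_airyDomain_intervalIntegral_swap a
      (f := fun x y => airyA lam x * (airyR lam a x y * F y))
      ((hA.comp continuous_fst).mul hRF)]
    simp_rw [← integral_airyA_mul_airyR hD, ← integral_mul_const, mul_assoc]
  have cAF : Continuous fun x => airyA lam x * F x := hA.mul hFc
  have cQF : Continuous fun y => (airyQ lam a y - airyA lam y) * F y := (hQ.sub hA).mul hFc
  rw [integral_airyDomain_update ha ht.1 cAF, e1, e2, add_assoc, ← mul_add,
    ← intervalIntegral.integral_add (cQF.intervalIntegrable _ _) (cAF.intervalIntegrable _ _)]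
  congr 2
  refine intervalIntegral.integral_congr fun y _ => ?_
  ring

/-! ### The system of differential equations -/

theorem hasDerivAt_airyq_of_ne (ha : StrictMono a) (hD : airyDet lam a ≠ 0) {j k : Fin (2 * m)}
    (hjk : j ≠ k) : HasDerivAt (fun t : ℝ => airyq lam j (Function.update a k t))
      (endpointSign k * ((airyq lam j a * airyp lam k a - airyp lam j a * airyq lam k a)
        / ((a j - a k : ℝ) : ℂ)) * airyq lam k a) (a k) := by
  have h := hasDerivAt_airyInv_update ha hD k
    ⟨airyA lam, (contDiff_airyA lam (n := 0)).continuous⟩ (ξ := fun _ => a j) continuous_const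
    (hasDerivAt_const _ _)
  simp only [airyR_endpoint hD ha hjk, zero_add, ← mul_assoc] at h
  simp only [airyq, Function.update_of_ne hjk]
  exact h

theorem hasDerivAt_airyp_of_ne (ha : StrictMono a) (hD : airyDet lam a ≠ 0) {j k : Fin (2 * m)}
    (hjk : j ≠ k) : HasDerivAt (fun t : ℝ => airyp lam j (Function.update a k t))
      (endpointSign k * ((airyq lam j a * airyp lam k a - airyp lam j a * airyq lam k a)
        / ((a j - a k : ℝ) : ℂ)) * airyp lam k a) (a k) := by
  have h := hasDerivAt_airyInv_update ha hD k
    ⟨deriv (airyA lam), (contDiff_deriv_airyA lam).continuous⟩ (ξ := fun _ => a j)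
    continuous_const (hasDerivAt_const _ _)
  simp only [airyR_endpoint hD ha hjk, zero_add, ← mul_assoc] at h
  simp only [airyp, Function.update_of_ne hjk]
  exact h

/-- In a sum over the endpoints, the `j`-th term compensates the explicit dependence of
`(I - K)⁻¹` on `aⱼ`. -/
theorem sum_airyR_endpoint (ha : StrictMono a) (hD : airyDet lam a ≠ 0) (j : Fin (2 * m))
    (c : Fin (2 * m) → ℂ) :
    ∑ k, endpointSign k * airyR lam a (a j) (a k) * c k
      = endpointSign j * (airyR lam a (a j) (a j) * c j) + ∑ k ∈ Finset.univ.erase j,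
        endpointSign k * ((airyq lam j a * airyp lam k a - airyp lam j a * airyq lam k a)
            / ((a j - a k : ℝ) : ℂ)) * c k := by
  rw [← Finset.add_sum_erase _ _ (Finset.mem_univ j), mul_assoc]
  congr 1
  exact Finset.sum_congr rfl fun k hk => by
    rw [airyR_endpoint hD ha (Finset.ne_of_mem_erase hk).symm]

theorem hasDerivAt_airyq_self (ha : StrictMono a) (hD : airyDet lam a ≠ 0) (j : Fin (2 * m)) :
    HasDerivAt (fun t : ℝ => airyq lam j (Function.update a j t))
      (-(∑ k ∈ Finset.univ.erase j,
          endpointSign k * ((airyq lam j a * airyp lam k a - airyp lam j a * airyq lam k a)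
            / ((a j - a k : ℝ) : ℂ)) * airyq lam k a)
        + airyp lam j a - airyq lam j a * airyu lam a) (a j) := by
  have h := hasDerivAt_airyInv_update ha hD j
    ⟨airyA lam, (contDiff_airyA lam (n := 0)).continuous⟩ (ξ := fun t => t) continuous_id
    (hasDerivAt_airyQ ha hD (a j))
  have hs := sum_airyR_endpoint ha hD j fun k => airyQ lam a (a k)
  simp only [airyq, Function.update_self]
  refine h.congr_deriv ?_
  rw [hs]
  simp only [airyq, airyp, airyQ]
  ring

theorem hasDerivAt_airyp_self (ha : StrictMono a) (hD : airyDet lam a ≠ 0) (j : Fin (2 * m)) :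
    HasDerivAt (fun t : ℝ => airyp lam j (Function.update a j t))
      (-(∑ k ∈ Finset.univ.erase j,
          endpointSign k * ((airyq lam j a * airyp lam k a - airyp lam j a * airyq lam k a)
            / ((a j - a k : ℝ) : ℂ)) * airyp lam k a)
        + (a j : ℂ) * airyq lam j a + airyp lam j a * airyu lam a
        - 2 * airyq lam j a * airyv lam a) (a j) := by
  have h := hasDerivAt_airyInv_update ha hD j
    ⟨deriv (airyA lam), (contDiff_deriv_airyA lam).continuous⟩ (ξ := fun t => t) continuous_id
    (hasDerivAt_airyP ha hD (a j))
  have hs := sum_airyR_endpoint ha hD j fun k => airyP lam a (a k)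
  simp only [airyp, Function.update_self]
  refine h.congr_deriv ?_
  rw [hs]
  simp only [airyq, airyp, airyP]
  ring

theorem hasDerivAt_airyu (ha : StrictMono a) (hD : airyDet lam a ≠ 0) (j : Fin (2 * m)) :
    HasDerivAt (fun t : ℝ => airyu lam (Function.update a j t))
      (endpointSign j * airyq lam j a ^ 2) (a j) := by
  have h := hasDerivAt_integral_airyA_mul_airyInv ha hD j
    ⟨airyA lam, (contDiff_airyA lam (n := 0)).continuous⟩
  rw [sq]
  exact h

theorem hasDerivAt_airyv (ha : StrictMono a) (hD : airyDet lam a ≠ 0) (j : Fin (2 * m)) :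
    HasDerivAt (fun t : ℝ => airyv lam (Function.update a j t))
      (endpointSign j * (airyp lam j a * airyq lam j a)) (a j) := by
  have h := hasDerivAt_integral_airyA_mul_airyInv ha hD j
    ⟨deriv (airyA lam), (contDiff_deriv_airyA lam).continuous⟩
  rw [mul_comm (airyp lam j a)]
  exact h

end Variation

end

theorem mainTheorem1 (lam : ℂ) (m : ℕ) (a : Fin (2 * m) → ℝ) (ha : StrictMono a)
    (hD : airyDet lam a ≠ 0) :
    -- `I - K` is invertible, and `R` is the kernel of `K (I - K)⁻¹`
    IsUnit (1 - airyOp lam a : Module.End ℂ C(ℝ, ℂ)) ∧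
    (∀ (f : C(ℝ, ℂ)) (x : ℝ),
      (airyOp lam a * airyInv lam a : Module.End ℂ C(ℝ, ℂ)) f x
        = ∫ y in airyDomain a, airyR lam a x y * f y) ∧
    (∀ j k, Filter.Tendsto (fun y => airyR lam a (a j) y) (nhdsWithin (a k) (airyDomain a))
      (nhds (airyR lam a (a j) (a k)))) ∧
    -- `d log D = - ∑ (-1)^j R(aⱼ,aⱼ) daⱼ`; near `a`, `log (D(b) / D(a))` is a branch of `log D`
    -- up to a constant
    HasFDerivAt (fun b : Fin (2 * m) → ℝ => Complex.log (airyDet lam b / airyDet lam a))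
      (-∑ j, (ContinuousLinearMap.proj j : (Fin (2 * m) → ℝ) →L[ℝ] ℝ).smulRight
        (endpointSign j * airyR lam a (a j) (a j))) a ∧
    -- the partial derivatives of the `qⱼ`
    (∀ j k, j ≠ k → HasDerivAt (fun t : ℝ => airyq lam j (Function.update a k t))
      (endpointSign k * ((airyq lam j a * airyp lam k a - airyp lam j a * airyq lam k a)
        / ((a j - a k : ℝ) : ℂ)) * airyq lam k a) (a k)) ∧
    -- the partial derivatives of the `pⱼ`
    (∀ j k, j ≠ k → HasDerivAt (fun t : ℝ => airyp lam j (Function.update a k t))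
      (endpointSign k * ((airyq lam j a * airyp lam k a - airyp lam j a * airyq lam k a)
        / ((a j - a k : ℝ) : ℂ)) * airyp lam k a) (a k)) ∧
    (∀ j, HasDerivAt (fun t : ℝ => airyq lam j (Function.update a j t))
      (-(∑ k ∈ Finset.univ.erase j,
          endpointSign k * ((airyq lam j a * airyp lam k a - airyp lam j a * airyq lam k a)
            / ((a j - a k : ℝ) : ℂ)) * airyq lam k a)
        + airyp lam j a - airyq lam j a * airyu lam a) (a j)) ∧
    (∀ j, HasDerivAt (fun t : ℝ => airyp lam j (Function.update a j t))
      (-(∑ k ∈ Finset.univ.erase j,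
          endpointSign k * ((airyq lam j a * airyp lam k a - airyp lam j a * airyq lam k a)
            / ((a j - a k : ℝ) : ℂ)) * airyp lam k a)
        + (a j : ℂ) * airyq lam j a + airyp lam j a * airyu lam a
        - 2 * airyq lam j a * airyv lam a) (a j)) ∧
    -- the partial derivatives of `u` and `v`
    (∀ j, HasDerivAt (fun t : ℝ => airyu lam (Function.update a j t))
      (endpointSign j * airyq lam j a ^ 2) (a j)) ∧
    (∀ j, HasDerivAt (fun t : ℝ => airyv lam (Function.update a j t))
      (endpointSign j * (airyp lam j a * airyq lam j a)) (a j)) ∧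
    -- the diagonal values of the resolvent kernel
    (∀ j, airyR lam a (a j) (a j)
      = (∑ k ∈ Finset.univ.erase j,
          endpointSign k * ((airyq lam j a * airyp lam k a - airyp lam j a * airyq lam k a) ^ 2
            / ((a j - a k : ℝ) : ℂ)))
        + airyp lam j a ^ 2 - (a j : ℂ) * airyq lam j a ^ 2
        - 2 * airyp lam j a * airyq lam j a * airyu lam a
        + 2 * airyq lam j a ^ 2 * airyv lam a) ∧
    -- the two auxiliary relations
    2 * airyv lam a - airyu lam a ^ 2 = ∑ j, endpointSign j * airyq lam j a ^ 2 ∧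
    ∑ j, endpointSign j * airyR lam a (a j) (a j) = -airyu lam a := by
  refine ⟨isUnit_one_sub_airyOp hD, airyOp_mul_airyInv_apply hD, fun j k => ?_,
    hasFDerivAt_log_airyDet ha hD, fun j k => hasDerivAt_airyq_of_ne ha hD,
    fun j k => hasDerivAt_airyp_of_ne ha hD, hasDerivAt_airyq_self ha hD,
    hasDerivAt_airyp_self ha hD, hasDerivAt_airyu ha hD, hasDerivAt_airyv ha hD,
    airyR_diag_endpoint ha hD, two_mul_airyv_sub ha hD, sum_endpointSign_mul_airyR ha hD⟩
  have hR : Continuous fun y => airyR lam a (a j) y :=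
    (continuous_airyR hD).comp (by fun_prop : Continuous fun y : ℝ => (a j, y))
  exact (hR.tendsto (a k)).mono_left nhdsWithin_le_nhds
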